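/- **Setting.** Let $C>0$ and let $\mathbf m=(m_x)_{x\in\mathbb Z}$ be i.i.d. with an arbitrary common law on $[C^{-1},C]$; write $\Omega_{\mathcal D}=[C^{-1},C]^{\mathbb Z}$ and $\mathbb P$ for the law of $\mathbf m$. Let $\mu_1$ be the law on $\Omega=\mathbb R^{\mathbb Z}$ of independent standard Gaussian variables $(\omega_x)_{x\in\mathbb Z}$, let $\mathbb E_1^\star$ be the expectation under $\mathbb P_1^\star=\mathbb P\otimes\mu_1$, and $\mathbb E_1^\star[f,g]=\mathbb E_1^\star[fg]$. Let $\gamma,\lambda>0$ and $\chi(1)=\mathbb E_1^\star[\omega_0^4]-\mathbb E_1^\star[\omega_0^2]^2$. For $f:\Omega_{\mathcal D}\times\Omega\to\mathbb R$ put $\tau_xf(\mathbf m,\omega)=f((m_{x+z})_z,(\omega_{x+z})_z)$, $\nabla_xf(\mathbf m,\omega)=f(\mathbf m,\omega^x)-f(\mathbf m,\omega)$ and $\nabla_{x,x+1}f(\mathbf m,\omega)=f(\mathbf m,\omega^{x,x+1})-f(\mathbf m,\omega)$, where $\omega^x$ is $\omega$ with the sign of $\omega_x$ flipped and $\omega^{x,x+1}$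 is $\omega$ with $\omega_x,\omega_{x+1}$ exchanged. A cylinder function is one that depends on finitely many of the $m_x,\omega_x$ only. For a cylinder function $g$ put $\nabla_0\Gamma_g=\sum_{x\in\mathbb Z}\nabla_0(\tau_xg)$ and $\nabla_{0,1}\Gamma_g=\sum_{x\in\mathbb Z}\nabla_{0,1}(\tau_xg)$ (finite sums). * $\mathcal Q$ is the set of functions $g(\mathbf m,\omega)=\sum_{i}\psi_{i,i}(\mathbf m)(\omega_{i+1}^2-\omega_i^2)+\sum_{i\neq j}\psi_{i,j}(\mathbf m)\omega_i\omega_j$ with continuous cylinder functions $\psi_{i,j}=\psi_{j,i}$ of $\mathbf m$, all but finitely many of them zero. * $\mathcal Q_0$ is the set of cylinder functions $\varphi=\sum_{x\in\Lambda}\{\nabla_xF_x+\nabla_{x,x+1}G_x\}$ with $\Lambda\subset\mathbb Z$ finite and $F_x,G_x$ measurable cylinder functions that are continuous in $\mathbf m$ for every $\omega$ and, for every $\mathbf m$, homogeneous polynomials of degree two in $\omega$. * For $\ell\in\mathbb N$, $\Lambda_\ell=\{-\ell,\dots,\ell\}$ and $\mathcal S_{\Lambda_\ell}=\gamma\sum_{x\in\Lambda_\ell}\nabla_x+\lambda\sum_{x,x+1\in\Lambda_\ell}\nabla_{x,x+1}$.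 * $\ll\varphi,g\gg_{1,\star}=\sum_{x\in\mathbb Z}\mathbb E_1^\star[\varphi\,\tau_xg]$ and $\ll\varphi\gg_{1,\star\star}=\sum_{x\in\mathbb Z}x\,\mathbb E_1^\star[\varphi\,\omega_x^2]$. * For $\varphi\in\mathcal Q_0$, $$|||\varphi|||_1^2=\sup_{g\in\mathcal Q}\Big\{2\ll\varphi,g\gg_{1,\star}+\frac1\lambda\frac{\ll\varphi\gg_{1,\star\star}^2}{\chi(1)}-\frac\lambda2\mathbb E_1^\star\big[(\nabla_{0,1}\Gamma_g)^2\big]-\frac\gamma2\mathbb E_1^\star\big[(\nabla_0\Gamma_g)^2\big]\Big\}.$$ **Theorem.** Let $\varphi\in\mathcal Q_0$, let $s_\varphi$ be the smallest positive integer $s$ such that $\varphi$ depends only on $\{m_x,\omega_x:|x|\le s\}$, and let $\ell_\varphi=\ell-s_\varphi-1$. Then $|||\varphi|||_1^2$ is finite, it also equals $$\sup_{g\in\mathcal Q,\,a\in\mathbb R}\Big\{2\ll\varphi,g\gg_{1,\star}+2a\ll\varphi\gg_{1,\star\star}-\frac\lambda2\mathbb E_1^\star\big[(a(\omega_0^2-\omega_1^2)+\nabla_{0,1}\Gamma_g)^2\big]-\frac\gamma2\mathbb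 E_1^\star\big[(\nabla_0\Gamma_g)^2\big]\Big\},$$ and for every $\ell$ the equation $-\mathcal S_{\Lambda_\ell}u=\sum_{|x|\le\ell_\varphi}\tau_x\varphi$ has a solution $u\in \mathbf L^2(\mathbb P_1^\star)$ (a value of $(-\mathcal S_{\Lambda_\ell})^{-1}\sum_{|x|\le\ell_\varphi}\tau_x\varphi$). For any choice of these solutions, $$\lim_{\ell\to\infty}(2\ell)^{-1}\,\mathbb E_1^\star\Big[(-\mathcal S_{\Lambda_\ell})^{-1}\sum_{|x|\le\ell_\varphi}\tau_x\varphi,\ \sum_{|x|\le\ell_\varphi}\tau_x\varphi\Big]=|||\varphi|||_1^2 .$$ -/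

import Mathlib

noncomputable section

namespace HarmonicChain

open MeasureTheory ProbabilityTheory

/-- Disorder configurations: masses `m x ∈ [C⁻¹, C]`, indexed by `x ∈ ℤ`. -/
abbrev Disorder (C : ℝ) : Type := ℤ → Set.Icc C⁻¹ C

/-- Particle configurations on the infinite line. -/
abbrev Config : Type := ℤ → ℝ

/-- Real functions of the disorder and of the configuration. -/
abbrev Fn (C : ℝ) : Type := Disorder C → Config → ℝ

variable {C : ℝ}

/-- The Gibbs measure at inverse temperature one: independent standard Gaussian variables. -/
def gibbs : Measure Config := Measure.infinitePi fun _ : ℤ => gaussianReal 0 1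

/-- The law of the disorder (i.i.d. with one-site law `ν`) times the Gibbs measure. -/
def starMeasure (ν : Measure (Set.Icc C⁻¹ C)) [IsProbabilityMeasure ν] :
    Measure (Disorder C × Config) :=
  (Measure.infinitePi fun _ : ℤ => ν).prod gibbs

/-- Expectation with respect to `starMeasure ν`. -/
def starE (ν : Measure (Set.Icc C⁻¹ C)) [IsProbabilityMeasure ν] (f : Fn C) : ℝ :=
  ∫ p, f p.1 p.2 ∂(starMeasure ν)

/-- The static compressibility: the variance of the one-site energy. -/
def chi : ℝ := (∫ ω : Config, ω 0 ^ 4 ∂gibbs) - (∫ ω : Config, ω 0 ^ 2 ∂gibbs) ^ 2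

/-- The configuration with the sign at site `x` flipped. -/
def flip (x : ℤ) (ω : Config) : Config := Function.update ω x (-ω x)

/-- The configuration with the values at `x` and `x + 1` exchanged. -/
def exch (x : ℤ) (ω : Config) : Config := fun z => ω (Equiv.swap x (x + 1) z)

/-- The translated function `τ_x f`. -/
def shift (x : ℤ) (f : Fn C) : Fn C :=
  fun m ω => f (fun z => m (x + z)) (fun z => ω (x + z))

/-- `∇_x f`. -/
def gradFlip (x : ℤ) (f : Fn C) : Fn C := fun m ω => f m (flip x ω) - f m ω

/-- `∇_{x,x+1} f`. -/
def gradExch (x : ℤ) (f : Fn C) : Fn C := fun m ω => f m (exch x ω) - f m ω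

/-- `f` only depends on the `m x` and `ω x` with `x ∈ Λ`. -/
def LocalOn (f : Fn C) (Λ : Set ℤ) : Prop :=
  ∀ (m m' : Disorder C) (ω ω' : Config), (∀ x ∈ Λ, m x = m' x ∧ ω x = ω' x) → f m ω = f m' ω'

/-- Cylinder functions. -/
def IsCylinder (f : Fn C) : Prop := ∃ Λ : Finset ℤ, LocalOn f (Λ : Set ℤ)

/-- `s_f`: the smallest positive integer `s` such that the support of `f` is in `{-s, …, s}`. -/
def supportRadius (f : Fn C) : ℕ :=
  sInf {s : ℕ | 0 < s ∧ LocalOn f (Set.Icc (-(s : ℤ)) (s : ℤ))}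

/-- The set `𝒬` of quadratic cylinder functions with null average. The coefficients `ψ i j` are
continuous cylinder functions of the disorder, hence measurable. -/
def IsQuadratic (f : Fn C) : Prop :=
  ∃ (I : Finset ℤ) (ψ : ℤ → ℤ → Disorder C → ℝ),
    (∀ i j, Continuous (ψ i j)) ∧
    (∀ i j, ∃ Λ : Finset ℤ, DependsOn (ψ i j) (Λ : Set ℤ)) ∧
    (∀ i j, (i ∉ I ∨ j ∉ I) → ψ i j = 0) ∧
    (∀ i j, ψ i j = ψ j i) ∧
    ∀ m ω, f m ω = (∑ i ∈ I, ψ i i m * (ω (i + 1) ^ 2 - ω i ^ 2)) +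
      ∑ i ∈ I, ∑ j ∈ I, if i ≠ j then ψ i j m * (ω i * ω j) else 0

/-- The functions `F_x`, `G_x` allowed in the definition of `𝒬₀`: measurable cylinder functions,
continuous in the disorder, square integrable in `ω`, and homogeneous polynomials of degree two
in `ω`. -/
structure IsHomQuadratic (f : Fn C) : Prop where
  cylinder : IsCylinder f
  measurable : Measurable fun p : Disorder C × Config => f p.1 p.2
  continuous : ∀ ω, Continuous fun m => f m ω
  memLp : ∀ m, MemLp (f m) 2 gibbs
  homogeneous : ∀ m, ∃ p : MvPolynomial ℤ ℝ,
    p.IsHomogeneous 2 ∧ ∀ ω, f m ω = MvPolynomial.eval ω p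

/-- The set `𝒬₀`. -/
def IsQZero (φ : Fn C) : Prop :=
  IsCylinder φ ∧ ∃ (Λ : Finset ℤ) (F G : ℤ → Fn C),
    (∀ x ∈ Λ, IsHomQuadratic (F x) ∧ IsHomQuadratic (G x)) ∧
    ∀ m ω, φ m ω = ∑ x ∈ Λ, (gradFlip x (F x) m ω + gradExch x (G x) m ω)

/-- The restriction `S_{Λ_ℓ}` of the generator of the noise (flips at rate `γ`, exchanges at
rate `lam`) to the box `Λ_ℓ = {-ℓ, …, ℓ}`: flips of the sites of the box, and exchanges along
the bonds `{x, x + 1}` with both ends in the box. -/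
def boxGenerator (γ lam : ℝ) (ℓ : ℕ) (f : Fn C) : Fn C := fun m ω =>
  γ * (∑ x ∈ Finset.Icc (-(ℓ : ℤ)) (ℓ : ℤ), gradFlip x f m ω) +
  lam * (∑ x ∈ Finset.Ico (-(ℓ : ℤ)) (ℓ : ℤ), gradExch x f m ω)

/-- `∑_{|x| ≤ ℓ_φ} τ_x φ`, where `ℓ_φ = ℓ - s_φ - 1` (an empty sum if `ℓ_φ < 0`). -/
def boxSum (φ : Fn C) (ℓ : ℕ) : Fn C := fun m ω =>
  ∑ x ∈ Finset.Icc (-((ℓ : ℤ) - supportRadius φ - 1)) ((ℓ : ℤ) - supportRadius φ - 1),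
    shift x φ m ω

/-- `u` is a value of `(-S_{Λ_ℓ})⁻¹ Φ` in `L²`: a square integrable solution of
`-S_{Λ_ℓ} u = Φ`. -/
def IsInverse (ν : Measure (Set.Icc C⁻¹ C)) [IsProbabilityMeasure ν] (γ lam : ℝ) (ℓ : ℕ)
    (u Φ : Fn C) : Prop :=
  MemLp (fun p : Disorder C × Config => u p.1 p.2) 2 (starMeasure ν) ∧
  ∀ᵐ p ∂(starMeasure ν), -boxGenerator γ lam ℓ u p.1 p.2 = Φ p.1 p.2

/-- `≪g, h≫_⋆`. -/
def starInner (ν : Measure (Set.Icc C⁻¹ C)) [IsProbabilityMeasure ν] (g h : Fn C) : ℝ :=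
  ∑' x : ℤ, starE ν fun m ω => g m ω * shift x h m ω

/-- `≪g≫_⋆⋆`. -/
def starStar (ν : Measure (Set.Icc C⁻¹ C)) [IsProbabilityMeasure ν] (g : Fn C) : ℝ :=
  ∑' x : ℤ, (x : ℝ) * starE ν fun m ω => g m ω * ω x ^ 2

/-- `∇_0 Γ_g`, where `Γ_g = ∑_x τ_x g` is a formal sum. -/
def gradFlipGamma (g : Fn C) : Fn C := fun m ω => ∑' x : ℤ, gradFlip 0 (shift x g) m ω

/-- `∇_{0,1} Γ_g`, where `Γ_g = ∑_x τ_x g` is a formal sum. -/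
def gradExchGamma (g : Fn C) : Fn C := fun m ω => ∑' x : ℤ, gradExch 0 (shift x g) m ω

/-- The values, for `g ∈ 𝒬`, whose supremum is the squared semi-norm of `φ`. -/
def normValues (ν : Measure (Set.Icc C⁻¹ C)) [IsProbabilityMeasure ν] (γ lam : ℝ) (φ : Fn C) :
    Set ℝ :=
  {r | ∃ g : Fn C, IsQuadratic g ∧
    r = 2 * starInner ν φ g + 1 / lam * (starStar ν φ ^ 2 / chi)
      - lam / 2 * starE ν (fun m ω => gradExchGamma g m ω ^ 2)
      - γ / 2 * starE ν (fun m ω => gradFlipGamma g m ω ^ 2)}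

/-- The squared semi-norm of `φ`. -/
def seminormSq (ν : Measure (Set.Icc C⁻¹ C)) [IsProbabilityMeasure ν] (γ lam : ℝ) (φ : Fn C) :
    ℝ :=
  sSup (normValues ν γ lam φ)

/-- The values, for `g ∈ 𝒬` and `a ∈ ℝ`, in the second variational formula for the squared
semi-norm. -/
def normValuesBis (ν : Measure (Set.Icc C⁻¹ C)) [IsProbabilityMeasure ν] (γ lam : ℝ)
    (φ : Fn C) : Set ℝ :=
  {r | ∃ (g : Fn C) (a : ℝ), IsQuadratic g ∧
    r = 2 * starInner ν φ g + 2 * a * starStar ν φ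
      - (lam / 2 * starE ν (fun m ω => (a * (ω 0 ^ 2 - ω 1 ^ 2) + gradExchGamma g m ω) ^ 2)
        + γ / 2 * starE ν (fun m ω => gradFlipGamma g m ω ^ 2))}

end HarmonicChain

end

/-! ### Abstract flips, exchanges and translations: Dirichlet form and dual seminorm. -/

noncomputable section

namespace HarmonicChain

open MeasureTheory ProbabilityTheory Filter Topology

/-! Let `D` be the Dirichlet form of the box, `Φ = ∑ τ_x φ` and `-S u = Φ`. For every test vector
`h` one has `⟨u, Φ⟩ = 2⟨h, Φ⟩ - D(h) + D(u - h)` (`inner_eq_add_dir`). Take `h = ∑ τ_x g + a ∑ x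
ω_x²`. Away from the edges its gradients are translates of `∇_0 Γ_g` and of `a(ω_0² - ω_1²) +
∇_{0,1} Γ_g`, so `(2ℓ)⁻¹(2⟨h, Φ⟩ - D(h))` converges to the element of `normValuesBis` given by `(g,
a)` (`tendsto_functional`). As `D ≥ 0`, this is the lower bound.

For the upper bound, `D(u - h)` must be made `o(ℓ)`, up to an arbitrarily small multiple of `ℓ`.
Since `Φ + S h = -S (u - h)`, it suffices to bound `Φ + S h` by `ε √ℓ + O(1)` in the seminorm dual
to `D`; this is `Approx`. A sum of translates of a vector that is odd under one flip or one exchange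
has dual seminorm at most `const · ‖f‖ · √(number of translates)` (`IsOdd.hNeg_sum`), so small `L²`
norms suffice.

Elements of `𝒬₀` are combinations of `ψ(m) ω_i ω_j`, `i ≠ j`, and of bond gradients `ψ(m)(ω_{i+1}² -
ω_i²)`, all of them odd. Calculate modulo images of the generator and coboundaries `f - τ_1 f`,
which cost `O(1)`. For an off-diagonal monomial, the flips contribute `-4γ` and the at most four
bonds that act contribute terms of the same kind, so a bound valid for all such monomials improves
by the factor `λ/(γ + λ)`; iterating makes it arbitrarily small (`approx_mon`). For a bond gradient,
the generator acts as a discrete Laplacian in the bond, hence, modulo coboundaries, in the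
translations of `ψ`. So `ψ` may be replaced by the average of its translates over `{-n, …, n}`. If
`ψ` is centered, independence of the masses makes this average `O(n^{-1/2})` in `L²`
(`approx_bnd_of_mean_zero`). If `ψ` is constant, the bond gradient is a gradient of `∑ x ω_x²`,
which is why the parameter `a` appears.

Finally `ω_0² - ω_1²` is orthogonal to `∇_{0,1} Γ_g`, so the maximization over `a` is explicit and
turns the second formula into the first. -/

/-- Involutions `flip x`, `exch x` of a Hilbert space, indexed by the sites and the bonds of `ℤ`,
with a compatible isometric action of the translations of `ℤ`. -/
structure LatticeRep (H : Type*) [NormedAddCommGroup H] [InnerProductSpace ℝ H] where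
  flip : ℤ → H →ₗ[ℝ] H
  exch : ℤ → H →ₗ[ℝ] H
  shift : ℤ → H →ₗ[ℝ] H
  flip_flip : ∀ x v, flip x (flip x v) = v
  exch_exch : ∀ x v, exch x (exch x v) = v
  inner_flip : ∀ x v w, inner ℝ (flip x v) w = inner ℝ v (flip x w)
  inner_exch : ∀ x v w, inner ℝ (exch x v) w = inner ℝ v (exch x w)
  inner_shift : ∀ x v w, inner ℝ (shift x v) (shift x w) = inner ℝ v w
  shift_zero : ∀ v, shift 0 v = v
  shift_shift : ∀ x y v, shift x (shift y v) = shift (x + y) v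
  shift_flip : ∀ x y v, shift x (flip y v) = flip (x + y) (shift x v)
  shift_exch : ∀ x y v, shift x (exch y v) = exch (x + y) (shift x v)

lemma sum_Icc_sub_eq {M : Type*} [AddCommMonoid M] (f : ℤ → M) (L x : ℤ) :
    ∑ y ∈ Finset.Icc (-L) L, f (y - x) = ∑ z ∈ Finset.Icc (-L - x) (L - x), f z := by
  refine Finset.sum_nbij' (· - x) (· + x) ?_ ?_ (by simp) (by simp) (by simp)
  all_goals
    intro y hy
    simp only [Finset.mem_Icc] at hy ⊢
    omega

lemma sum_Icc_sub_of_support {M : Type*} [AddCommMonoid M] (f : ℤ → M) (t : ℤ)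
    (hf : ∀ z, t < |z| → f z = 0) (L x : ℤ) (h : |x| + t ≤ L) :
    ∑ y ∈ Finset.Icc (-L) L, f (y - x) = ∑ z ∈ Finset.Icc (-t) t, f z := by
  rw [sum_Icc_sub_eq]
  symm
  apply Finset.sum_subset
  · intro z hz
    simp only [Finset.mem_Icc] at hz ⊢
    have := abs_le.1 (le_refl |x|)
    omega
  · intro z _ hz
    apply hf
    simp only [Finset.mem_Icc] at hz
    by_contra hc
    exact hz (abs_le.1 (not_lt.1 hc))

lemma norm_sum_Icc_sub_le {M : Type*} [NormedAddCommGroup M] (f : ℤ → M) (t : ℤ)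
    (hf : ∀ z, t < |z| → f z = 0) (L x : ℤ) :
    ‖∑ y ∈ Finset.Icc (-L) L, f (y - x)‖ ≤ ∑ z ∈ Finset.Icc (-t) t, ‖f z‖ := by
  rw [sum_Icc_sub_eq]
  refine (norm_sum_le _ _).trans ?_
  rw [← Finset.sum_filter_ne_zero]
  refine Finset.sum_le_sum_of_subset_of_nonneg ?_ fun _ _ _ => norm_nonneg _
  intro z hz
  rw [Finset.mem_Icc, ← abs_le]
  by_contra hc
  exact (Finset.mem_filter.1 hz).2 (by simp [hf z (not_le.1 hc)])

/-- Averages over boxes of quantities that are constant in the bulk and bounded at the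
boundary. -/
lemma tendsto_average (A : ℕ → Finset ℤ) (F : ℕ → ℤ → ℝ) (v K : ℝ) (q : ℕ)
    (hA : ∀ ℓ : ℕ, Finset.Icc (-((ℓ : ℤ) - q)) ((ℓ : ℤ) - q) ⊆ A ℓ)
    (hA' : ∀ ℓ : ℕ, A ℓ ⊆ Finset.Icc (-(ℓ : ℤ)) ℓ)
    (hv : ∀ ℓ : ℕ, ∀ x ∈ Finset.Icc (-((ℓ : ℤ) - q)) ((ℓ : ℤ) - q), F ℓ x = v)
    (hK : ∀ ℓ : ℕ, ∀ x ∈ A ℓ, |F ℓ x| ≤ K) :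
    Tendsto (fun ℓ : ℕ => (2 * (ℓ : ℝ))⁻¹ * ∑ x ∈ A ℓ, F ℓ x) atTop (𝓝 v) := by
  -- The inner interval has `2(ℓ - q) + 1` points, where the value is exactly `v`, and at most `2q`
  -- other points remain, so the error is bounded uniformly in `ℓ`.
  have hbound : ∀ ℓ : ℕ, q ≤ ℓ → |∑ x ∈ A ℓ, F ℓ x - 2 * ℓ * v| ≤ 2 * q * |K| + (2 * q + 1) * |v| := by
    intro ℓ hℓ
    set I := Finset.Icc (-((ℓ : ℤ) - q)) ((ℓ : ℤ) - q) with hI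
    have hIc : (I.card : ℝ) = 2 * (ℓ - q) + 1 := by
      have : (I.card : ℤ) = 2 * (ℓ - q) + 1 := by
        rw [hI, Int.card_Icc, Int.toNat_of_nonneg] <;> omega
      exact_mod_cast this
    have hAc : ((A ℓ \ I).card : ℝ) ≤ 2 * q := by
      have h1 := Finset.card_le_card (hA' ℓ)
      rw [Int.card_Icc] at h1
      have h2 := Finset.card_sdiff_add_card_eq_card (hA ℓ)
      rw [← hI] at h2
      have h3 : (I.card : ℤ) = 2 * (ℓ - q) + 1 := by
        rw [hI, Int.card_Icc, Int.toNat_of_nonneg] <;> omega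
      have : ((A ℓ \ I).card : ℤ) ≤ 2 * q := by omega
      exact_mod_cast this
    rw [← Finset.sum_sdiff (hA ℓ), Finset.sum_congr rfl (hv ℓ), Finset.sum_const, nsmul_eq_mul, hIc]
    have h1 : |∑ x ∈ A ℓ \ I, F ℓ x| ≤ 2 * q * |K| := by
      refine (Finset.abs_sum_le_sum_abs _ _).trans ?_
      calc ∑ x ∈ A ℓ \ I, |F ℓ x| ≤ ∑ x ∈ A ℓ \ I, |K| :=
            Finset.sum_le_sum fun x hx =>
              (hK ℓ x (Finset.mem_sdiff.1 hx).1).trans (le_abs_self K)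
        _ = (A ℓ \ I).card * |K| := by rw [Finset.sum_const, nsmul_eq_mul]
        _ ≤ _ := by gcongr
    have h2 : ∑ x ∈ A ℓ \ I, F ℓ x + (2 * ((ℓ : ℝ) - q) + 1) * v - 2 * ℓ * v
        = ∑ x ∈ A ℓ \ I, F ℓ x + (1 - 2 * q) * v := by ring
    rw [h2]
    refine (abs_add_le _ _).trans (add_le_add h1 ?_)
    rw [abs_mul]
    gcongr
    rw [abs_le]
    constructor <;> linarith [Nat.cast_nonneg (α := ℝ) q]
  rw [tendsto_iff_norm_sub_tendsto_zero]
  have hlim : Tendsto (fun ℓ : ℕ => (2 * (ℓ : ℝ))⁻¹ * (2 * q * |K| + (2 * q + 1) * |v|)) atTop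
      (𝓝 0) := by
    rw [← zero_mul (2 * q * |K| + (2 * q + 1) * |v|)]
    apply Tendsto.mul_const
    exact tendsto_inv_atTop_zero.comp
      ((tendsto_natCast_atTop_atTop (R := ℝ)).const_mul_atTop two_pos)
  refine squeeze_zero' (Eventually.of_forall fun _ => norm_nonneg _) ?_ hlim
  filter_upwards [eventually_ge_atTop (q + 1)] with ℓ hℓ
  have hpos : (0 : ℝ) < 2 * ℓ := by
    have : 0 < ℓ := by omega
    positivity
  have : (2 * (ℓ : ℝ))⁻¹ * ∑ x ∈ A ℓ, F ℓ x - v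
      = (2 * (ℓ : ℝ))⁻¹ * (∑ x ∈ A ℓ, F ℓ x - 2 * ℓ * v) := by
    rw [mul_sub, ← mul_assoc, inv_mul_cancel₀ hpos.ne', one_mul]
  rw [this, norm_mul, Real.norm_eq_abs, Real.norm_eq_abs, abs_of_pos (inv_pos.2 hpos)]
  gcongr
  exact hbound ℓ (by omega)

namespace LatticeRep

variable {H : Type*} [NormedAddCommGroup H] [InnerProductSpace ℝ H] (R : LatticeRep H)
  (γ lam : ℝ)

lemma norm_shift (x : ℤ) (v : H) : ‖R.shift x v‖ = ‖v‖ := by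
  have := R.inner_shift x v v
  rw [real_inner_self_eq_norm_sq, real_inner_self_eq_norm_sq] at this
  exact (pow_left_inj₀ (norm_nonneg _) (norm_nonneg _) two_ne_zero).1 this

lemma inner_shift_shift (x y : ℤ) (v w : H) :
    inner ℝ (R.shift x v) (R.shift y w) = inner ℝ v (R.shift (y - x) w) := by
  rw [← R.inner_shift x v, R.shift_shift, add_sub_cancel]

lemma flip_shift (x y : ℤ) (v : H) :
    R.flip x (R.shift y v) = R.shift y (R.flip (x - y) v) := by
  rw [R.shift_flip, add_sub_cancel]

lemma exch_shift (x y : ℤ) (v : H) :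
    R.exch x (R.shift y v) = R.shift y (R.exch (x - y) v) := by
  rw [R.shift_exch, add_sub_cancel]

lemma norm_flip_sub_sq (x : ℤ) (v : H) :
    ‖R.flip x v - v‖ ^ 2 = -2 * inner ℝ v (R.flip x v - v) := by
  have h : inner ℝ (R.flip x v) (R.flip x v) = inner ℝ v v := by rw [R.inner_flip, R.flip_flip]
  rw [← real_inner_self_eq_norm_sq, inner_sub_left, inner_sub_right, inner_sub_right, h,
    R.inner_flip]
  ring

lemma norm_exch_sub_sq (x : ℤ) (v : H) :
    ‖R.exch x v - v‖ ^ 2 = -2 * inner ℝ v (R.exch x v - v) := by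
  have h : inner ℝ (R.exch x v) (R.exch x v) = inner ℝ v v := by rw [R.inner_exch, R.exch_exch]
  rw [← real_inner_self_eq_norm_sq, inner_sub_left, inner_sub_right, inner_sub_right, h,
    R.inner_exch]
  ring

/-- The generator of flips and exchanges in the box `{-ℓ, …, ℓ}`. -/
def gen (ℓ : ℕ) : H →ₗ[ℝ] H :=
  γ • ∑ x ∈ Finset.Icc (-(ℓ : ℤ)) ℓ, (R.flip x - LinearMap.id) +
    lam • ∑ x ∈ Finset.Ico (-(ℓ : ℤ)) ℓ, (R.exch x - LinearMap.id)

lemma gen_apply (ℓ : ℕ) (v : H) : R.gen γ lam ℓ v =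
    γ • ∑ x ∈ Finset.Icc (-(ℓ : ℤ)) ℓ, (R.flip x v - v) +
    lam • ∑ x ∈ Finset.Ico (-(ℓ : ℤ)) ℓ, (R.exch x v - v) := by
  simp [gen, LinearMap.sum_apply]

/-- The Dirichlet form of `gen`. -/
def dir (ℓ : ℕ) (v : H) : ℝ :=
  γ / 2 * ∑ x ∈ Finset.Icc (-(ℓ : ℤ)) ℓ, ‖R.flip x v - v‖ ^ 2 +
    lam / 2 * ∑ x ∈ Finset.Ico (-(ℓ : ℤ)) ℓ, ‖R.exch x v - v‖ ^ 2

lemma inner_gen_self (ℓ : ℕ) (v : H) : inner ℝ v (R.gen γ lam ℓ v) = -R.dir γ lam ℓ v := by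
  rw [gen_apply, dir]
  simp only [norm_flip_sub_sq, norm_exch_sub_sq, inner_add_right, inner_smul_right, inner_sum,
    ← Finset.mul_sum]
  ring

lemma inner_gen_comm (ℓ : ℕ) (v w : H) :
    inner ℝ v (R.gen γ lam ℓ w) = inner ℝ (R.gen γ lam ℓ v) w := by
  rw [gen_apply, gen_apply]
  simp only [inner_add_right, inner_add_left, inner_smul_right, inner_smul_left, inner_sum,
    sum_inner, inner_sub_left, inner_sub_right, R.inner_flip, R.inner_exch]
  simp

lemma dir_nonneg {γ lam : ℝ} (hγ : 0 < γ) (hlam : 0 < lam) (ℓ : ℕ) (v : H) :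
    0 ≤ R.dir γ lam ℓ v := by
  unfold dir; positivity

lemma dir_neg (ℓ : ℕ) (v : H) : R.dir γ lam ℓ (-v) = R.dir γ lam ℓ v := by
  have h1 : R.gen γ lam ℓ (-v) = -R.gen γ lam ℓ v := map_neg _ _
  have := R.inner_gen_self γ lam ℓ (-v)
  rw [h1, inner_neg_neg, R.inner_gen_self] at this
  linarith

/-- If `-gen u = Φ`, the variational functional at `h` misses its maximum by the Dirichlet form
of `u - h`. -/
lemma inner_eq_add_dir (ℓ : ℕ) {u Φ : H} (hu : -R.gen γ lam ℓ u = Φ) (h : H) :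
    inner ℝ u Φ = 2 * inner ℝ h Φ - R.dir γ lam ℓ h + R.dir γ lam ℓ (u - h) := by
  have h1 := R.inner_gen_self γ lam ℓ (u - h)
  have h2 := R.inner_gen_self γ lam ℓ h
  have h3 := R.inner_gen_comm γ lam ℓ u h
  subst hu
  rw [map_sub, inner_sub_left, inner_sub_right, inner_sub_right] at h1
  simp only [inner_neg_right]
  rw [real_inner_comm h] at h3
  linarith

/-- The functional `⟪W, ·⟫` is bounded by `B` in the seminorm dual to the Dirichlet form. -/
def HNeg (ℓ : ℕ) (W : H) (B : ℝ) : Prop :=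
  ∀ v, inner ℝ W v ≤ B * √(R.dir γ lam ℓ v)

variable {R γ lam}

lemma HNeg.zero (ℓ : ℕ) : R.HNeg γ lam ℓ 0 0 := fun v => by simp

lemma HNeg.mono {ℓ : ℕ} {W : H} {B B' : ℝ} (h : R.HNeg γ lam ℓ W B) (hB : B ≤ B') :
    R.HNeg γ lam ℓ W B' :=
  fun v => (h v).trans (by gcongr)

lemma HNeg.add {ℓ : ℕ} {W W' : H} {B B' : ℝ} (h : R.HNeg γ lam ℓ W B)
    (h' : R.HNeg γ lam ℓ W' B') : R.HNeg γ lam ℓ (W + W') (B + B') := fun v => by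
  rw [inner_add_left, add_mul]
  exact add_le_add (h v) (h' v)

/-- `HNeg` is a one-sided bound, but the Dirichlet form is even, so testing against `-v` gives the
other side. -/
lemma HNeg.neg {ℓ : ℕ} {W : H} {B : ℝ} (h : R.HNeg γ lam ℓ W B) :
    R.HNeg γ lam ℓ (-W) B := fun v => by
  have := h (-v)
  rwa [dir_neg, inner_neg_right, ← inner_neg_left] at this

lemma HNeg.smul {ℓ : ℕ} {W : H} {B : ℝ} (h : R.HNeg γ lam ℓ W B) (c : ℝ) :
    R.HNeg γ lam ℓ (c • W) (|c| * B) := by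
  have key : ∀ c : ℝ, 0 ≤ c → R.HNeg γ lam ℓ (c • W) (|c| * B) := fun c hc v => by
    rw [real_inner_smul_left, abs_of_nonneg hc, mul_assoc]
    exact mul_le_mul_of_nonneg_left (h v) hc
  rcases le_total 0 c with hc | hc
  · exact key c hc
  · have := (key (-c) (by linarith)).neg
    rwa [neg_smul, neg_neg, abs_neg] at this

lemma HNeg.sum {ι : Type*} {ℓ : ℕ} (A : Finset ι) {W : ι → H} {B : ι → ℝ}
    (h : ∀ i ∈ A, R.HNeg γ lam ℓ (W i) (B i)) :
    R.HNeg γ lam ℓ (∑ i ∈ A, W i) (∑ i ∈ A, B i) := fun v => by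
  rw [sum_inner, Finset.sum_mul]
  exact Finset.sum_le_sum fun i hi => h i hi v

/-- The vector `Φ + gen h` is `-gen (u - h)`, and its pairing with `u - h` is the Dirichlet form
`d²`. Testing the dual bound at `u - h` gives `d² ≤ B d`. -/
lemma HNeg.dir_le (hγ : 0 < γ) (hlam : 0 < lam) {ℓ : ℕ} {u Φ h : H} {B : ℝ}
    (hu : -R.gen γ lam ℓ u = Φ) (hW : R.HNeg γ lam ℓ (Φ + R.gen γ lam ℓ h) B) :
    R.dir γ lam ℓ (u - h) ≤ B ^ 2 := by
  have h0 := R.dir_nonneg hγ hlam ℓ (u - h)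
  have h1 := hW (u - h)
  have h2 : inner ℝ (Φ + R.gen γ lam ℓ h) (u - h) = R.dir γ lam ℓ (u - h) := by
    have := R.inner_gen_self γ lam ℓ (u - h)
    rw [← neg_eq_iff_eq_neg.2 this, ← inner_neg_right, ← hu, real_inner_comm, map_sub]
    congr 1
    abel
  rw [h2] at h1
  set d := √(R.dir γ lam ℓ (u - h)) with hd
  have hd2 : R.dir γ lam ℓ (u - h) = d ^ 2 := (Real.sq_sqrt h0).symm
  rw [hd2] at h1 ⊢
  have hd0 : 0 ≤ d := Real.sqrt_nonneg _
  rcases hd0.eq_or_lt with h | h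
  · simpa [← h] using sq_nonneg B
  · have : d ≤ B := by nlinarith
    gcongr

/-- A bound on the dual seminorm of sums of translates, in terms of the `L²` norm. -/
def dualConst (γ lam : ℝ) : ℝ := √(1 / (2 * γ)) + √(1 / (2 * lam))

lemma dualConst_pos (hγ : 0 < γ) : 0 < dualConst γ lam := by
  unfold dualConst; positivity

variable (R) in
/-- Vectors that are odd with respect to a flip or to an exchange in `{-r, …, r}`. -/
def IsOdd (r : ℕ) (f : H) : Prop :=
  (∃ k ∈ Finset.Icc (-(r : ℤ)) r, R.flip k f = -f) ∨
    ∃ k ∈ Finset.Ico (-(r : ℤ)) r, R.exch k f = -f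

/-- Since `τ_x f` is odd under `S (x + k)`, its pairing with `v` is `-1/2` times its pairing with `S
(x + k) v - v`. Different `x` use different terms of the Dirichlet form, so Cauchy–Schwarz over `A`
costs only the square root of the number of translates. -/
lemma sum_inner_le_of_involution (S : ℤ → H →ₗ[ℝ] H)
    (hS : ∀ x v w, inner ℝ (S x v) w = inner ℝ v (S x w))
    (hT : ∀ x y v, R.shift x (S y v) = S (x + y) (R.shift x v)) {f : H} {k : ℤ}
    (hk : S k f = -f) (A B : Finset ℤ) (hA : ∀ x ∈ A, x + k ∈ B) {c d : ℝ} (hc : 0 < c)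
    (v : H) (hd : c / 2 * ∑ x ∈ B, ‖S x v - v‖ ^ 2 ≤ d) :
    inner ℝ (∑ x ∈ A, R.shift x f) v ≤ √(1 / (2 * c)) * ‖f‖ * √A.card * √d := by
  have h1 : ∀ x ∈ A, inner ℝ (R.shift x f) v ≤ 1 / 2 * ‖f‖ * ‖S (x + k) v - v‖ := by
    intro x _
    have h2 : S (x + k) (R.shift x f) = -R.shift x f := by rw [← hT, hk, map_neg]
    have h3 := hS (x + k) (R.shift x f) v
    rw [h2, inner_neg_left] at h3
    have h4 : inner ℝ (R.shift x f) v = -(1 / 2) * inner ℝ (R.shift x f) (S (x + k) v - v) := by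
      rw [inner_sub_right, ← h3]; ring
    have h5 := abs_real_inner_le_norm (R.shift x f) (S (x + k) v - v)
    rw [R.norm_shift] at h5
    have := abs_le.1 h5
    rw [h4]
    linarith [this.1]
  have h2 : (∑ x ∈ A, ‖S (x + k) v - v‖) ^ 2 ≤ A.card * (2 * d / c) := by
    refine (sq_sum_le_card_mul_sum_sq).trans ?_
    gcongr
    have : ∑ x ∈ A, ‖S (x + k) v - v‖ ^ 2 ≤ ∑ x ∈ B, ‖S x v - v‖ ^ 2 := by
      have hmap := Finset.sum_map A (addRightEmbedding k) (fun x => ‖S x v - v‖ ^ 2)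
      simp only [addRightEmbedding_apply] at hmap
      rw [← hmap]
      apply Finset.sum_le_sum_of_subset_of_nonneg
      · intro y hy
        simp only [Finset.mem_map, addRightEmbedding_apply] at hy
        obtain ⟨x, hx, rfl⟩ := hy
        exact hA x hx
      · intros; positivity
    rw [le_div_iff₀ hc]
    nlinarith
  have hd0 : 0 ≤ d := le_trans (by positivity) hd
  have h3 : ∑ x ∈ A, ‖S (x + k) v - v‖ ≤ √(A.card * (2 * d / c)) := Real.le_sqrt_of_sq_le h2
  rw [sum_inner]
  calc ∑ x ∈ A, inner ℝ (R.shift x f) v ≤ ∑ x ∈ A, 1 / 2 * ‖f‖ * ‖S (x + k) v - v‖ :=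
        Finset.sum_le_sum h1
    _ = 1 / 2 * ‖f‖ * ∑ x ∈ A, ‖S (x + k) v - v‖ := by rw [Finset.mul_sum]
    _ ≤ 1 / 2 * ‖f‖ * √(A.card * (2 * d / c)) := by gcongr
    _ = _ := by
      have : (A.card : ℝ) * (2 * d / c) = 2 ^ 2 * ((1 / (2 * c)) * (A.card * d)) := by
        field_simp
      rw [this, Real.sqrt_mul (by positivity), Real.sqrt_sq (by norm_num),
        Real.sqrt_mul (by positivity), Real.sqrt_mul (by positivity)]
      ring

lemma IsOdd.hNeg_sum (hγ : 0 < γ) (hlam : 0 < lam) {r : ℕ} {f : H} (hf : R.IsOdd r f) {ℓ : ℕ}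
    (A : Finset ℤ) (hA : ∀ x ∈ A, |x| + r ≤ ℓ) :
    R.HNeg γ lam ℓ (∑ x ∈ A, R.shift x f) (dualConst γ lam * ‖f‖ * √A.card) := by
  intro v
  have hs1 : √(1 / (2 * γ)) ≤ dualConst γ lam := le_add_of_nonneg_right (Real.sqrt_nonneg _)
  have hs2 : √(1 / (2 * lam)) ≤ dualConst γ lam := le_add_of_nonneg_left (Real.sqrt_nonneg _)
  rcases hf with ⟨k, hk, hkf⟩ | ⟨k, hk, hkf⟩
  · refine (sum_inner_le_of_involution R.flip R.inner_flip R.shift_flip hkf A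
      (Finset.Icc (-(ℓ : ℤ)) ℓ) ?_ hγ v (d := R.dir γ lam ℓ v) ?_).trans (by gcongr)
    · intro x hx
      have := hA x hx
      have := abs_le.1 (le_refl |x|)
      rw [Finset.mem_Icc] at hk ⊢
      omega
    · unfold dir
      exact le_add_of_nonneg_right (by positivity)
  · refine (sum_inner_le_of_involution R.exch R.inner_exch R.shift_exch hkf A
      (Finset.Ico (-(ℓ : ℤ)) ℓ) ?_ hlam v (d := R.dir γ lam ℓ v) ?_).trans (by gcongr)
    · intro x hx
      have := hA x hx
      have := abs_le.1 (le_refl |x|)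
      rw [Finset.mem_Ico] at hk ⊢
      omega
    · unfold dir
      exact le_add_of_nonneg_left (by positivity)

end LatticeRep
end HarmonicChain
end

/-! ### Test vectors and the limit of the functionals per unit length. -/

noncomputable section

namespace HarmonicChain

open MeasureTheory ProbabilityTheory Filter Topology

namespace LatticeRep

variable {H : Type*} [NormedAddCommGroup H] [InnerProductSpace ℝ H] (R : LatticeRep H)
  (γ lam : ℝ)

/-- The sum of the translates of a vector by the sites of `{-L, …, L}`. -/
def sumBox (L : ℤ) : H →ₗ[ℝ] H := ∑ x ∈ Finset.Icc (-L) L, R.shift x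

lemma sumBox_apply (L : ℤ) (v : H) : R.sumBox L v = ∑ x ∈ Finset.Icc (-L) L, R.shift x v := by
  simp [sumBox, LinearMap.sum_apply]

/-- `g` is invariant under the flips and the exchanges away from `{-r, …, r}`. -/
def Local (r : ℕ) (g : H) : Prop := ∀ x : ℤ, (r : ℤ) < |x| → R.flip x g = g ∧ R.exch x g = g

/-- `φ` is orthogonal to all vectors that are invariant under the flips and the exchanges in
`{-s, …, s}`. -/
def OrthInv (s : ℕ) (φ : H) : Prop :=
  ∀ v, (∀ x ∈ Finset.Icc (-(s : ℤ)) s, R.flip x v = v) →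
    (∀ x ∈ Finset.Ico (-(s : ℤ)) s, R.exch x v = v) → inner ℝ φ v = 0

variable {R}

/-- A distant translate of `g` is invariant under everything that happens in `{-s, …, s}`. The
disorder plays no role in this orthogonality, which therefore holds even if the coefficients have
overlapping supports. -/
lemma Local.inner_shift_eq_zero {s r : ℕ} {φ g : H} (hφ : R.OrthInv s φ) (hg : R.Local r g)
    {z : ℤ} (hz : ((r + s : ℕ) : ℤ) < |z|) : inner ℝ φ (R.shift z g) = 0 := by
  push_cast at hz
  have key : ∀ x ∈ Finset.Icc (-(s : ℤ)) s, (r : ℤ) < |x - z| := by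
    intro x hx
    rw [Finset.mem_Icc, ← abs_le] at hx
    have := abs_sub_abs_le_abs_sub z x
    rw [abs_sub_comm] at this
    omega
  apply hφ
  · intro x hx
    rw [flip_shift, (hg _ (key x hx)).1]
  · intro x hx
    rw [exch_shift, (hg _ (key x (Finset.Ico_subset_Icc_self hx))).2]

lemma Local.flip_shift_sub {r : ℕ} {g : H} (hg : R.Local r g) {z : ℤ} (hz : (r : ℤ) < |z|) :
    R.flip 0 (R.shift z g) - R.shift z g = 0 := by
  rw [flip_shift, (hg _ (by simpa using hz)).1, sub_self]

lemma Local.exch_shift_sub {r : ℕ} {g : H} (hg : R.Local r g) {z : ℤ} (hz : (r : ℤ) < |z|) :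
    R.exch 0 (R.shift z g) - R.shift z g = 0 := by
  rw [exch_shift, (hg _ (by simpa using hz)).2, sub_self]

lemma flip_sumBox_sub (x L : ℤ) (g : H) :
    R.flip x (R.sumBox L g) - R.sumBox L g =
      R.shift x (∑ y ∈ Finset.Icc (-L) L,
        (R.flip 0 (R.shift (y - x) g) - R.shift (y - x) g)) := by
  simp only [sumBox_apply, map_sum, map_sub, R.shift_flip, R.shift_shift, Finset.sum_sub_distrib,
    add_zero, add_sub_cancel]

lemma exch_sumBox_sub (x L : ℤ) (g : H) :
    R.exch x (R.sumBox L g) - R.sumBox L g =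
      R.shift x (∑ y ∈ Finset.Icc (-L) L,
        (R.exch 0 (R.shift (y - x) g) - R.shift (y - x) g)) := by
  simp only [sumBox_apply, map_sum, map_sub, R.shift_exch, R.shift_shift, Finset.sum_sub_distrib,
    add_zero, add_sub_cancel]

variable (R) in
/-- The vectors `X ℓ` play the role of `∑_{|x| ≤ ℓ} x ω_x²`, whose gradients in the box are the
translates of `b`. -/
structure IsLinearProfile (X : ℕ → H) (b : H) : Prop where
  flip : ∀ (ℓ : ℕ), ∀ x ∈ Finset.Icc (-(ℓ : ℤ)) ℓ, R.flip x (X ℓ) = X ℓ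
  exch : ∀ (ℓ : ℕ), ∀ x ∈ Finset.Ico (-(ℓ : ℤ)) ℓ, R.exch x (X ℓ) - X ℓ = R.shift x b

variable {X : ℕ → H} {b : H}

/-- In the bulk, the differences `y - x` cover the whole finite range of the correlations of `φ`
with translates of `g`, while the profile always contributes `a * S`; near the edges the terms are
merely bounded. -/
lemma tendsto_inner_test {s r : ℕ} {φ g : H} (hφ : R.OrthInv s φ) (hg : R.Local r g) {S : ℝ}
    (hS : ∀ (ℓ : ℕ) (x : ℤ), |x| + s ≤ ℓ → inner ℝ (R.shift x φ) (X ℓ) = S) (a : ℝ)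
    {p : ℕ} (hp : s ≤ p) (q : ℕ) :
    Tendsto (fun ℓ : ℕ => (2 * (ℓ : ℝ))⁻¹ *
      inner ℝ (R.sumBox (ℓ - q) g + a • X ℓ) (R.sumBox (ℓ - p) φ)) atTop
      (𝓝 (∑ z ∈ Finset.Icc (-((r + s : ℕ) : ℤ)) (r + s : ℕ), inner ℝ φ (R.shift z g) + a * S)) := by
  have key : ∀ (ℓ : ℕ), ∀ x ∈ Finset.Icc (-((ℓ : ℤ) - p)) (ℓ - p),
      inner ℝ (R.shift x φ) (R.sumBox (ℓ - q) g + a • X ℓ) =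
        ∑ y ∈ Finset.Icc (-((ℓ : ℤ) - q)) (ℓ - q), inner ℝ φ (R.shift (y - x) g) + a * S := by
    intro ℓ x hx
    rw [Finset.mem_Icc, ← abs_le] at hx
    rw [inner_add_right, real_inner_smul_right, hS ℓ x (by omega), sumBox_apply, inner_sum]
    simp only [inner_shift_shift]
  have hz : ∀ z : ℤ, ((r + s : ℕ) : ℤ) < |z| → inner ℝ φ (R.shift z g) = 0 :=
    fun z hz => Local.inner_shift_eq_zero hφ hg hz
  have := tendsto_average (fun ℓ => Finset.Icc (-((ℓ : ℤ) - p)) (ℓ - p))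
    (fun ℓ x => inner ℝ (R.shift x φ) (R.sumBox (ℓ - q) g + a • X ℓ))
    (∑ z ∈ Finset.Icc (-((r + s : ℕ) : ℤ)) (r + s : ℕ), inner ℝ φ (R.shift z g) + a * S)
    (∑ z ∈ Finset.Icc (-((r + s : ℕ) : ℤ)) (r + s : ℕ), ‖inner ℝ φ (R.shift z g)‖ + |a * S|)
    (p + q + r + s) ?_ ?_ ?_ ?_
  · refine this.congr fun ℓ => ?_
    rw [real_inner_comm, sumBox_apply (R := R) _ φ, sum_inner]
  · intro ℓ
    apply Finset.Icc_subset_Icc <;> push_cast <;> omega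
  · intro ℓ
    apply Finset.Icc_subset_Icc <;> omega
  · intro ℓ x hx
    rw [key ℓ x (Finset.Icc_subset_Icc (by push_cast; omega) (by push_cast; omega) hx),
      sum_Icc_sub_of_support (fun z => inner ℝ φ (R.shift z g)) _ hz]
    rw [Finset.mem_Icc, ← abs_le] at hx
    push_cast at hx ⊢
    omega
  · intro ℓ x hx
    rw [key ℓ x hx]
    refine (abs_add_le _ _).trans (add_le_add ?_ le_rfl)
    exact norm_sum_Icc_sub_le (fun z => inner ℝ φ (R.shift z g)) _ hz _ _

lemma tendsto_sq_norm_average {S : ℤ → H →ₗ[ℝ] H} {f : ℤ → H} {r : ℕ} {w : H} {h : ℕ → H}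
    (A : ℕ → Finset ℤ) (q : ℕ) (hA : ∀ ℓ : ℕ, Finset.Icc (-((ℓ : ℤ) - 1)) (ℓ - 1) ⊆ A ℓ)
    (hA' : ∀ ℓ : ℕ, A ℓ ⊆ Finset.Icc (-(ℓ : ℤ)) ℓ)
    (hf : ∀ z : ℤ, (r : ℤ) < |z| → f z = 0)
    (hh : ∀ (ℓ : ℕ), ∀ x ∈ A ℓ, S x (h ℓ) - h ℓ =
      R.shift x (w + ∑ y ∈ Finset.Icc (-((ℓ : ℤ) - q)) (ℓ - q), f (y - x))) :
    Tendsto (fun ℓ : ℕ => (2 * (ℓ : ℝ))⁻¹ * ∑ x ∈ A ℓ, ‖S x (h ℓ) - h ℓ‖ ^ 2) atTop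
      (𝓝 (‖w + ∑ z ∈ Finset.Icc (-(r : ℤ)) r, f z‖ ^ 2)) := by
  -- The margin adds the truncation `q` of the sum, the range `r` of `f`, and `1` because the bonds
  -- in the box omit its right endpoint.
  apply tendsto_average _ _ _ ((‖w‖ + ∑ z ∈ Finset.Icc (-(r : ℤ)) r, ‖f z‖) ^ 2) (q + r + 1) _ hA'
  · intro ℓ x hx
    rw [hh ℓ x (hA ℓ (Finset.Icc_subset_Icc (by push_cast; omega) (by push_cast; omega) hx)),
      R.norm_shift, sum_Icc_sub_of_support f _ hf]
    rw [Finset.mem_Icc, ← abs_le] at hx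
    push_cast at hx
    omega
  · intro ℓ x hx
    rw [hh ℓ x hx, R.norm_shift, abs_of_nonneg (by positivity)]
    gcongr
    exact (norm_add_le _ _).trans (add_le_add le_rfl (norm_sum_Icc_sub_le f _ hf _ _))
  · intro ℓ
    exact (Finset.Icc_subset_Icc (by push_cast; omega) (by push_cast; omega)).trans (hA ℓ)

/-- The value per unit length of the variational functional of the box at the test functions
`∑ τ_x g + a X`. -/
lemma tendsto_functional {s r : ℕ} {φ g : H} (hφ : R.OrthInv s φ) (hg : R.Local r g) {S : ℝ}
    (hX : R.IsLinearProfile X b)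
    (hS : ∀ (ℓ : ℕ) (x : ℤ), |x| + s ≤ ℓ → inner ℝ (R.shift x φ) (X ℓ) = S) (a : ℝ)
    {p : ℕ} (hp : s ≤ p) (q : ℕ) :
    Tendsto (fun ℓ : ℕ => (2 * (ℓ : ℝ))⁻¹ *
      (2 * inner ℝ (R.sumBox (ℓ - q) g + a • X ℓ) (R.sumBox (ℓ - p) φ) -
        R.dir γ lam ℓ (R.sumBox (ℓ - q) g + a • X ℓ))) atTop
      (𝓝 (2 * ∑ z ∈ Finset.Icc (-((r + s : ℕ) : ℤ)) (r + s : ℕ), inner ℝ φ (R.shift z g)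
        + 2 * a * S
        - (lam / 2 * ‖a • b + ∑ z ∈ Finset.Icc (-(r : ℤ)) r,
            (R.exch 0 (R.shift z g) - R.shift z g)‖ ^ 2
          + γ / 2 * ‖∑ z ∈ Finset.Icc (-(r : ℤ)) r,
            (R.flip 0 (R.shift z g) - R.shift z g)‖ ^ 2))) := by
  have h1 := tendsto_inner_test hφ hg hS a hp q
  have h2 := tendsto_sq_norm_average (R := R) (S := R.flip)
    (f := fun z => R.flip 0 (R.shift z g) - R.shift z g) (r := r) (w := 0)
    (h := fun ℓ => R.sumBox (ℓ - q) g + a • X ℓ) (fun ℓ => Finset.Icc (-(ℓ : ℤ)) ℓ) q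
    (fun ℓ => Finset.Icc_subset_Icc (by omega) (by omega)) (fun ℓ => subset_rfl)
    (fun z hz => hg.flip_shift_sub hz) (by
      intro ℓ x hx
      rw [zero_add, ← flip_sumBox_sub, map_add, map_smul, hX.flip ℓ x hx]
      abel)
  have h3 := tendsto_sq_norm_average (R := R) (S := R.exch)
    (f := fun z => R.exch 0 (R.shift z g) - R.shift z g) (r := r) (w := a • b)
    (h := fun ℓ => R.sumBox (ℓ - q) g + a • X ℓ) (fun ℓ => Finset.Ico (-(ℓ : ℤ)) ℓ) q
    (fun ℓ x hx => by rw [Finset.mem_Icc] at hx; rw [Finset.mem_Ico]; omega)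
    (fun ℓ => Finset.Ico_subset_Icc_self)
    (fun z hz => hg.exch_shift_sub hz) (by
      intro ℓ x hx
      rw [map_add (R.shift x), ← exch_sumBox_sub, map_add, map_smul, map_smul, ← hX.exch ℓ x hx,
        smul_sub]
      abel)
  rw [zero_add] at h2
  have h4 := (h1.const_mul 2).sub ((h3.const_mul (lam / 2)).add (h2.const_mul (γ / 2)))
  convert h4 using 2
  · unfold dir; ring
  · ring

end LatticeRep
end HarmonicChain
end

/-! ### Approximation in the dual seminorm and its variational consequence. -/

noncomputable section

namespace HarmonicChain

open MeasureTheory ProbabilityTheory Filter Topology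

lemma card_sdiff_Icc_le (ℓ p q : ℕ) :
    (Finset.Icc (-((ℓ : ℤ) - p)) (ℓ - p) \ Finset.Icc (-((ℓ : ℤ) - q)) (ℓ - q)).card
      ≤ 2 * q + 1 := by
  have h : Finset.Icc (-((ℓ : ℤ) - p)) (ℓ - p) \ Finset.Icc (-((ℓ : ℤ) - q)) (ℓ - q) ⊆
      Finset.Ico (-(ℓ : ℤ)) (-(ℓ : ℤ) + q) ∪ Finset.Ioc ((ℓ : ℤ) - q) ℓ := by
    intro x hx
    simp only [Finset.mem_sdiff, Finset.mem_Icc, Finset.mem_union, Finset.mem_Ico,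
      Finset.mem_Ioc] at hx ⊢
    omega
  refine (Finset.card_le_card h).trans ((Finset.card_union_le _ _).trans ?_)
  rw [Int.card_Ico, Int.card_Ioc]
  omega

lemma card_sdiff_Ico_le (ℓ q : ℕ) :
    (Finset.Ico (-(ℓ : ℤ)) ℓ \ Finset.Icc (-((ℓ : ℤ) - q)) (ℓ - q)).card ≤ 2 * q + 1 := by
  refine (Finset.card_le_card ?_).trans (card_sdiff_Icc_le ℓ 0 q)
  apply Finset.sdiff_subset_sdiff _ subset_rfl
  simpa using Finset.Ico_subset_Icc_self

lemma card_Icc_sub_le (ℓ p : ℕ) : ((Finset.Icc (-((ℓ : ℤ) - p)) (ℓ - p)).card : ℝ) ≤ 2 * ℓ + 1 := by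
  have : (Finset.Icc (-((ℓ : ℤ) - p)) (ℓ - p)).card ≤ 2 * ℓ + 1 := by
    rw [Int.card_Icc]; omega
  exact_mod_cast this

lemma sum_Icc_sub_succ {M : Type*} [AddCommGroup M] (L : ℤ) (hL : 0 ≤ L)
    (u : ℤ → M) :
    ∑ x ∈ Finset.Icc (-L) L, (u x - u (x + 1)) = u (-L) - u (L + 1) := by
  obtain ⟨n, rfl⟩ : ∃ n : ℕ, L = n := ⟨L.toNat, by omega⟩
  have h : ∀ (m : ℕ) (a : ℤ), ∑ x ∈ Finset.Ico a (a + m), (u x - u (x + 1)) = u a - u (a + m) := by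
    intro m a
    induction m with
    | zero => simp
    | succ m ih =>
      have : Finset.Ico a (a + (m + 1 : ℕ)) = insert (a + m) (Finset.Ico a (a + m)) := by
        ext y; simp only [Finset.mem_Ico, Finset.mem_insert]; push_cast; omega
      rw [this, Finset.sum_insert (by simp), ih]
      push_cast
      rw [← add_assoc]
      abel
  have h2 : Finset.Icc (-(n : ℤ)) n = Finset.Ico (-(n : ℤ)) (-n + (2 * n + 1 : ℕ)) := by
    ext y; simp only [Finset.mem_Icc, Finset.mem_Ico]; omega
  rw [h2, h]
  congr 2
  omega

namespace LatticeRep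

variable {H : Type*} [NormedAddCommGroup H] [InnerProductSpace ℝ H] {R : LatticeRep H}
  {γ lam : ℝ}

variable (R γ lam) in
/-- The translates of `f` are bounded in the dual seminorms of the boxes. -/
def TransBdd (r : ℕ) (f : H) : Prop :=
  ∃ C : ℝ, ∀ (ℓ : ℕ) (x : ℤ), |x| + r ≤ ℓ → R.HNeg γ lam ℓ (R.shift x f) C

lemma IsOdd.transBdd (hγ : 0 < γ) (hlam : 0 < lam) {r : ℕ} {f : H} (hf : R.IsOdd r f) :
    R.TransBdd γ lam r f :=
  ⟨_, fun ℓ x hx => by simpa using hf.hNeg_sum hγ hlam {x} (by simpa using hx)⟩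

lemma TransBdd.zero (r : ℕ) : R.TransBdd γ lam r 0 :=
  ⟨0, fun ℓ x _ => by simpa using HNeg.zero ℓ⟩

lemma TransBdd.add {r : ℕ} {f f' : H} (h : R.TransBdd γ lam r f) (h' : R.TransBdd γ lam r f') :
    R.TransBdd γ lam r (f + f') := by
  obtain ⟨C, hC⟩ := h
  obtain ⟨C', hC'⟩ := h'
  exact ⟨C + C', fun ℓ x hx => by rw [map_add]; exact (hC ℓ x hx).add (hC' ℓ x hx)⟩

lemma TransBdd.smul {r : ℕ} {f : H} (h : R.TransBdd γ lam r f) (c : ℝ) :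
    R.TransBdd γ lam r (c • f) := by
  obtain ⟨C, hC⟩ := h
  exact ⟨|c| * C, fun ℓ x hx => by rw [map_smul]; exact (hC ℓ x hx).smul c⟩

/-- At most `2q + 1` translates lie between the two boxes, each with a uniformly bounded dual
seminorm. Hence enlarging the margin costs only `O(1)`. -/
lemma TransBdd.hNeg_sumBox_sub {p q : ℕ} (hpq : p ≤ q) {f : H} (h : R.TransBdd γ lam p f) :
    ∃ K, ∀ ℓ : ℕ, R.HNeg γ lam ℓ (R.sumBox (ℓ - p) f - R.sumBox (ℓ - q) f) K := by
  obtain ⟨C, hC⟩ := h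
  refine ⟨(2 * q + 1 : ℕ) * |C|, fun ℓ => ?_⟩
  have hsub : Finset.Icc (-((ℓ : ℤ) - q)) (ℓ - q) ⊆ Finset.Icc (-((ℓ : ℤ) - p)) (ℓ - p) :=
    Finset.Icc_subset_Icc (by omega) (by omega)
  rw [sumBox_apply, sumBox_apply, ← Finset.sum_sdiff hsub, add_sub_cancel_right]
  refine (HNeg.sum _ (B := fun _ => C) fun x hx => ?_).mono ?_
  · have := (Finset.mem_sdiff.1 hx).1
    rw [Finset.mem_Icc, ← abs_le] at this
    exact hC ℓ x (by omega)
  · rw [Finset.sum_const, nsmul_eq_mul]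
    have := card_sdiff_Icc_le ℓ p q
    refine (mul_le_mul_of_nonneg_left (le_abs_self C) (Nat.cast_nonneg _)).trans ?_
    gcongr

variable (R γ lam) in
/-- Up to an error at most `B` per square root of the length in the dual seminorms of the boxes,
the sums of the translates of `φ` are images under the generators of test functions
`∑ τ_x g + a X` with `g ∈ Q`. -/
def Approx (Q : Submodule ℝ H) (X : ℕ → H) (φ : H) (B : ℝ) : Prop :=
  ∃ g ∈ Q, ∃ (a : ℝ) (p₀ : ℕ), ∀ p ≥ p₀, ∃ K : ℝ, ∀ ℓ : ℕ,
    R.HNeg γ lam ℓ (R.sumBox (ℓ - p) φ + R.gen γ lam ℓ (R.sumBox (ℓ - p) g + a • X ℓ))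
      (B * √(2 * ℓ + 1) + K)

variable {Q : Submodule ℝ H} {X : ℕ → H}

lemma Approx.mono {φ : H} {B B' : ℝ} (h : R.Approx γ lam Q X φ B) (hB : B ≤ B') :
    R.Approx γ lam Q X φ B' := by
  obtain ⟨g, hg, a, p₀, h⟩ := h
  refine ⟨g, hg, a, p₀, fun p hp => ?_⟩
  obtain ⟨K, hK⟩ := h p hp
  exact ⟨K, fun ℓ => (hK ℓ).mono (by gcongr)⟩

/-- Requiring the approximation at every margin `p ≥ p₀` allows two of them to be used at a common
margin. -/
lemma Approx.add {φ φ' : H} {B B' : ℝ} (h : R.Approx γ lam Q X φ B)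
    (h' : R.Approx γ lam Q X φ' B') : R.Approx γ lam Q X (φ + φ') (B + B') := by
  obtain ⟨g, hg, a, p₀, h⟩ := h
  obtain ⟨g', hg', a', p₀', h'⟩ := h'
  refine ⟨g + g', Q.add_mem hg hg', a + a', max p₀ p₀', fun p hp => ?_⟩
  obtain ⟨K, hK⟩ := h p (le_of_max_le_left hp)
  obtain ⟨K', hK'⟩ := h' p (le_of_max_le_right hp)
  refine ⟨K + K', fun ℓ => ?_⟩
  convert (hK ℓ).add (hK' ℓ) using 1
  · simp only [map_add, add_smul]; abel
  · ring

lemma Approx.smul {φ : H} {B : ℝ} (h : R.Approx γ lam Q X φ B) (c : ℝ) :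
    R.Approx γ lam Q X (c • φ) (|c| * B) := by
  obtain ⟨g, hg, a, p₀, h⟩ := h
  refine ⟨c • g, Q.smul_mem c hg, c * a, p₀, fun p hp => ?_⟩
  obtain ⟨K, hK⟩ := h p hp
  refine ⟨|c| * K, fun ℓ => ?_⟩
  convert (hK ℓ).smul c using 1
  · simp only [map_add, map_smul, mul_smul, smul_add]
  · ring

lemma Approx.smul_zero {φ : H} (h : R.Approx γ lam Q X φ 0) (c : ℝ) :
    R.Approx γ lam Q X (c • φ) 0 := by
  simpa using h.smul c

lemma Approx.add_zero {φ φ' : H} {B : ℝ} (h : R.Approx γ lam Q X φ B)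
    (h' : R.Approx γ lam Q X φ' 0) : R.Approx γ lam Q X (φ + φ') B := by
  simpa using h.add h'

lemma Approx.zero : R.Approx γ lam Q X 0 0 :=
  ⟨0, Q.zero_mem, 0, 0, fun p _ => ⟨0, fun ℓ => by simpa using HNeg.zero ℓ⟩⟩

lemma Approx.sum {ι : Type*} (A : Finset ι) {φ : ι → H} {B : ℝ}
    (h : ∀ i ∈ A, R.Approx γ lam Q X (φ i) B) :
    R.Approx γ lam Q X (∑ i ∈ A, φ i) (A.card * B) := by
  classical
  induction A using Finset.induction_on with
  | empty => simpa using Approx.zero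
  | insert i A hi ih =>
    rw [Finset.sum_insert hi, Finset.card_insert_of_notMem hi]
    have := (h i (Finset.mem_insert_self i A)).add
      (ih fun j hj => h j (Finset.mem_insert_of_mem hj))
    convert this using 1
    push_cast; ring

/-- With the zero test vector, oddness alone bounds the cost by the `L²` norm. Every smallness
statement below enters through this crude bound. -/
lemma IsOdd.approx (hγ : 0 < γ) (hlam : 0 < lam) {r : ℕ} {f : H} (hf : R.IsOdd r f) :
    R.Approx γ lam Q X f (dualConst γ lam * ‖f‖) := by
  refine ⟨0, Q.zero_mem, 0, r, fun p hp => ⟨0, fun ℓ => ?_⟩⟩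
  simp only [map_zero, zero_smul, _root_.add_zero, sumBox_apply R _ f]
  refine (hf.hNeg_sum hγ hlam _ fun x hx => ?_).mono ?_
  · rw [Finset.mem_Icc, ← abs_le] at hx
    omega
  · have := card_Icc_sub_le ℓ p
    have := dualConst_pos (lam := lam) hγ
    gcongr

variable (R γ lam) in
/-- The generator of the infinite system, on vectors that are invariant away from
`{-r, …, r}`. -/
def locGen (r : ℕ) (f : H) : H :=
  γ • ∑ z ∈ Finset.Icc (-(r : ℤ)) r, (R.flip z f - f) +
    lam • ∑ z ∈ Finset.Icc (-(r : ℤ)) r, (R.exch z f - f)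

/-- Only flips and exchanges within `r` of `x` act on `τ_x f`. The extra unit of margin keeps the
bond `{x + r, x + r + 1}` inside the box. -/
lemma Local.gen_shift {r : ℕ} {f : H} (hf : R.Local r f) {ℓ : ℕ} {x : ℤ} (hx : |x| + r + 1 ≤ ℓ) :
    R.gen γ lam ℓ (R.shift x f) = R.shift x (R.locGen γ lam r f) := by
  have key : ∀ (S : ℤ → H →ₗ[ℝ] H) (hT : ∀ x y v, R.shift x (S y v) = S (x + y) (R.shift x v))
      (hS : ∀ z : ℤ, (r : ℤ) < |z| → S z f = f) (A : Finset ℤ)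
      (hA : ∀ z : ℤ, |z| ≤ r → x + z ∈ A),
      ∑ y ∈ A, (S y (R.shift x f) - R.shift x f) =
        R.shift x (∑ z ∈ Finset.Icc (-(r : ℤ)) r, (S z f - f)) := by
    intro S hT hS A hA
    simp only [map_sum, map_sub, hT]
    symm
    have hmap := Finset.sum_map (Finset.Icc (-(r : ℤ)) r) (addLeftEmbedding x)
      (fun y => S y (R.shift x f) - R.shift x f)
    simp only [addLeftEmbedding_apply] at hmap
    rw [← hmap]
    apply Finset.sum_subset
    · intro y hy
      simp only [Finset.mem_map, addLeftEmbedding_apply] at hy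
      obtain ⟨z, hz, rfl⟩ := hy
      rw [Finset.mem_Icc, ← abs_le] at hz
      exact hA z hz
    · intro y _ hy
      have hS' := hS (y - x) (by
        by_contra hc
        apply hy
        simp only [Finset.mem_map, addLeftEmbedding_apply]
        exact ⟨y - x, by rw [Finset.mem_Icc, ← abs_le]; exact not_lt.1 hc, by ring⟩)
      have := hT x (y - x) f
      rw [hS', add_sub_cancel] at this
      rw [← this, sub_self]
  have habs := abs_le.1 (le_refl |x|)
  rw [gen_apply, locGen, map_add, map_smul, map_smul,
    key R.flip R.shift_flip (fun z hz => (hf z hz).1),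
    key R.exch R.shift_exch (fun z hz => (hf z hz).2)]
  · intro z hz
    rw [abs_le] at hz
    rw [Finset.mem_Ico]
    omega
  · intro z hz
    rw [abs_le] at hz
    rw [Finset.mem_Icc]
    omega

/-- The test function `-f` cancels the sum of the translates exactly. -/
lemma Local.approx_locGen {r : ℕ} {f : H} (hf : R.Local r f) (hQ : f ∈ Q) :
    R.Approx γ lam Q X (R.locGen γ lam r f) 0 := by
  refine ⟨-f, Q.neg_mem hQ, 0, r + 1, fun p hp => ⟨0, fun ℓ => ?_⟩⟩
  have : R.gen γ lam ℓ (R.sumBox (ℓ - p) f) = R.sumBox (ℓ - p) (R.locGen γ lam r f) := by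
    rw [sumBox_apply, sumBox_apply, map_sum]
    refine Finset.sum_congr rfl fun x hx => hf.gen_shift ?_
    rw [Finset.mem_Icc, ← abs_le] at hx
    omega
  simpa [this] using HNeg.zero ℓ

/-- The sum telescopes to two boundary translates, so the error stays bounded as the box grows. The
margin is `r + 1` because the outer one is a translate by `ℓ - p + 1`. -/
lemma IsOdd.approx_coboundary (hγ : 0 < γ) (hlam : 0 < lam) {r : ℕ} {f : H} (hf : R.IsOdd r f) :
    R.Approx γ lam Q X (f - R.shift 1 f) 0 := by
  obtain ⟨C, hC⟩ := hf.transBdd hγ hlam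
  refine ⟨0, Q.zero_mem, 0, r + 1, fun p hp => ⟨|C| + |C|, fun ℓ => ?_⟩⟩
  simp only [map_zero, zero_smul, _root_.add_zero, sumBox_apply R _ (f - _), map_sub,
    R.shift_shift, zero_mul, zero_add]
  rcases le_or_gt (p : ℤ) ℓ with h | h
  · rw [sum_Icc_sub_succ _ (by omega) (fun x => R.shift x f), sub_eq_add_neg]
    refine HNeg.add ((hC ℓ _ ?_).mono (le_abs_self C)) ((hC ℓ _ ?_).mono (le_abs_self C)).neg
    · rw [abs_neg, abs_of_nonneg (by omega)]; omega
    · rw [abs_of_nonneg (by omega)]; omega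
  · rw [Finset.Icc_eq_empty (by omega), Finset.sum_empty]
    exact (HNeg.zero ℓ).mono (by positivity)

lemma IsLinearProfile.gen_eq {b : H} (hX : R.IsLinearProfile X b) (ℓ : ℕ) :
    R.gen γ lam ℓ (X ℓ) = lam • ∑ x ∈ Finset.Ico (-(ℓ : ℤ)) ℓ, R.shift x b := by
  rw [gen_apply, Finset.sum_congr rfl fun x hx => hX.exch ℓ x hx,
    Finset.sum_congr rfl fun x hx => sub_eq_zero.2 (hX.flip ℓ x hx)]
  simp

/-- The generator maps `λ⁻¹ X` to the sum of the translates of `b` over all bonds of the box; only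
boundedly many of them are missing from the smaller box. This is the only use of a nonzero
coefficient of the profile. -/
lemma IsLinearProfile.approx (hγ : 0 < γ) (hlam : 0 < lam) {b : H}
    (hX : R.IsLinearProfile X b) (hb : R.exch 0 b = -b) :
    R.Approx γ lam Q X b 0 := by
  refine ⟨0, Q.zero_mem, -lam⁻¹, 1, fun p hp =>
    ⟨√(1 / (2 * lam)) * ‖b‖ * √(2 * p + 1 : ℕ), fun ℓ => ?_⟩⟩
  have hsub : Finset.Icc (-((ℓ : ℤ) - p)) (ℓ - p) ⊆ Finset.Ico (-(ℓ : ℤ)) ℓ := by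
    intro x hx
    rw [Finset.mem_Icc] at hx
    rw [Finset.mem_Ico]
    omega
  rw [map_zero, zero_add, map_smul, hX.gen_eq, smul_smul, sumBox_apply, neg_mul,
    inv_mul_cancel₀ hlam.ne', neg_smul, one_smul, ← sub_eq_add_neg, ← Finset.sum_sdiff hsub,
    sub_add_cancel_right, zero_mul, zero_add]
  refine HNeg.neg fun v => ?_
  refine (sum_inner_le_of_involution R.exch R.inner_exch R.shift_exch hb _
      (Finset.Ico (-(ℓ : ℤ)) ℓ) ?_ hlam v (d := R.dir γ lam ℓ v) ?_).trans ?_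
  · intro x hx
    simpa using (Finset.mem_sdiff.1 hx).1
  · unfold dir
    exact le_add_of_nonneg_left (by positivity)
  · have := card_sdiff_Ico_le ℓ p
    gcongr

/-- Lower bound of the variational formula in the box. -/
lemma functional_le (hγ : 0 < γ) (hlam : 0 < lam) {ℓ : ℕ} {u Φ : H}
    (hu : -R.gen γ lam ℓ u = Φ) (h : H) :
    2 * inner ℝ h Φ - R.dir γ lam ℓ h ≤ inner ℝ u Φ := by
  rw [R.inner_eq_add_dir γ lam ℓ hu h]
  linarith [R.dir_nonneg hγ hlam ℓ (u - h)]

/-- Upper bound of the variational formula in the box. -/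
lemma Approx.eventually_le (hγ : 0 < γ) (hlam : 0 < lam) {φ : H} {B : ℝ} {p : ℕ}
    (h : R.Approx γ lam Q X φ B) (hφ : R.TransBdd γ lam p φ) :
    ∃ g ∈ Q, ∃ (a : ℝ) (q : ℕ), ∀ u : ℕ → H,
      (∀ ℓ : ℕ, -R.gen γ lam ℓ (u ℓ) = R.sumBox (ℓ - p) φ) → ∀ ε > 0, ∀ᶠ ℓ : ℕ in atTop,
      (2 * (ℓ : ℝ))⁻¹ * inner ℝ (u ℓ) (R.sumBox (ℓ - p) φ) ≤
        (2 * (ℓ : ℝ))⁻¹ * (2 * inner ℝ (R.sumBox (ℓ - q) g + a • X ℓ) (R.sumBox (ℓ - p) φ) -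
          R.dir γ lam ℓ (R.sumBox (ℓ - q) g + a • X ℓ)) + 2 * B ^ 2 + ε := by
  obtain ⟨g, hg, a, p₀, h⟩ := h
  -- The approximation is available only at margins at least `p₀`; the translates of `φ` lost by
  -- enlarging the margin from `p` are paid for by `K'`.
  obtain ⟨K, hK⟩ := h (max p p₀) (le_max_right _ _)
  obtain ⟨K', hK'⟩ := hφ.hNeg_sumBox_sub (le_max_left p p₀)
  set q := max p p₀
  refine ⟨g, hg, a, q, fun u hu ε hε => ?_⟩
  have hlim : Tendsto (fun ℓ : ℕ => (B ^ 2 + (K + K') ^ 2) * ((ℓ : ℝ))⁻¹) atTop (𝓝 0) := by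
    rw [← mul_zero (B ^ 2 + (K + K') ^ 2)]
    exact (tendsto_inv_atTop_zero.comp tendsto_natCast_atTop_atTop).const_mul _
  filter_upwards [hlim.eventually_lt_const hε, eventually_gt_atTop 0] with ℓ hℓ hℓ0
  have hℓ0' : (0 : ℝ) < ℓ := by exact_mod_cast hℓ0
  set t := R.sumBox (ℓ - q) g + a • X ℓ
  have hW : R.HNeg γ lam ℓ (R.sumBox (ℓ - p) φ + R.gen γ lam ℓ t)
      (B * √(2 * ℓ + 1) + (K + K')) := by
    convert (hK ℓ).add (hK' ℓ) using 1
    · abel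
    · ring
  have h1 := HNeg.dir_le hγ hlam (hu ℓ) hW
  rw [R.inner_eq_add_dir γ lam ℓ (hu ℓ) t, mul_add, add_assoc]
  gcongr
  -- By `(x + y)² ≤ 2x² + 2y²`; after division by `2ℓ` only `2B²` survives in the limit.
  have h2 : (B * √(2 * ℓ + 1) + (K + K')) ^ 2 ≤ 2 * B ^ 2 * (2 * ℓ + 1) + 2 * (K + K') ^ 2 := by
    have h3 : √(2 * (ℓ : ℝ) + 1) ^ 2 = 2 * ℓ + 1 := Real.sq_sqrt (by positivity)
    nlinarith [sq_nonneg (B * √(2 * ℓ + 1) - (K + K'))]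
  calc (2 * (ℓ : ℝ))⁻¹ * R.dir γ lam ℓ (u ℓ - t)
      ≤ (2 * (ℓ : ℝ))⁻¹ * (2 * B ^ 2 * (2 * ℓ + 1) + 2 * (K + K') ^ 2) := by
        gcongr; exact h1.trans h2
    _ = 2 * B ^ 2 + (B ^ 2 + (K + K') ^ 2) * ((ℓ : ℝ))⁻¹ := by field_simp; ring
    _ ≤ _ := by linarith

end LatticeRep

/-- A sequence that is asymptotically above all elements of `VB`, and asymptotically below some
element of `VB` up to an arbitrarily small error, converges to the supremum. -/
lemma isLUB_and_tendsto_sSup {A : ℕ → ℝ} {V VB : Set ℝ} (hsub : V ⊆ VB)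
    (hdom : ∀ v ∈ VB, ∃ w ∈ V, v ≤ w)
    (hlow : ∀ v ∈ VB, ∀ ε > 0, ∀ᶠ ℓ in atTop, v - ε ≤ A ℓ)
    (hup : ∀ ε > 0, ∃ v ∈ VB, ∀ᶠ ℓ in atTop, A ℓ ≤ v + ε) :
    IsLUB V (sSup V) ∧ IsLUB VB (sSup V) ∧ Tendsto A atTop (𝓝 (sSup V)) := by
  have hne : V.Nonempty := by
    obtain ⟨v, hv, _⟩ := hup 1 one_pos
    obtain ⟨w, hw, _⟩ := hdom v hv
    exact ⟨w, hw⟩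
  -- All elements of `VB` lie asymptotically below the sequence, and the sequence lies eventually
  -- below one fixed element plus an error, so `VB` is bounded.
  have hbdd : BddAbove VB := by
    obtain ⟨v, _, hv⟩ := hup 1 one_pos
    refine ⟨v + 2, fun w hw => ?_⟩
    obtain ⟨ℓ, h1, h2⟩ := (hv.and (hlow w hw 1 one_pos)).exists
    linarith
  have hV : IsLUB V (sSup V) := isLUB_csSup hne (hbdd.mono hsub)
  have hVB : IsLUB VB (sSup V) := by
    refine ⟨fun v hv => ?_, fun c hc => hV.2 fun v hv => hc (hsub hv)⟩
    obtain ⟨w, hw, hvw⟩ := hdom v hv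
    exact hvw.trans (hV.1 hw)
  refine ⟨hV, hVB, ?_⟩
  rw [tendsto_order]
  constructor
  · intro c hc
    obtain ⟨v, hv, hcv⟩ := (lt_isLUB_iff hVB).1 hc
    filter_upwards [hlow v hv ((v - c) / 2) (by linarith)] with ℓ hℓ
    linarith
  · intro c hc
    obtain ⟨v, hv, h⟩ := hup ((c - sSup V) / 2) (by linarith)
    filter_upwards [h] with ℓ hℓ
    linarith [hVB.1 hv]

end HarmonicChain
end

/-! ### Realization on `L²` of the disorder and the configuration. -/

noncomputable section

namespace HarmonicChain

open MeasureTheory ProbabilityTheory Filter Topology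

variable {C : ℝ}

/-- The action of `flip` on pairs (disorder, configuration). -/
def flipMap (x : ℤ) (p : Disorder C × Config) : Disorder C × Config := (p.1, flip x p.2)

/-- The action of `exch` on pairs (disorder, configuration). -/
def exchMap (x : ℤ) (p : Disorder C × Config) : Disorder C × Config := (p.1, exch x p.2)

/-- The action of the translations on pairs (disorder, configuration). -/
def shiftMap (x : ℤ) (p : Disorder C × Config) : Disorder C × Config :=
  (fun z => p.1 (x + z), fun z => p.2 (x + z))

lemma flip_flip (x : ℤ) (ω : Config) : flip x (flip x ω) = ω := by
  unfold flip; simp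

lemma exch_exch (x : ℤ) (ω : Config) : exch x (exch x ω) = ω := by
  funext z
  simp [exch]

lemma flip_shift_eq (x y : ℤ) (ω : Config) :
    flip y (fun z => ω (x + z)) = fun z => flip (x + y) ω (x + z) := by
  ext z
  simp [flip, Function.update_apply]

lemma exch_shift_eq (x y : ℤ) (ω : Config) :
    exch y (fun z => ω (x + z)) = fun z => exch (x + y) ω (x + z) := by
  ext z
  simp only [exch, Equiv.swap_apply_def]
  congr 1
  split_ifs <;> omega

instance : IsProbabilityMeasure gibbs := by unfold gibbs; infer_instance

lemma measurePreserving_flip (x : ℤ) : MeasurePreserving (flip x) gibbs gibbs := by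
  have h : flip x = fun (ω : Config) i => (fun i : ℤ => if i = x then fun t : ℝ => -t else id) i (ω i) := by
    ext ω i
    simp only [flip, Function.update_apply]
    split_ifs with h <;> simp [h]
  have hm : ∀ i : ℤ, Measurable ((fun i : ℤ => if i = x then fun t : ℝ => -t else id) i) := by
    intro i
    show Measurable (if i = x then fun t : ℝ => -t else id)
    split_ifs
    · exact measurable_neg
    · exact measurable_id
  rw [h]
  refine ⟨measurable_pi_lambda _ fun i => (hm i).comp (measurable_pi_apply i), ?_⟩
  rw [gibbs, Measure.infinitePi_map_pi _ hm]
  congr 1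
  ext1 i
  split_ifs
  · rw [gaussianReal_map_neg, neg_zero]
  · rw [Measure.map_id]

/-- An i.i.d. family stays i.i.d. under an injective relabelling of the sites; this serves both the
exchanges and the translations. -/
lemma measurePreserving_comp_injective {X : Type*} [MeasurableSpace X] (P : Measure X)
    [IsProbabilityMeasure P] {e : ℤ → ℤ} (he : Function.Injective e) :
    MeasurePreserving (fun (ω : ℤ → X) i => ω (e i)) (Measure.infinitePi fun _ => P)
      (Measure.infinitePi fun _ => P) :=
  ⟨by fun_prop, Measure.map_infinitePi_infinitePi_of_inj he⟩

variable (ν : Measure (Set.Icc C⁻¹ C)) [IsProbabilityMeasure ν]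

lemma measurePreserving_flipMap (x : ℤ) :
    MeasurePreserving (flipMap x) (starMeasure ν) (starMeasure ν) :=
  (MeasurePreserving.id _).prod (measurePreserving_flip x)

lemma measurePreserving_exchMap (x : ℤ) :
    MeasurePreserving (exchMap x) (starMeasure ν) (starMeasure ν) :=
  (MeasurePreserving.id _).prod
    (measurePreserving_comp_injective _ (Equiv.swap x (x + 1)).injective)

lemma measurePreserving_shiftMap (x : ℤ) :
    MeasurePreserving (shiftMap x) (starMeasure ν) (starMeasure ν) :=
  (measurePreserving_comp_injective _ (add_right_injective x)).prod
    (measurePreserving_comp_injective _ (add_right_injective x))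

lemma compMeasurePreserving_congr {α : Type*} [MeasurableSpace α] {μ : Measure α}
    {f g : α → α} (hf : MeasurePreserving f μ μ) (hg : MeasurePreserving g μ μ) (h : f = g)
    (v : Lp ℝ 2 μ) :
    Lp.compMeasurePreserving f hf v = Lp.compMeasurePreserving g hg v := by
  subst h
  rfl

lemma compMeasurePreserving_comp_eq {α : Type*} [MeasurableSpace α] {μ : Measure α}
    {f f' g g' : α → α} (hf : MeasurePreserving f μ μ) (hf' : MeasurePreserving f' μ μ)
    (hg : MeasurePreserving g μ μ) (hg' : MeasurePreserving g' μ μ) (h : f ∘ f' = g ∘ g')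
    (v : Lp ℝ 2 μ) :
    Lp.compMeasurePreserving f' hf' (Lp.compMeasurePreserving f hf v) =
      Lp.compMeasurePreserving g' hg' (Lp.compMeasurePreserving g hg v) := by
  rw [← Lp.compMeasurePreserving_comp_apply, ← Lp.compMeasurePreserving_comp_apply]
  exact compMeasurePreserving_congr _ _ h v

lemma compMeasurePreserving_eq_self {α : Type*} [MeasurableSpace α] {μ : Measure α}
    {f : α → α} (hf : MeasurePreserving f μ μ) (h : f = id) (v : Lp ℝ 2 μ) :
    Lp.compMeasurePreserving f hf v = v := by
  subst h
  exact Lp.compMeasurePreserving_id_apply v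

lemma inner_compMeasurePreserving {α : Type*} [MeasurableSpace α] {μ : Measure α}
    {f : α → α} (hf : MeasurePreserving f μ μ) (v w : Lp ℝ 2 μ) :
    inner ℝ (Lp.compMeasurePreserving f hf v) (Lp.compMeasurePreserving f hf w) = inner ℝ v w :=
  (Lp.compMeasurePreservingₗᵢ ℝ f hf).inner_map_map v w

/-- The flips, exchanges and translations acting on `L²`. -/
def chainRep : LatticeRep (Lp ℝ 2 (starMeasure ν)) where
  flip x := Lp.compMeasurePreservingₗ ℝ (flipMap x) (measurePreserving_flipMap ν x)
  exch x := Lp.compMeasurePreservingₗ ℝ (exchMap x) (measurePreserving_exchMap ν x)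
  shift x := Lp.compMeasurePreservingₗ ℝ (shiftMap x) (measurePreserving_shiftMap ν x)
  flip_flip x v := by
    refine (Lp.compMeasurePreserving_comp_apply v _ _).symm.trans ?_
    exact compMeasurePreserving_eq_self _ (funext fun p => by simp [flipMap, flip_flip]) v
  exch_exch x v := by
    refine (Lp.compMeasurePreserving_comp_apply v _ _).symm.trans ?_
    exact compMeasurePreserving_eq_self _ (funext fun p => by simp [exchMap, exch_exch]) v
  inner_flip x v w := by
    refine (inner_compMeasurePreserving (measurePreserving_flipMap ν x) _ _).symm.trans ?_
    congr 1
    refine (Lp.compMeasurePreserving_comp_apply v _ _).symm.trans ?_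
    exact compMeasurePreserving_eq_self _ (funext fun p => by simp [flipMap, flip_flip]) v
  inner_exch x v w := by
    refine (inner_compMeasurePreserving (measurePreserving_exchMap ν x) _ _).symm.trans ?_
    congr 1
    refine (Lp.compMeasurePreserving_comp_apply v _ _).symm.trans ?_
    exact compMeasurePreserving_eq_self _ (funext fun p => by simp [exchMap, exch_exch]) v
  inner_shift x v w := inner_compMeasurePreserving _ v w
  shift_zero v := compMeasurePreserving_eq_self _ (funext fun p => by simp [shiftMap]) v
  shift_shift x y v := by
    refine (Lp.compMeasurePreserving_comp_apply v _ _).symm.trans ?_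
    exact compMeasurePreserving_congr _ _ (funext fun p => by simp [shiftMap, add_assoc]) v
  shift_flip x y v := compMeasurePreserving_comp_eq _ _ _ _
    (funext fun p => by simp [shiftMap, flipMap, flip_shift_eq]) v
  shift_exch x y v := compMeasurePreserving_comp_eq _ _ _ _
    (funext fun p => by simp [shiftMap, exchMap, exch_shift_eq]) v

/-- Square integrable functions of the disorder and of the configuration. -/
def IsL2 (f : Fn C) : Prop := MemLp (fun p : Disorder C × Config => f p.1 p.2) 2 (starMeasure ν)

open Classical in
/-- The class of a square integrable function. -/
def cls (f : Fn C) : Lp ℝ 2 (starMeasure ν) := if h : IsL2 ν f then h.toLp else 0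

variable {ν}

lemma cls_eq {f : Fn C} (h : IsL2 ν f) : cls ν f = h.toLp := dif_pos h

lemma IsL2.coeFn {f : Fn C} (h : IsL2 ν f) :
    cls ν f =ᵐ[starMeasure ν] fun p => f p.1 p.2 := by
  rw [cls_eq h]; exact MemLp.coeFn_toLp h

lemma IsL2.add {f g : Fn C} (hf : IsL2 ν f) (hg : IsL2 ν g) : IsL2 ν (f + g) := MemLp.add hf hg

lemma IsL2.smul {f : Fn C} (hf : IsL2 ν f) (c : ℝ) : IsL2 ν (c • f) := MemLp.const_smul hf c

lemma IsL2.sub {f g : Fn C} (hf : IsL2 ν f) (hg : IsL2 ν g) : IsL2 ν (f - g) := MemLp.sub hf hg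

lemma IsL2.zero : IsL2 ν (0 : Fn C) := MemLp.zero

lemma IsL2.sum {ι : Type*} {A : Finset ι} {f : ι → Fn C} (hf : ∀ i ∈ A, IsL2 ν (f i)) :
    IsL2 ν (∑ i ∈ A, f i) :=
  Finset.sum_induction _ _ (fun _ _ => IsL2.add) IsL2.zero hf

lemma cls_add {f g : Fn C} (hf : IsL2 ν f) (hg : IsL2 ν g) :
    cls ν (f + g) = cls ν f + cls ν g := by
  rw [cls_eq hf, cls_eq hg, cls_eq (hf.add hg)]; rfl

lemma cls_smul {f : Fn C} (hf : IsL2 ν f) (c : ℝ) : cls ν (c • f) = c • cls ν f := by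
  rw [cls_eq hf, cls_eq (hf.smul c)]; rfl

lemma cls_sub {f g : Fn C} (hf : IsL2 ν f) (hg : IsL2 ν g) :
    cls ν (f - g) = cls ν f - cls ν g := by
  rw [cls_eq hf, cls_eq hg, cls_eq (hf.sub hg)]; rfl

lemma cls_zero : cls ν (0 : Fn C) = 0 := by
  rw [cls_eq IsL2.zero]; rfl

lemma cls_sum {ι : Type*} {A : Finset ι} {f : ι → Fn C} (hf : ∀ i ∈ A, IsL2 ν (f i)) :
    cls ν (∑ i ∈ A, f i) = ∑ i ∈ A, cls ν (f i) := by
  classical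
  induction A using Finset.induction_on with
  | empty => simpa using cls_zero
  | insert i A hi ih =>
    have h1 := fun j (hj : j ∈ A) => hf j (Finset.mem_insert_of_mem hj)
    rw [Finset.sum_insert hi, Finset.sum_insert hi,
      cls_add (hf i (Finset.mem_insert_self _ _)) (IsL2.sum h1), ih h1]

lemma IsL2.comp_flip {f : Fn C} (hf : IsL2 ν f) (x : ℤ) : IsL2 ν fun m ω => f m (flip x ω) :=
  MemLp.comp_measurePreserving hf (measurePreserving_flipMap ν x)

lemma IsL2.comp_exch {f : Fn C} (hf : IsL2 ν f) (x : ℤ) : IsL2 ν fun m ω => f m (exch x ω) :=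
  MemLp.comp_measurePreserving hf (measurePreserving_exchMap ν x)

lemma IsL2.shift {f : Fn C} (hf : IsL2 ν f) (x : ℤ) : IsL2 ν (shift x f) :=
  MemLp.comp_measurePreserving hf (measurePreserving_shiftMap ν x)

lemma IsL2.gradFlip {f : Fn C} (hf : IsL2 ν f) (x : ℤ) : IsL2 ν (gradFlip x f) :=
  (hf.comp_flip x).sub hf

lemma IsL2.gradExch {f : Fn C} (hf : IsL2 ν f) (x : ℤ) : IsL2 ν (gradExch x f) :=
  (hf.comp_exch x).sub hf

lemma cls_comp_flip {f : Fn C} (hf : IsL2 ν f) (x : ℤ) :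
    cls ν (fun m ω => f m (flip x ω)) = (chainRep ν).flip x (cls ν f) := by
  rw [cls_eq hf, cls_eq (hf.comp_flip x)]; rfl

lemma cls_comp_exch {f : Fn C} (hf : IsL2 ν f) (x : ℤ) :
    cls ν (fun m ω => f m (exch x ω)) = (chainRep ν).exch x (cls ν f) := by
  rw [cls_eq hf, cls_eq (hf.comp_exch x)]; rfl

lemma cls_shift {f : Fn C} (hf : IsL2 ν f) (x : ℤ) :
    cls ν (shift x f) = (chainRep ν).shift x (cls ν f) := by
  rw [cls_eq hf, cls_eq (hf.shift x)]; rfl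

lemma cls_gradFlip {f : Fn C} (hf : IsL2 ν f) (x : ℤ) :
    cls ν (gradFlip x f) = (chainRep ν).flip x (cls ν f) - cls ν f := by
  rw [← cls_comp_flip hf]; exact cls_sub (hf.comp_flip x) hf

lemma cls_gradExch {f : Fn C} (hf : IsL2 ν f) (x : ℤ) :
    cls ν (gradExch x f) = (chainRep ν).exch x (cls ν f) - cls ν f := by
  rw [← cls_comp_exch hf]; exact cls_sub (hf.comp_exch x) hf

lemma inner_cls {f g : Fn C} (hf : IsL2 ν f) (hg : IsL2 ν g) :
    inner ℝ (cls ν f) (cls ν g) = starE ν fun m ω => f m ω * g m ω := by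
  rw [L2.inner_def]
  apply integral_congr_ae
  filter_upwards [hf.coeFn, hg.coeFn] with p h1 h2
  rw [h1, h2]
  simp [mul_comm]

lemma norm_cls_sq {f : Fn C} (hf : IsL2 ν f) :
    ‖cls ν f‖ ^ 2 = starE ν fun m ω => f m ω ^ 2 := by
  rw [← real_inner_self_eq_norm_sq, inner_cls hf hf]
  simp only [sq]

lemma cls_eq_cls_iff {f g : Fn C} (hf : IsL2 ν f) (hg : IsL2 ν g) :
    cls ν f = cls ν g ↔ ∀ᵐ p ∂(starMeasure ν), f p.1 p.2 = g p.1 p.2 := by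
  rw [cls_eq hf, cls_eq hg]
  exact MemLp.toLp_eq_toLp_iff hf hg

lemma exists_cls_eq (v : Lp ℝ 2 (starMeasure ν)) : ∃ f : Fn C, IsL2 ν f ∧ cls ν f = v := by
  have h : IsL2 ν (fun m ω => v (m, ω)) := Lp.memLp v
  exact ⟨_, h, by rw [cls_eq h]; exact Lp.toLp_coeFn v (Lp.memLp v)⟩

lemma boxGenerator_eq (γ lam : ℝ) (ℓ : ℕ) (f : Fn C) :
    boxGenerator γ lam ℓ f = γ • ∑ x ∈ Finset.Icc (-(ℓ : ℤ)) ℓ, gradFlip x f +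
      lam • ∑ x ∈ Finset.Ico (-(ℓ : ℤ)) ℓ, gradExch x f := by
  ext m ω
  simp [boxGenerator]

lemma IsL2.boxGenerator {f : Fn C} (hf : IsL2 ν f) (γ lam : ℝ) (ℓ : ℕ) :
    IsL2 ν (boxGenerator γ lam ℓ f) := by
  rw [boxGenerator_eq]
  exact ((IsL2.sum fun x _ => hf.gradFlip x).smul γ).add
    ((IsL2.sum fun x _ => hf.gradExch x).smul lam)

lemma cls_boxGenerator {f : Fn C} (hf : IsL2 ν f) (γ lam : ℝ) (ℓ : ℕ) :
    cls ν (boxGenerator γ lam ℓ f) = (chainRep ν).gen γ lam ℓ (cls ν f) := by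
  have h1 : ∀ x ∈ Finset.Icc (-(ℓ : ℤ)) ℓ, IsL2 ν (HarmonicChain.gradFlip x f) :=
    fun x _ => hf.gradFlip x
  have h2 : ∀ x ∈ Finset.Ico (-(ℓ : ℤ)) ℓ, IsL2 ν (HarmonicChain.gradExch x f) :=
    fun x _ => hf.gradExch x
  rw [boxGenerator_eq, cls_add ((IsL2.sum h1).smul γ) ((IsL2.sum h2).smul lam),
    cls_smul (IsL2.sum h1), cls_smul (IsL2.sum h2), cls_sum h1, cls_sum h2,
    LatticeRep.gen_apply]
  simp only [cls_gradFlip hf, cls_gradExch hf]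

lemma isInverse_iff {γ lam : ℝ} {ℓ : ℕ} {u Φ : Fn C} (hΦ : IsL2 ν Φ) :
    IsInverse ν γ lam ℓ u Φ ↔
      IsL2 ν u ∧ -(chainRep ν).gen γ lam ℓ (cls ν u) = cls ν Φ := by
  refine and_congr_right fun hu => ?_
  have hu' : IsL2 ν u := hu
  rw [← cls_boxGenerator hu', neg_eq_iff_eq_neg, ← neg_one_smul ℝ (cls ν Φ), ← cls_smul hΦ,
    cls_eq_cls_iff (hu'.boxGenerator γ lam ℓ) (hΦ.smul _)]
  refine eventually_congr (Eventually.of_forall fun p => ?_)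
  simp [neg_eq_iff_eq_neg]

end HarmonicChain
end

/-! ### Disorder coefficients, moments, and monomials in `L²`. -/

noncomputable section

namespace HarmonicChain

open MeasureTheory ProbabilityTheory Filter Topology

variable {C : ℝ}

/-! ### Coefficients -/

/-- Continuous cylinder functions of the disorder. -/
def coefs (C : ℝ) : Submodule ℝ (Disorder C → ℝ) where
  carrier := {ψ | Continuous ψ ∧ ∃ Λ : Finset ℤ, DependsOn ψ (Λ : Set ℤ)}
  zero_mem' := ⟨continuous_const, ∅, fun _ _ _ => rfl⟩
  add_mem' := by
    rintro ψ ψ' ⟨h, Λ, hΛ⟩ ⟨h', Λ', hΛ'⟩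
    refine ⟨h.add h', Λ ∪ Λ', fun m m' hm => ?_⟩
    rw [Pi.add_apply, Pi.add_apply, hΛ fun i hi => hm i (by simp_all),
      hΛ' fun i hi => hm i (by simp_all)]
  smul_mem' := by
    rintro c ψ ⟨h, Λ, hΛ⟩
    refine ⟨h.const_smul c, Λ, fun m m' hm => ?_⟩
    rw [Pi.smul_apply, Pi.smul_apply, hΛ hm]

/-- The translations of the coefficients. -/
def coefShift (x : ℤ) : coefs C →ₗ[ℝ] coefs C where
  toFun ψ := ⟨fun m => ψ.1 fun z => m (x + z), by
    obtain ⟨ψ, h, Λ, hΛ⟩ := ψ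
    refine ⟨h.comp (by fun_prop), Λ.image (x + ·), fun m m' hm => ?_⟩
    exact hΛ fun i hi => hm _ (by simpa using hi)⟩
  map_add' _ _ := rfl
  map_smul' _ _ := rfl

lemma coefShift_apply (x : ℤ) (ψ : coefs C) (m : Disorder C) :
    (coefShift x ψ).1 m = ψ.1 fun z => m (x + z) := rfl

lemma coefShift_coefShift (x y : ℤ) (ψ : coefs C) :
    coefShift x (coefShift y ψ) = coefShift (x + y) ψ := by
  ext m
  simp [coefShift_apply, add_assoc]

lemma coefShift_zero (ψ : coefs C) : coefShift 0 ψ = ψ := by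
  ext m
  simp [coefShift_apply]

/-- The constant coefficient equal to one. -/
def coefOne : coefs C := ⟨fun _ => 1, continuous_const, ∅, fun _ _ _ => rfl⟩

lemma coefShift_one (x : ℤ) : coefShift x (coefOne : coefs C) = coefOne := rfl

variable (ν : Measure (Set.Icc C⁻¹ C)) [IsProbabilityMeasure ν]

/-- The disorder space is compact, so continuous coefficients are bounded. -/
lemma coefs_memLp (ψ : coefs C) (p : ENNReal) :
    MemLp ψ.1 p (Measure.infinitePi fun _ : ℤ => ν) := by
  obtain ⟨K, hK⟩ := isCompact_univ.exists_bound_of_continuousOn ψ.2.1.continuousOn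
  exact MemLp.of_bound ψ.2.1.aestronglyMeasurable K (ae_of_all _ fun m => hK m (Set.mem_univ m))

lemma dependsOn_indepFun {X : Type*} [MeasurableSpace X] (P : Measure X) [IsProbabilityMeasure P]
    {f g : (ℤ → X) → ℝ} (hf : Measurable f) (hg : Measurable g) {Λ Λ' : Finset ℤ}
    (hfΛ : DependsOn f (Λ : Set ℤ)) (hgΛ : DependsOn g (Λ' : Set ℤ)) (hΛ : Disjoint Λ Λ') :
    IndepFun f g (Measure.infinitePi fun _ : ℤ => P) := by
  classical
  have : Nonempty X := nonempty_of_isProbabilityMeasure P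
  have hind : iIndepFun (fun i (ω : ℤ → X) => ω i) (Measure.infinitePi fun _ : ℤ => P) :=
    iIndepFun_infinitePi (X := fun _ => id) fun _ => measurable_id
  have h := hind.indepFun_finset Λ Λ' hΛ fun i => measurable_pi_apply i
  let x₀ : X := Classical.arbitrary X
  -- Filling the missing coordinates with `x₀` makes `f` and `g` measurable functions of the
  -- restrictions to the disjoint sets `Λ` and `Λ'`.
  let ext (A : Finset ℤ) (y : A → X) : ℤ → X := fun i => if hi : i ∈ A then y ⟨i, hi⟩ else x₀
  have hext : ∀ A : Finset ℤ, Measurable (ext A) := by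
    intro A
    refine measurable_pi_lambda _ fun i => ?_
    by_cases hi : i ∈ A
    · simpa [ext, hi] using measurable_pi_apply _
    · simp [ext, hi]
  have := h.comp (hf.comp (hext Λ)) (hg.comp (hext Λ'))
  convert this using 1
  · ext ω
    exact hfΛ fun i hi => by simp [ext, Finset.mem_coe.1 hi]
  · ext ω
    exact hgΛ fun i hi => by simp [ext, Finset.mem_coe.1 hi]

/-- The expectation of a coefficient. -/
def coefMean (ψ : coefs C) : ℝ := ∫ m, ψ.1 m ∂(Measure.infinitePi fun _ : ℤ => ν)

lemma coefMean_shift (x : ℤ) (ψ : coefs C) : coefMean ν (coefShift x ψ) = coefMean ν ψ := by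
  have h := measurePreserving_comp_injective ν (add_right_injective x)
  have := integral_map (μ := Measure.infinitePi fun _ : ℤ => ν) h.measurable.aemeasurable
    (f := ψ.1) ψ.2.1.aestronglyMeasurable
  rw [h.map_eq] at this
  exact this.symm

lemma coefMean_sub_smul_one (ψ : coefs C) : coefMean ν (ψ - coefMean ν ψ • coefOne) = 0 := by
  have h : ∀ m, (ψ - coefMean ν ψ • coefOne : coefs C).1 m = ψ.1 m - coefMean ν ψ := by
    intro m; simp [coefOne]
  unfold coefMean at h ⊢
  simp only [h]
  rw [integral_sub ((coefs_memLp ν ψ 1).integrable le_rfl) (integrable_const _)]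
  simp

/-- Distant translates of a centered coefficient are uncorrelated. -/
lemma exists_integral_shift_mul_shift_eq_zero {ψ : coefs C} (hψ : coefMean ν ψ = 0) :
    ∃ d : ℕ, ∀ k k' : ℤ, (d : ℤ) < |k - k'| →
      ∫ m, (coefShift k ψ).1 m * (coefShift k' ψ).1 m ∂(Measure.infinitePi fun _ : ℤ => ν) = 0 := by
  obtain ⟨Λ, hΛ⟩ := ψ.2.2
  obtain ⟨r, hr⟩ : ∃ r : ℕ, ∀ i ∈ Λ, |i| ≤ r := by
    refine ⟨Λ.sup Int.natAbs, fun i hi => ?_⟩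
    have := Finset.le_sup (f := Int.natAbs) hi
    rw [Int.abs_eq_natAbs]
    exact_mod_cast this
  -- Two translates of a set of radius `r` are disjoint once the shifts differ by more than `2r`.
  refine ⟨2 * r, fun k k' hk => ?_⟩
  have hdep : ∀ x : ℤ, DependsOn (coefShift x ψ).1 ((Λ.image (x + ·) : Finset ℤ) : Set ℤ) :=
    fun x m m' hm => hΛ fun i hi => hm _ (by simpa using hi)
  have hind := dependsOn_indepFun ν (coefShift k ψ).2.1.measurable
    (coefShift k' ψ).2.1.measurable (hdep k) (hdep k') (by
      rw [Finset.disjoint_left]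
      intro z hz hz'
      simp only [Finset.mem_image] at hz hz'
      obtain ⟨i, hi, rfl⟩ := hz
      obtain ⟨j, hj, hij⟩ := hz'
      have h1 := abs_le.1 (hr i hi)
      have h2 := abs_le.1 (hr j hj)
      rcases lt_abs.1 hk with h | h <;> push_cast at h <;> omega)
  rw [hind.integral_fun_mul_eq_mul_integral (coefShift k ψ).2.1.aestronglyMeasurable
    (coefShift k' ψ).2.1.aestronglyMeasurable]
  have := coefMean_shift ν k ψ
  rw [hψ, coefMean] at this
  rw [this, zero_mul]

/-! ### Gaussian moments -/

lemma memLp_eval_gibbs (i : ℤ) (p : ENNReal) (hp : p ≠ ⊤) :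
    MemLp (fun ω : Config => ω i) p gibbs :=
  (memLp_id_gaussianReal' p hp).comp_measurePreserving
    (measurePreserving_eval_infinitePi (fun _ : ℤ => gaussianReal 0 1) i)

lemma memLp_mul_gibbs (i j : ℤ) : MemLp (fun ω : Config => ω i * ω j) 2 gibbs := by
  have : ENNReal.HolderTriple 4 4 2 := by
    constructor
    rw [← two_mul, show (4 : ENNReal) = 2 * 2 by norm_num, ENNReal.mul_inv (by simp) (by simp),
      ← mul_assoc, ENNReal.mul_inv_cancel (by simp) (by simp), one_mul]
  exact (memLp_eval_gibbs j 4 (by simp)).mul (memLp_eval_gibbs i 4 (by simp))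

lemma memLp_sq_gibbs (i : ℤ) : MemLp (fun ω : Config => ω i ^ 2) 2 gibbs := by
  simpa only [sq] using memLp_mul_gibbs i i

lemma integral_eval_gibbs (i : ℤ) {f : ℝ → ℝ} (hf : Measurable f) :
    ∫ ω, f (ω i) ∂gibbs = ∫ t, f t ∂(gaussianReal 0 1) := by
  have h := measurePreserving_eval_infinitePi (fun _ : ℤ => gaussianReal 0 1) i
  have := integral_map (μ := gibbs) h.measurable.aemeasurable (f := f) hf.aestronglyMeasurable
  rw [← this]
  rw [← h.map_eq]
  rfl

/-- The second moment of `ω i * ω j`. -/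
def pairMoment (i j : ℤ) : ℝ := ∫ ω, (ω i * ω j) * (ω i * ω j) ∂gibbs

lemma integrable_pow_four_gibbs (i : ℤ) : Integrable (fun ω : Config => ω i ^ 4) gibbs := by
  have := (memLp_sq_gibbs i).integrable_sq
  simpa only [← pow_mul] using this

lemma integrable_pair_gibbs (i j : ℤ) :
    Integrable (fun ω : Config => (ω i * ω j) * (ω i * ω j)) gibbs := by
  have := (memLp_mul_gibbs i j).integrable_sq
  simpa only [sq] using this

/-- From `ω_i² ω_j² ≤ (ω_i⁴ + ω_j⁴) / 2`. Uniformity in the sites is what the iteration for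
off-diagonal monomials starts from. -/
lemma pairMoment_le (i j : ℤ) : pairMoment i j ≤ pairMoment 0 0 := by
  have h4 : ∀ i : ℤ, ∫ ω, ω i ^ 4 ∂gibbs = pairMoment 0 0 := by
    intro i
    rw [integral_eval_gibbs i (f := fun t => t ^ 4) (by fun_prop),
      ← integral_eval_gibbs 0 (f := fun t => t ^ 4) (by fun_prop), pairMoment]
    congr 1
    ext ω
    ring
  have h := integral_mono (integrable_pair_gibbs i j)
    (((integrable_pow_four_gibbs i).add (integrable_pow_four_gibbs j)).const_mul (1 / 2))
    (fun ω => by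
      simp only [Pi.add_apply]
      nlinarith [sq_nonneg (ω i ^ 2 - ω j ^ 2)])
  rw [integral_const_mul] at h
  have h5 := integral_add (integrable_pow_four_gibbs i) (integrable_pow_four_gibbs j)
  rw [h4, h4] at h5
  have h6 : ∫ a : Config, ((fun ω : Config => ω i ^ 4) + fun ω : Config => ω j ^ 4) a ∂gibbs =
    pairMoment 0 0 + pairMoment 0 0 := h5
  rw [h6] at h
  unfold pairMoment at h ⊢
  linarith

lemma chi_eq_variance : chi = Var[fun ω : Config => ω 0 ^ 2; gibbs] := by
  rw [variance_eq_sub (memLp_sq_gibbs 0), chi]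
  simp only [Pi.pow_apply, ← pow_mul]

/-- If the variance vanished, `ω_0` would almost surely take one of two values `±√c`, whereas the
Gaussian law has no atoms. -/
lemma chi_pos : 0 < chi := by
  rw [chi_eq_variance]
  refine lt_of_le_of_ne (variance_nonneg _ _) fun h => ?_
  have h1 := ae_eq_integral_of_variance_eq_zero (memLp_sq_gibbs 0) h.symm
  set c := ∫ ω : Config, ω 0 ^ 2 ∂gibbs
  have h2 := measurePreserving_eval_infinitePi (fun _ : ℤ => gaussianReal 0 1) 0
  have h3 : ∀ᵐ t ∂(gaussianReal 0 1), t ∈ ({√c, -√c} : Set ℝ) := by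
    have hS : MeasurableSet {t : ℝ | t ∈ ({√c, -√c} : Set ℝ)} :=
      (Set.toFinite ({√c, -√c} : Set ℝ)).measurableSet
    rw [← h2.map_eq, ae_map_iff h2.measurable.aemeasurable hS]
    filter_upwards [h1] with ω hω
    have hω' : ω 0 ^ 2 = c := hω
    rw [← hω', Real.sqrt_sq_eq_abs]
    rcases abs_choice (ω 0) with h | h <;> simp [h]
  have : NullSingletonClass (gaussianReal 0 1) :=
    nullSingletonClass_gaussianReal one_ne_zero
  have h4 : ∀ᵐ t ∂(gaussianReal 0 1), t ∉ ({√c, -√c} : Set ℝ) :=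
    (Set.toFinite _).countable.ae_notMem _
  obtain ⟨t, h5, h6⟩ := (h3.and h4).exists
  exact h6 h5

lemma integral_sq_sub_sq_sq : ∫ ω : Config, (ω 0 ^ 2 - ω 1 ^ 2) ^ 2 ∂gibbs = 2 * chi := by
  have hind : IndepFun (fun ω : Config => ω 0 ^ 2) (fun ω : Config => ω 1 ^ 2) gibbs :=
    (iIndepFun_infinitePi (P := fun _ : ℤ => gaussianReal 0 1) (X := fun _ t => t ^ 2)
      fun _ => by fun_prop).indepFun (by norm_num)
  have h1 := hind.integral_fun_mul_eq_mul_integral (memLp_sq_gibbs 0).1 (memLp_sq_gibbs 1).1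
  have h2 : ∫ ω : Config, ω 1 ^ 2 ∂gibbs = ∫ ω : Config, ω 0 ^ 2 ∂gibbs := by
    rw [integral_eval_gibbs 1 (f := fun t => t ^ 2) (by fun_prop),
      ← integral_eval_gibbs 0 (f := fun t => t ^ 2) (by fun_prop)]
  have h3 : ∫ ω : Config, ω 1 ^ 4 ∂gibbs = ∫ ω : Config, ω 0 ^ 4 ∂gibbs := by
    rw [integral_eval_gibbs 1 (f := fun t => t ^ 4) (by fun_prop),
      ← integral_eval_gibbs 0 (f := fun t => t ^ 4) (by fun_prop)]
  have hI : Integrable (fun ω : Config => ω 0 ^ 2 * ω 1 ^ 2) gibbs := by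
    refine (integrable_pair_gibbs 0 1).congr (ae_of_all _ fun ω => ?_)
    show ω 0 * ω 1 * (ω 0 * ω 1) = _
    ring
  have h4 : ∀ ω : Config, (ω 0 ^ 2 - ω 1 ^ 2) ^ 2 =
      ω 0 ^ 4 + ω 1 ^ 4 - 2 * (ω 0 ^ 2 * ω 1 ^ 2) := fun ω => by ring
  have h5 : Integrable (fun ω : Config => ω 0 ^ 4 + ω 1 ^ 4) gibbs :=
    (integrable_pow_four_gibbs 0).add (integrable_pow_four_gibbs 1)
  simp only [h4]
  rw [integral_sub h5 (hI.const_mul 2), integral_add (integrable_pow_four_gibbs 0) (integrable_pow_four_gibbs 1),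
    integral_const_mul, h1, h2, h3, chi]
  ring

/-! ### Monomials -/

/-- The monomial `ψ(m) ω_i ω_j`. -/
def monF (ψ : Disorder C → ℝ) (i j : ℤ) : Fn C := fun m ω => ψ m * (ω i * ω j)

lemma isL2_monF (ψ : coefs C) (i j : ℤ) : IsL2 ν (monF ψ.1 i j) := by
  have h1 : MemLp (fun p : Disorder C × Config => ψ.1 p.1) ⊤ (starMeasure ν) :=
    (coefs_memLp ν ψ ⊤).comp_measurePreserving measurePreserving_fst
  have h2 : MemLp (fun p : Disorder C × Config => p.2 i * p.2 j) 2 (starMeasure ν) :=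
    (memLp_mul_gibbs i j).comp_measurePreserving measurePreserving_snd
  exact h2.mul h1

/-- The class in `L²` of the monomial `ψ(m) ω_i ω_j`. -/
def mon (i j : ℤ) : coefs C →ₗ[ℝ] Lp ℝ 2 (starMeasure ν) where
  toFun ψ := cls ν (monF ψ.1 i j)
  map_add' ψ ψ' := by
    rw [← cls_add (isL2_monF ν ψ i j) (isL2_monF ν ψ' i j)]
    congr 1
    ext m ω
    simp [monF, add_mul]
  map_smul' c ψ := by
    rw [RingHom.id_apply, ← cls_smul (isL2_monF ν ψ i j)]
    congr 1
    ext m ω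
    simp [monF, mul_assoc]

lemma mon_apply (i j : ℤ) (ψ : coefs C) : mon ν i j ψ = cls ν (monF ψ.1 i j) := rfl

lemma shift_mon (x i j : ℤ) (ψ : coefs C) :
    (chainRep ν).shift x (mon ν i j ψ) = mon ν (x + i) (x + j) (coefShift x ψ) := by
  rw [mon_apply, ← cls_shift (isL2_monF ν ψ i j)]
  rfl

lemma exch_mon (x i j : ℤ) (ψ : coefs C) :
    (chainRep ν).exch x (mon ν i j ψ) =
      mon ν (Equiv.swap x (x + 1) i) (Equiv.swap x (x + 1) j) ψ := by
  rw [mon_apply, ← cls_comp_exch (isL2_monF ν ψ i j)]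
  rfl

lemma flip_mon_of_ne {x i j : ℤ} (hi : i ≠ x) (hj : j ≠ x) (ψ : coefs C) :
    (chainRep ν).flip x (mon ν i j ψ) = mon ν i j ψ := by
  rw [mon_apply, ← cls_comp_flip (isL2_monF ν ψ i j)]
  congr 1
  ext m ω
  simp [monF, flip, hi, hj]

lemma flip_mon_diag (x i : ℤ) (ψ : coefs C) :
    (chainRep ν).flip x (mon ν i i ψ) = mon ν i i ψ := by
  rw [mon_apply, ← cls_comp_flip (isL2_monF ν ψ i i)]
  congr 1
  ext m ω
  by_cases h : i = x
  · subst h; simp [monF, flip]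
  · simp [monF, flip, h]

lemma mon_comm (i j : ℤ) (ψ : coefs C) : mon ν i j ψ = mon ν j i ψ := by
  rw [mon_apply, mon_apply]
  congr 1
  ext m ω
  simp [monF, mul_comm]

lemma flip_mon_left {i j : ℤ} (hij : i ≠ j) (ψ : coefs C) :
    (chainRep ν).flip i (mon ν i j ψ) = -mon ν i j ψ := by
  rw [mon_apply, ← cls_comp_flip (isL2_monF ν ψ i j), ← neg_one_smul ℝ (cls ν _),
    ← cls_smul (isL2_monF ν ψ i j)]
  congr 1
  ext m ω
  simp [monF, flip, hij.symm]

lemma flip_mon_right {i j : ℤ} (hij : i ≠ j) (ψ : coefs C) :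
    (chainRep ν).flip j (mon ν i j ψ) = -mon ν i j ψ := by
  rw [mon_comm, flip_mon_left ν hij.symm]

lemma inner_mon (i j : ℤ) (ψ ψ' : coefs C) :
    inner ℝ (mon ν i j ψ) (mon ν i j ψ') =
      (∫ m, ψ.1 m * ψ'.1 m ∂(Measure.infinitePi fun _ : ℤ => ν)) * pairMoment i j := by
  rw [mon_apply, mon_apply, inner_cls (isL2_monF ν ψ i j) (isL2_monF ν ψ' i j), starE,
    starMeasure, pairMoment, ← integral_prod_mul]
  congr 1
  ext p
  simp only [monF]
  ring

lemma norm_mon_le (i j : ℤ) (ψ : coefs C) : ‖mon ν i j ψ‖ ≤ ‖mon ν 0 0 ψ‖ := by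
  rw [← abs_norm, ← abs_norm (mon ν 0 0 ψ)]
  apply sq_le_sq.1
  rw [← real_inner_self_eq_norm_sq, ← real_inner_self_eq_norm_sq, inner_mon, inner_mon]
  exact mul_le_mul_of_nonneg_left (pairMoment_le i j)
    (integral_nonneg fun m => mul_self_nonneg _)

end HarmonicChain
end

/-! ### Odd generators of the quadratic span, and solvability in a box. -/

noncomputable section

namespace HarmonicChain

open MeasureTheory ProbabilityTheory Filter Topology

namespace LatticeRep

variable {H : Type*} [NormedAddCommGroup H] [InnerProductSpace ℝ H] {R : LatticeRep H}

lemma Local.add {r : ℕ} {f g : H} (hf : R.Local r f) (hg : R.Local r g) : R.Local r (f + g) :=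
  fun x hx => by simp [(hf x hx).1, (hf x hx).2, (hg x hx).1, (hg x hx).2]

lemma Local.smul {r : ℕ} {f : H} (hf : R.Local r f) (c : ℝ) : R.Local r (c • f) :=
  fun x hx => by simp [(hf x hx).1, (hf x hx).2]

lemma Local.zero {r : ℕ} : R.Local r (0 : H) := fun x _ => by simp

lemma OrthInv.add {r : ℕ} {f g : H} (hf : R.OrthInv r f) (hg : R.OrthInv r g) :
    R.OrthInv r (f + g) :=
  fun v h1 h2 => by rw [inner_add_left, hf v h1 h2, hg v h1 h2, add_zero]

lemma OrthInv.smul {r : ℕ} {f : H} (hf : R.OrthInv r f) (c : ℝ) : R.OrthInv r (c • f) :=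
  fun v h1 h2 => by rw [real_inner_smul_left, hf v h1 h2, mul_zero]

lemma OrthInv.zero {r : ℕ} : R.OrthInv r (0 : H) := fun v _ _ => inner_zero_left v

lemma IsOdd.orthInv {r : ℕ} {f : H} (hf : R.IsOdd r f) : R.OrthInv r f := by
  intro v h1 h2
  rcases hf with ⟨k, hk, hkf⟩ | ⟨k, hk, hkf⟩
  · have := R.inner_flip k f v
    rw [hkf, h1 k hk, inner_neg_left] at this
    linarith
  · have := R.inner_exch k f v
    rw [hkf, h2 k hk, inner_neg_left] at this
    linarith

variable (R) in
/-- The scalar product of the translates of `f` with the linear profile does not depend on the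
translation nor on the box. -/
def ConstProfile (X : ℕ → H) (r : ℕ) (f : H) : Prop :=
  ∃ S : ℝ, ∀ (ℓ : ℕ) (x : ℤ), |x| + r ≤ ℓ → inner ℝ (R.shift x f) (X ℓ) = S

lemma ConstProfile.add {X : ℕ → H} {r : ℕ} {f g : H} (hf : R.ConstProfile X r f)
    (hg : R.ConstProfile X r g) : R.ConstProfile X r (f + g) := by
  obtain ⟨S, hS⟩ := hf
  obtain ⟨S', hS'⟩ := hg
  exact ⟨S + S', fun ℓ x hx => by rw [map_add, inner_add_left, hS ℓ x hx, hS' ℓ x hx]⟩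

lemma ConstProfile.smul {X : ℕ → H} {r : ℕ} {f : H} (hf : R.ConstProfile X r f) (c : ℝ) :
    R.ConstProfile X r (c • f) := by
  obtain ⟨S, hS⟩ := hf
  exact ⟨c * S, fun ℓ x hx => by rw [map_smul, real_inner_smul_left, hS ℓ x hx]⟩

lemma ConstProfile.zero {X : ℕ → H} {r : ℕ} : R.ConstProfile X r 0 := ⟨0, by simp⟩

/-- If `f` is odd under a flip the product is zero, since the profile is invariant. If it is odd
under the exchange at `k`, moving that exchange to the profile gives `-1/2 ⟨f, τ_k b⟩`, in which
neither the translation nor the box appears. -/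
lemma IsOdd.constProfile {X : ℕ → H} {b : H} (hX : R.IsLinearProfile X b) {r : ℕ} {f : H}
    (hf : R.IsOdd r f) : R.ConstProfile X r f := by
  rcases hf with ⟨k, hk, hkf⟩ | ⟨k, hk, hkf⟩
  · refine ⟨0, fun ℓ x hx => ?_⟩
    rw [Finset.mem_Icc] at hk
    have := R.inner_flip (x + k) (R.shift x f) (X ℓ)
    rw [← R.shift_flip, hkf, map_neg, inner_neg_left, hX.flip ℓ (x + k) (by
      have := abs_le.1 (le_refl |x|)
      rw [Finset.mem_Icc]
      omega)] at this
    linarith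
  · refine ⟨-(1 / 2) * inner ℝ f (R.shift k b), fun ℓ x hx => ?_⟩
    rw [Finset.mem_Ico] at hk
    have h1 := R.inner_exch (x + k) (R.shift x f) (X ℓ)
    have h2 := hX.exch ℓ (x + k) (by
      have := abs_le.1 (le_refl |x|)
      rw [Finset.mem_Ico]
      omega)
    rw [← R.shift_exch, hkf, map_neg, inner_neg_left, sub_eq_iff_eq_add.1 h2,
      inner_add_right, ← R.shift_shift, R.inner_shift] at h1
    linarith

end LatticeRep

/-- The norm of a sum of vectors whose correlations have finite range. -/
lemma norm_sum_range_sq_le {H : Type*} [NormedAddCommGroup H] [InnerProductSpace ℝ H]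
    (v : ℕ → H) (M : ℝ) (d : ℕ) (hM : ∀ k, ‖v k‖ ≤ M)
    (hv : ∀ k k' : ℕ, (d : ℤ) < |(k : ℤ) - k'| → inner ℝ (v k) (v k') = 0) (n : ℕ) :
    ‖∑ k ∈ Finset.range n, v k‖ ^ 2 ≤ n * (2 * d + 1) * M ^ 2 := by
  rw [← real_inner_self_eq_norm_sq, sum_inner]
  simp only [inner_sum]
  have h : ∀ k ∈ Finset.range n,
      ∑ k' ∈ Finset.range n, inner ℝ (v k) (v k') ≤ (2 * d + 1) * M ^ 2 := by
    intro k _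
    have hsub : ∑ k' ∈ Finset.range n, inner ℝ (v k) (v k') ≤
        ∑ k' ∈ (Finset.range n).filter (fun k' : ℕ => |(k : ℤ) - k'| ≤ d), M ^ 2 := by
      rw [Finset.sum_filter]
      refine Finset.sum_le_sum fun k' _ => ?_
      split_ifs with hk
      · refine (real_inner_le_norm _ _).trans ?_
        rw [sq]
        exact mul_le_mul (hM k) (hM k') (norm_nonneg _) ((norm_nonneg _).trans (hM k))
      · exact (hv k k' (not_le.1 hk)).le
    refine hsub.trans ?_
    rw [Finset.sum_const, nsmul_eq_mul]
    gcongr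
    have hcard : ((Finset.range n).filter (fun k' : ℕ => |(k : ℤ) - k'| ≤ d)).card ≤
        (Finset.Icc ((k : ℤ) - d) (k + d)).card := by
      refine Finset.card_le_card_of_injOn (fun k' : ℕ => (k' : ℤ)) ?_ (by
        intro a _ b _ hab; exact Nat.cast_injective hab)
      intro k' hk'
      have := abs_le.1 (Finset.mem_filter.1 hk').2
      simp only [Finset.coe_Icc, Set.mem_Icc]
      omega
    rw [Int.card_Icc] at hcard
    have : ((Finset.range n).filter (fun k' : ℕ => |(k : ℤ) - k'| ≤ d)).card ≤ 2 * d + 1 := by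
      omega
    exact_mod_cast this
  refine (Finset.sum_le_sum h).trans ?_
  rw [Finset.sum_const, Finset.card_range, nsmul_eq_mul, mul_assoc]

variable {C : ℝ} (ν : Measure (Set.Icc C⁻¹ C)) [IsProbabilityMeasure ν]

/-- The class in `L²` of `ψ(m) (ω_{i+1}² - ω_i²)`. -/
def bnd (i : ℤ) : coefs C →ₗ[ℝ] Lp ℝ 2 (starMeasure ν) := mon ν (i + 1) (i + 1) - mon ν i i

lemma bnd_apply (i : ℤ) (ψ : coefs C) :
    bnd ν i ψ = mon ν (i + 1) (i + 1) ψ - mon ν i i ψ := rfl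

lemma shift_bnd (x i : ℤ) (ψ : coefs C) :
    (chainRep ν).shift x (bnd ν i ψ) = bnd ν (x + i) (coefShift x ψ) := by
  rw [bnd_apply, bnd_apply, map_sub, shift_mon, shift_mon, add_assoc]

lemma exch_mon_of_ne {x i j : ℤ} (h1 : i ≠ x) (h2 : i ≠ x + 1) (h3 : j ≠ x) (h4 : j ≠ x + 1)
    (ψ : coefs C) : (chainRep ν).exch x (mon ν i j ψ) = mon ν i j ψ := by
  rw [exch_mon, Equiv.swap_apply_of_ne_of_ne h1 h2, Equiv.swap_apply_of_ne_of_ne h3 h4]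

lemma exch_bnd_self (i : ℤ) (ψ : coefs C) :
    (chainRep ν).exch i (bnd ν i ψ) = -bnd ν i ψ := by
  rw [bnd_apply, map_sub, exch_mon, exch_mon, Equiv.swap_apply_left, Equiv.swap_apply_right,
    neg_sub]

lemma isOdd_mon {i j : ℤ} (hij : i ≠ j) {r : ℕ} (hi : |i| ≤ r) (ψ : coefs C) :
    (chainRep ν).IsOdd r (mon ν i j ψ) :=
  Or.inl ⟨i, by rwa [Finset.mem_Icc, ← abs_le], flip_mon_left ν hij ψ⟩

lemma isOdd_bnd {i : ℤ} {r : ℕ} (hi : i ∈ Finset.Ico (-(r : ℤ)) r) (ψ : coefs C) :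
    (chainRep ν).IsOdd r (bnd ν i ψ) :=
  Or.inr ⟨i, hi, exch_bnd_self ν i ψ⟩

/-- The radius is `r + 1` because the exchange at `-r - 1` moves the site `-r`. -/
lemma local_mon {i j : ℤ} {r : ℕ} (hi : |i| ≤ r) (hj : |j| ≤ r) (ψ : coefs C) :
    (chainRep ν).Local (r + 1) (mon ν i j ψ) := by
  intro x hx
  rw [abs_le] at hi hj
  push_cast at hx
  constructor
  · apply flip_mon_of_ne <;> rcases lt_abs.1 hx with h | h <;> omega
  · apply exch_mon_of_ne <;> rcases lt_abs.1 hx with h | h <;> omega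

lemma local_bnd {i : ℤ} {r : ℕ} (hi : i ∈ Finset.Ico (-(r : ℤ)) r) (ψ : coefs C) :
    (chainRep ν).Local (r + 1) (bnd ν i ψ) := by
  rw [Finset.mem_Ico] at hi
  rw [bnd_apply, sub_eq_add_neg, ← neg_one_smul ℝ (mon ν i i ψ)]
  exact (local_mon ν (abs_le.2 (by omega)) (abs_le.2 (by omega)) ψ).add
    ((local_mon ν (abs_le.2 (by omega)) (abs_le.2 (by omega)) ψ).smul (-1))

/-- The span in `L²` of the functions `ψ(m) ω_i ω_j` and `ψ(m) (ω_{i+1}² - ω_i²)` that are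
supported in `Λ`. -/
def quadL2 (Λ : Set ℤ) : Submodule ℝ (Lp ℝ 2 (starMeasure ν)) :=
  Submodule.span ℝ ({v | ∃ (ψ : coefs C) (i j : ℤ), i ∈ Λ ∧ j ∈ Λ ∧ i ≠ j ∧ v = mon ν i j ψ} ∪
    {v | ∃ (ψ : coefs C) (i : ℤ), i ∈ Λ ∧ i + 1 ∈ Λ ∧ v = bnd ν i ψ})

variable {ν}

lemma mon_mem_quadL2 {Λ : Set ℤ} {i j : ℤ} (hi : i ∈ Λ) (hj : j ∈ Λ) (hij : i ≠ j)
    (ψ : coefs C) : mon ν i j ψ ∈ quadL2 ν Λ :=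
  Submodule.subset_span (Or.inl ⟨ψ, i, j, hi, hj, hij, rfl⟩)

lemma bnd_mem_quadL2 {Λ : Set ℤ} {i : ℤ} (hi : i ∈ Λ) (hj : i + 1 ∈ Λ) (ψ : coefs C) :
    bnd ν i ψ ∈ quadL2 ν Λ :=
  Submodule.subset_span (Or.inr ⟨ψ, i, hi, hj, rfl⟩)

lemma quadL2_induction {Λ : Set ℤ} {p : Lp ℝ 2 (starMeasure ν) → Prop}
    (hmon : ∀ (ψ : coefs C) (i j : ℤ), i ∈ Λ → j ∈ Λ → i ≠ j → p (mon ν i j ψ))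
    (hbnd : ∀ (ψ : coefs C) (i : ℤ), i ∈ Λ → i + 1 ∈ Λ → p (bnd ν i ψ))
    (zero : p 0) (add : ∀ v w, p v → p w → p (v + w)) (smul : ∀ (c : ℝ) v, p v → p (c • v))
    {v : Lp ℝ 2 (starMeasure ν)} (hv : v ∈ quadL2 ν Λ) : p v := by
  induction hv using Submodule.span_induction with
  | mem v hv =>
    rcases hv with ⟨ψ, i, j, hi, hj, hij, rfl⟩ | ⟨ψ, i, hi, hj, rfl⟩
    · exact hmon ψ i j hi hj hij
    · exact hbnd ψ i hi hj
  | zero => exact zero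
  | add v w _ _ h1 h2 => exact add v w h1 h2
  | smul c v _ h => exact smul c v h

lemma quadL2_mono {Λ Λ' : Set ℤ} (h : Λ ⊆ Λ') : quadL2 ν Λ ≤ quadL2 ν Λ' := fun _ hv =>
  quadL2_induction (p := fun v => v ∈ quadL2 ν Λ')
    (fun ψ _ _ hi hj hij => mon_mem_quadL2 (h hi) (h hj) hij ψ)
    (fun ψ _ hi hj => bnd_mem_quadL2 (h hi) (h hj) ψ) (Submodule.zero_mem _)
    (fun _ _ => Submodule.add_mem _) (fun c _ => Submodule.smul_mem _ c) hv

section Box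

variable {s : ℕ} {v : Lp ℝ 2 (starMeasure ν)} (hv : v ∈ quadL2 ν (Set.Icc (-(s : ℤ)) s))
include hv

lemma quadL2_local : (chainRep ν).Local (s + 1) v :=
  quadL2_induction (Λ := Set.Icc (-(s : ℤ)) s) (p := (chainRep ν).Local (s + 1))
    (fun ψ _ _ hi hj _ => local_mon ν (abs_le.2 hi) (abs_le.2 hj) ψ)
    (fun ψ i hi hj => local_bnd ν (by
      rw [Set.mem_Icc] at hi hj
      rw [Finset.mem_Ico]; omega) ψ)
    LatticeRep.Local.zero (fun _ _ h h' => h.add h') (fun c _ h => h.smul c) hv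

/-- Each generator of the span is odd under a single flip or exchange in the box, so any property
stable under linear combinations need only be checked on odd vectors. -/
lemma quadL2_of_isOdd {p : Lp ℝ 2 (starMeasure ν) → Prop}
    (h : ∀ v, (chainRep ν).IsOdd s v → p v)
    (zero : p 0) (add : ∀ v w, p v → p w → p (v + w)) (smul : ∀ (c : ℝ) v, p v → p (c • v)) :
    p v :=
  quadL2_induction (Λ := Set.Icc (-(s : ℤ)) s)
    (fun ψ _ _ hi _ hij => h _ (isOdd_mon ν hij (abs_le.2 hi) ψ))
    (fun ψ i hi hj => h _ (isOdd_bnd ν (by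
      rw [Set.mem_Icc] at hi hj
      rw [Finset.mem_Ico]; omega) ψ)) zero add smul hv

lemma quadL2_orthInv : (chainRep ν).OrthInv s v :=
  quadL2_of_isOdd hv (fun _ h => h.orthInv) LatticeRep.OrthInv.zero (fun _ _ h h' => h.add h')
    (fun c _ h => h.smul c)

lemma quadL2_transBdd {γ lam : ℝ} (hγ : 0 < γ) (hlam : 0 < lam) :
    (chainRep ν).TransBdd γ lam s v :=
  quadL2_of_isOdd hv (fun _ h => h.transBdd hγ hlam) (LatticeRep.TransBdd.zero _)
    (fun _ _ h h' => h.add h') (fun c _ h => h.smul c)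

lemma quadL2_constProfile {X : ℕ → Lp ℝ 2 (starMeasure ν)} {b : Lp ℝ 2 (starMeasure ν)}
    (hX : (chainRep ν).IsLinearProfile X b) : (chainRep ν).ConstProfile X s v :=
  quadL2_of_isOdd hv (fun _ h => h.constProfile hX) LatticeRep.ConstProfile.zero
    (fun _ _ h h' => h.add h') (fun c _ h => h.smul c)

lemma shift_mem_quadL2 {ℓ : ℕ} {x : ℤ} (hx : |x| + s ≤ ℓ) :
    (chainRep ν).shift x v ∈ quadL2 ν (Set.Icc (-(ℓ : ℤ)) ℓ) := by
  have hx' := abs_le.1 (le_refl |x|)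
  have key : ∀ i : ℤ, i ∈ Set.Icc (-(s : ℤ)) s → x + i ∈ Set.Icc (-(ℓ : ℤ)) ℓ := by
    intro i hi
    rw [Set.mem_Icc] at hi ⊢
    omega
  refine quadL2_induction
    (p := fun v => (chainRep ν).shift x v ∈ quadL2 ν (Set.Icc (-(ℓ : ℤ)) ℓ))
    ?_ ?_ (by simp) ?_ ?_ hv
  · intro ψ i j hi hj hij
    rw [shift_mon]
    exact mon_mem_quadL2 (key i hi) (key j hj) (by simpa using hij) _
  · intro ψ i hi hj
    rw [shift_bnd]
    exact bnd_mem_quadL2 (key i hi) (by rw [add_assoc]; exact key _ hj) _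
  · intro v w h1 h2
    rw [map_add]; exact Submodule.add_mem _ h1 h2
  · intro c v h
    rw [map_smul]; exact Submodule.smul_mem _ c h

end Box

variable (ν)

/-! ### Solutions in a box -/

/-- The total energy to the right of the bond `{i, i + 1}` is invariant under all flips and all
exchanges of the box except the one across that bond. This solves the equation explicitly for bond
gradients. -/
lemma gen_sum_mon_diag (γ : ℝ) {lam : ℝ} {ℓ : ℕ} {i : ℤ}
    (hi : i ∈ Finset.Ico (-(ℓ : ℤ)) ℓ) (ψ : coefs C) :
    (chainRep ν).gen γ lam ℓ (∑ y ∈ Finset.Ioc i ℓ, mon ν y y ψ) = -(lam • bnd ν i ψ) := by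
  set u := ∑ y ∈ Finset.Ioc i (ℓ : ℤ), mon ν y y ψ
  have h1 : ∀ x ∈ Finset.Icc (-(ℓ : ℤ)) ℓ, (chainRep ν).flip x u - u = 0 := by
    intro x _
    rw [sub_eq_zero, map_sum]
    exact Finset.sum_congr rfl fun y _ => flip_mon_diag ν x y ψ
  rw [Finset.mem_Ico] at hi
  have h2 : ∀ x ∈ Finset.Ico (-(ℓ : ℤ)) ℓ, x ≠ i → (chainRep ν).exch x u - u = 0 := by
    intro x hx hxi
    rw [Finset.mem_Ico] at hx
    rw [sub_eq_zero, map_sum]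
    refine Finset.sum_equiv (Equiv.swap x (x + 1)) ?_ ?_
    · intro y
      rw [Equiv.swap_apply_def]
      simp only [Finset.mem_Ioc]
      split_ifs <;> omega
    · intro y _
      rw [exch_mon]
  have h3 : (chainRep ν).exch i u - u = -bnd ν i ψ := by
    have hins : Finset.Ioc i (ℓ : ℤ) = insert (i + 1) (Finset.Ioc (i + 1) (ℓ : ℤ)) := by
      ext y
      simp only [Finset.mem_Ioc, Finset.mem_insert]
      omega
    have hu : u = mon ν (i + 1) (i + 1) ψ + ∑ y ∈ Finset.Ioc (i + 1) (ℓ : ℤ), mon ν y y ψ := by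
      show ∑ y ∈ Finset.Ioc i (ℓ : ℤ), mon ν y y ψ = _
      rw [hins, Finset.sum_insert (by simp)]
    have hrest : (chainRep ν).exch i (∑ y ∈ Finset.Ioc (i + 1) (ℓ : ℤ), mon ν y y ψ) =
        ∑ y ∈ Finset.Ioc (i + 1) (ℓ : ℤ), mon ν y y ψ := by
      rw [map_sum]
      refine Finset.sum_congr rfl fun y hy => ?_
      rw [Finset.mem_Ioc] at hy
      apply exch_mon_of_ne <;> omega
    rw [hu, map_add, hrest, exch_mon, Equiv.swap_apply_right, bnd_apply]
    abel
  rw [LatticeRep.gen_apply, Finset.sum_eq_zero h1, smul_zero, zero_add,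
    Finset.sum_eq_single_of_mem i (Finset.mem_Ico.2 hi) h2, h3, smul_neg]

/-- The span of the off-diagonal monomials with coefficient `ψ` in the box `{-ℓ, …, ℓ}`. -/
def offSpan (ℓ : ℕ) (ψ : coefs C) : Submodule ℝ (Lp ℝ 2 (starMeasure ν)) :=
  Submodule.span ℝ ((fun p : ℤ × ℤ => mon ν p.1 p.2 ψ) ''
    ((Finset.Icc (-(ℓ : ℤ)) ℓ).offDiag : Set (ℤ × ℤ)))

instance (ℓ : ℕ) (ψ : coefs C) : FiniteDimensional ℝ (offSpan ν ℓ ψ) :=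
  FiniteDimensional.span_of_finite ℝ ((Finset.finite_toSet _).image _)

variable {ν}

/-- Only the flips at `i` and `j` act, each contributing `-2`. -/
lemma sum_flip_mon {A : Finset ℤ} {i j : ℤ} (hi : i ∈ A) (hj : j ∈ A) (hij : i ≠ j)
    (ψ : coefs C) :
    ∑ x ∈ A, ((chainRep ν).flip x (mon ν i j ψ) - mon ν i j ψ) = (-4 : ℝ) • mon ν i j ψ := by
  rw [Finset.sum_eq_add_of_mem i j hi hj hij, flip_mon_left ν hij, flip_mon_right ν hij]
  · module
  · intro x _ hx
    rw [flip_mon_of_ne ν hx.1.symm hx.2.symm, sub_self]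

lemma sum_flip_of_mem_offSpan {ℓ : ℕ} {ψ : coefs C} {v : Lp ℝ 2 (starMeasure ν)}
    (hv : v ∈ offSpan ν ℓ ψ) :
    ∑ x ∈ Finset.Icc (-(ℓ : ℤ)) ℓ, ((chainRep ν).flip x v - v) = (-4 : ℝ) • v := by
  induction hv using Submodule.span_induction with
  | mem v hv =>
    obtain ⟨p, hp, rfl⟩ := hv
    obtain ⟨h1, h2, h3⟩ := Finset.mem_offDiag.1 (Finset.mem_coe.1 hp)
    exact sum_flip_mon h1 h2 h3 ψ
  | zero => simp
  | add v w _ _ h1 h2 =>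
    rw [smul_add, ← h1, ← h2, ← Finset.sum_add_distrib]
    refine Finset.sum_congr rfl fun x _ => ?_
    rw [map_add]; abel
  | smul c v _ h =>
    rw [smul_comm, ← h, Finset.smul_sum]
    refine Finset.sum_congr rfl fun x _ => ?_
    rw [map_smul, smul_sub]

lemma exch_mem_offSpan {ℓ : ℕ} {ψ : coefs C} {v : Lp ℝ 2 (starMeasure ν)}
    (hv : v ∈ offSpan ν ℓ ψ) {x : ℤ} (hx : x ∈ Finset.Ico (-(ℓ : ℤ)) ℓ) :
    (chainRep ν).exch x v ∈ offSpan ν ℓ ψ := by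
  rw [Finset.mem_Ico] at hx
  induction hv using Submodule.span_induction with
  | mem v hv =>
    obtain ⟨p, hp, rfl⟩ := hv
    obtain ⟨h1, h2, h3⟩ := Finset.mem_offDiag.1 (Finset.mem_coe.1 hp)
    have key : ∀ y ∈ Finset.Icc (-(ℓ : ℤ)) ℓ,
        Equiv.swap x (x + 1) y ∈ Finset.Icc (-(ℓ : ℤ)) ℓ := by
      intro y hy
      rw [Finset.mem_Icc] at hy
      rw [Equiv.swap_apply_def, Finset.mem_Icc]
      split_ifs <;> omega
    rw [exch_mon]
    exact Submodule.subset_span ⟨(Equiv.swap x (x + 1) p.1, Equiv.swap x (x + 1) p.2),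
      Finset.mem_coe.2 (Finset.mem_offDiag.2 ⟨key _ h1, key _ h2, by simpa using h3⟩), rfl⟩
  | zero => simp
  | add v w _ _ h1 h2 => rw [map_add]; exact Submodule.add_mem _ h1 h2
  | smul c v _ h => rw [map_smul]; exact Submodule.smul_mem _ c h

lemma gen_of_mem_offSpan (γ lam : ℝ) {ℓ : ℕ} {ψ : coefs C} {v : Lp ℝ 2 (starMeasure ν)}
    (hv : v ∈ offSpan ν ℓ ψ) :
    (chainRep ν).gen γ lam ℓ v = γ • (-4 : ℝ) • v +
      lam • ∑ x ∈ Finset.Ico (-(ℓ : ℤ)) ℓ, ((chainRep ν).exch x v - v) := by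
  rw [LatticeRep.gen_apply, sum_flip_of_mem_offSpan hv]

/-- The dynamics does not touch `ψ`, so the generator preserves the finite-dimensional span of the
off-diagonal monomials with this coefficient. There the flips give `-gen ≥ 4γ` and the exchanges
have the good sign; hence `gen` is injective, and so surjective, on that span. -/
lemma mon_mem_range_gen {γ lam : ℝ} (hγ : 0 < γ) (hlam : 0 < lam) {ℓ : ℕ} {i j : ℤ}
    (hi : i ∈ Finset.Icc (-(ℓ : ℤ)) ℓ) (hj : j ∈ Finset.Icc (-(ℓ : ℤ)) ℓ) (hij : i ≠ j)
    (ψ : coefs C) : mon ν i j ψ ∈ LinearMap.range ((chainRep ν).gen γ lam ℓ) := by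
  have hmaps : ∀ v ∈ offSpan ν ℓ ψ, (chainRep ν).gen γ lam ℓ v ∈ offSpan ν ℓ ψ := by
    intro v hv
    rw [gen_of_mem_offSpan γ lam hv]
    exact Submodule.add_mem _ (Submodule.smul_mem _ _ (Submodule.smul_mem _ _ hv))
      (Submodule.smul_mem _ _ (Submodule.sum_mem _ fun x hx =>
        Submodule.sub_mem _ (exch_mem_offSpan hv hx) hv))
  have hinj : Function.Injective (((chainRep ν).gen γ lam ℓ).restrict hmaps) := by
    rw [← LinearMap.ker_eq_bot, LinearMap.ker_eq_bot']
    rintro ⟨v, hv⟩ h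
    have h0 : (chainRep ν).gen γ lam ℓ v = 0 := congrArg Subtype.val h
    have h1 : inner ℝ v ((chainRep ν).gen γ lam ℓ v) ≤ -(4 * γ) * ‖v‖ ^ 2 := by
      rw [gen_of_mem_offSpan γ lam hv, inner_add_right, inner_smul_right, inner_smul_right,
        inner_smul_right, inner_sum, real_inner_self_eq_norm_sq]
      have h2 : ∑ x ∈ Finset.Ico (-(ℓ : ℤ)) ℓ, inner ℝ v ((chainRep ν).exch x v - v) ≤ 0 := by
        refine Finset.sum_nonpos fun x _ => ?_
        have := (chainRep ν).norm_exch_sub_sq x v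
        nlinarith [sq_nonneg ‖(chainRep ν).exch x v - v‖]
      nlinarith
    rw [h0, inner_zero_right] at h1
    have h3 : ‖v‖ ^ 2 ≤ 0 := by nlinarith
    have h4 : ‖v‖ = 0 := by nlinarith [norm_nonneg v]
    exact Subtype.ext (norm_eq_zero.1 h4)
  obtain ⟨u, hu⟩ := LinearMap.injective_iff_surjective.1 hinj ⟨mon ν i j ψ,
    Submodule.subset_span ⟨(i, j), Finset.mem_coe.2 (Finset.mem_offDiag.2 ⟨hi, hj, hij⟩), rfl⟩⟩
  exact ⟨u.1, congrArg Subtype.val hu⟩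

lemma quadL2_le_range_gen {γ lam : ℝ} (hγ : 0 < γ) (hlam : 0 < lam) (ℓ : ℕ) :
    quadL2 ν (Set.Icc (-(ℓ : ℤ)) ℓ) ≤ LinearMap.range ((chainRep ν).gen γ lam ℓ) := fun v hv =>
  quadL2_induction (Λ := Set.Icc (-(ℓ : ℤ)) ℓ)
    (p := fun v => v ∈ LinearMap.range ((chainRep ν).gen γ lam ℓ))
    (fun ψ i j hi hj hij =>
      mon_mem_range_gen hγ hlam (Finset.mem_Icc.2 hi) (Finset.mem_Icc.2 hj) hij ψ)
    (fun ψ i hi hj => ⟨-lam⁻¹ • ∑ y ∈ Finset.Ioc i (ℓ : ℤ), mon ν y y ψ, by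
      rw [Set.mem_Icc] at hi hj
      rw [map_smul, gen_sum_mon_diag ν γ (Finset.mem_Ico.2 (by omega)), smul_neg, smul_smul,
        neg_mul, inv_mul_cancel₀ hlam.ne', neg_smul, one_smul, neg_neg]⟩)
    (Submodule.zero_mem _) (fun _ _ => Submodule.add_mem _) (fun c _ => Submodule.smul_mem _ c) hv

end HarmonicChain
end

/-! ### Every element of the quadratic span is approximable with small error. -/

noncomputable section

namespace HarmonicChain

open MeasureTheory ProbabilityTheory Filter Topology

variable {C : ℝ} (ν : Measure (Set.Icc C⁻¹ C)) [IsProbabilityMeasure ν]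

/-- The class in `L²` of `ω_x²`. -/
def energy (x : ℤ) : Lp ℝ 2 (starMeasure ν) := mon ν x x coefOne

/-- The class in `L²` of `∑_{|x| ≤ ℓ} x ω_x²`. -/
def linProfile (ℓ : ℕ) : Lp ℝ 2 (starMeasure ν) :=
  ∑ x ∈ Finset.Icc (-(ℓ : ℤ)) ℓ, (x : ℝ) • energy ν x

lemma shift_energy (x y : ℤ) : (chainRep ν).shift x (energy ν y) = energy ν (x + y) := by
  rw [energy, shift_mon, coefShift_one]; rfl

lemma flip_energy (x y : ℤ) : (chainRep ν).flip x (energy ν y) = energy ν y :=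
  flip_mon_diag ν x y _

lemma exch_energy (x y : ℤ) :
    (chainRep ν).exch x (energy ν y) = energy ν (Equiv.swap x (x + 1) y) :=
  exch_mon ν x y y _

/-- Exchanging `x` and `x + 1` turns `x ω_x² + (x + 1) ω_{x+1}²` into `(x + 1) ω_x² + x ω_{x+1}²`, a
change of `ω_x² - ω_{x+1}²` whatever `x` is. -/
lemma isLinearProfile_linProfile :
    (chainRep ν).IsLinearProfile (linProfile ν) (energy ν 0 - energy ν 1) where
  flip ℓ x _ := by
    simp only [linProfile, map_sum, map_smul, flip_energy]
  exch ℓ x hx := by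
    rw [Finset.mem_Ico] at hx
    have h : (chainRep ν).exch x (linProfile ν ℓ) =
        ∑ y ∈ Finset.Icc (-(ℓ : ℤ)) ℓ, ((Equiv.swap x (x + 1) y : ℤ) : ℝ) • energy ν y := by
      simp only [linProfile, map_sum, map_smul, exch_energy]
      refine Finset.sum_equiv (Equiv.swap x (x + 1)) ?_ ?_
      · intro y
        rw [Equiv.swap_apply_def]
        simp only [Finset.mem_Icc]
        split_ifs <;> omega
      · intro y _
        rw [Equiv.swap_apply_self]
    rw [h, linProfile, ← Finset.sum_sub_distrib,
      Finset.sum_eq_add_of_mem x (x + 1) (Finset.mem_Icc.2 (by omega))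
        (Finset.mem_Icc.2 (by omega)) (by omega), map_sub, shift_energy, shift_energy,
      Equiv.swap_apply_left, Equiv.swap_apply_right, add_zero]
    · push_cast
      module
    · intro y _ hy
      rw [Equiv.swap_apply_of_ne_of_ne hy.1 hy.2, sub_self]

/-- Approximation by images of quadratic test functions, in the space of the chain. -/
abbrev QApprox (γ lam : ℝ) (φ : Lp ℝ 2 (starMeasure ν)) (B : ℝ) : Prop :=
  (chainRep ν).Approx γ lam (quadL2 ν Set.univ) (linProfile ν) φ B

variable {ν} {γ lam : ℝ}

/-! ### Off-diagonal monomials -/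

/-- Solve the formula for the generator at `f` for `f` itself: up to an image of the generator, `f`
is a combination of the exchanged monomials of total weight `λ c / (4γ + λ c)`, where `c` is the
number of bonds that touch `i` or `j`. -/
lemma approx_mon_step (hγ : 0 < γ) (hlam : 0 < lam) {ψ : coefs C} {B : ℝ}
    (hB : 0 ≤ B) (h : ∀ i j : ℤ, i ≠ j → QApprox ν γ lam (mon ν i j ψ) B) {i j : ℤ}
    (hij : i ≠ j) : QApprox ν γ lam (mon ν i j ψ) (lam / (γ + lam) * B) := by
  set f := mon ν i j ψ with hf
  obtain ⟨r, hi, hj⟩ : ∃ r : ℕ, |i| ≤ r ∧ |j| ≤ r :=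
    ⟨max i.natAbs j.natAbs, by rw [Int.abs_eq_natAbs]; omega, by rw [Int.abs_eq_natAbs]; omega⟩
  have hi' := abs_le.1 hi
  have hj' := abs_le.1 hj
  have hloc : (chainRep ν).Local (r + 1) f := local_mon ν hi hj ψ
  -- The bonds touching `i` or `j`: four of them, or three when the sites are adjacent.
  set S : Finset ℤ := {i - 1, i, j - 1, j} with hS
  have hSsub : S ⊆ Finset.Icc (-((r + 1 : ℕ) : ℤ)) (r + 1 : ℕ) := by
    intro z hz
    simp only [hS, Finset.mem_insert, Finset.mem_singleton] at hz
    rw [Finset.mem_Icc]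
    push_cast
    omega
  have hgen : (chainRep ν).locGen γ lam (r + 1) f =
      γ • (-4 : ℝ) • f + lam • (∑ z ∈ S, (chainRep ν).exch z f - (S.card : ℝ) • f) := by
    rw [LatticeRep.locGen, hf, sum_flip_mon (Finset.mem_Icc.2 (by push_cast; omega))
      (Finset.mem_Icc.2 (by push_cast; omega)) hij, ← hf]
    congr 2
    rw [← Finset.sum_subset hSsub, Finset.sum_sub_distrib, Finset.sum_const,
      Nat.cast_smul_eq_nsmul]
    intro z _ hz
    simp only [hS, Finset.mem_insert, Finset.mem_singleton, not_or] at hz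
    rw [hf, exch_mon_of_ne, sub_self] <;> omega
  have hpos : 0 < 4 * γ + lam * S.card := by positivity
  have heq : f = (4 * γ + lam * S.card)⁻¹ •
      ((-1 : ℝ) • (chainRep ν).locGen γ lam (r + 1) f + lam • ∑ z ∈ S, (chainRep ν).exch z f) := by
    rw [hgen, eq_inv_smul_iff₀ hpos.ne']
    module
  have hgenA := hloc.approx_locGen (γ := γ) (lam := lam) (X := linProfile ν)
    (mon_mem_quadL2 (Set.mem_univ i) (Set.mem_univ j) hij ψ)
  have hsumA : QApprox ν γ lam (∑ z ∈ S, (chainRep ν).exch z f) (S.card * B) := by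
    refine LatticeRep.Approx.sum S fun z _ => ?_
    rw [hf, exch_mon]
    exact h _ _ (by simpa using hij)
  have hA := ((hgenA.smul_zero (-1)).add (hsumA.smul lam)).smul (4 * γ + lam * S.card)⁻¹
  rw [← heq] at hA
  refine hA.mono ?_
  have hc : (S.card : ℝ) ≤ 4 := by exact_mod_cast Finset.card_le_four
  rw [abs_of_pos (inv_pos.2 hpos), abs_of_pos hlam, zero_add, inv_mul_le_iff₀ hpos]
  -- The weight `λ c / (4γ + λ c)` increases with `c ≤ 4`, and `c = 4` gives `λ / (γ + λ) < 1`.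
  have h3 : lam * S.card ≤ (4 * γ + lam * S.card) * (lam / (γ + lam)) := by
    rw [mul_div_assoc', le_div_iff₀ (by positivity)]
    nlinarith [mul_pos hγ hlam]
  calc lam * (S.card * B) = lam * S.card * B := by ring
    _ ≤ (4 * γ + lam * S.card) * (lam / (γ + lam)) * B := by gcongr
    _ = _ := by ring

lemma approx_mon (hγ : 0 < γ) (hlam : 0 < lam) (ψ : coefs C) {ε : ℝ} (hε : 0 < ε) {i j : ℤ}
    (hij : i ≠ j) : QApprox ν γ lam (mon ν i j ψ) ε := by
  set K := LatticeRep.dualConst γ lam * ‖mon ν 0 0 ψ‖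
  have hK : 0 ≤ K := mul_nonneg (LatticeRep.dualConst_pos hγ).le (norm_nonneg _)
  have hθ : 0 ≤ lam / (γ + lam) := by positivity
  have key : ∀ n : ℕ, ∀ i j : ℤ, i ≠ j →
      QApprox ν γ lam (mon ν i j ψ) ((lam / (γ + lam)) ^ n * K) := by
    intro n
    induction n with
    | zero =>
      intro i j hij
      have hodd : (chainRep ν).IsOdd i.natAbs (mon ν i j ψ) :=
        isOdd_mon ν hij (by rw [Int.abs_eq_natAbs]) ψ
      refine (hodd.approx hγ hlam).mono ?_
      rw [pow_zero, one_mul]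
      exact mul_le_mul_of_nonneg_left (norm_mon_le ν i j ψ) (LatticeRep.dualConst_pos hγ).le
    | succ n ih =>
      intro i j hij
      rw [pow_succ', mul_assoc]
      exact approx_mon_step hγ hlam (by positivity) ih hij
  have hθ1 : lam / (γ + lam) < 1 := by rw [div_lt_one (by positivity)]; linarith
  have hlim := (tendsto_pow_atTop_nhds_zero_of_lt_one hθ hθ1).mul_const K
  rw [zero_mul] at hlim
  obtain ⟨n, hn⟩ := (hlim.eventually_lt_const hε).exists
  exact (key n i j hij).mono hn.le

/-! ### Diagonal gradients -/

lemma approx_bnd_coboundary (hγ : 0 < γ) (hlam : 0 < lam) (i : ℤ) (ψ : coefs C) :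
    QApprox ν γ lam (bnd ν i ψ - bnd ν (i + 1) (coefShift 1 ψ)) 0 := by
  have hodd : (chainRep ν).IsOdd (i.natAbs + 1) (bnd ν i ψ) :=
    isOdd_bnd ν (by rw [Finset.mem_Ico]; omega) ψ
  have := hodd.approx_coboundary (Q := quadL2 ν Set.univ) (X := linProfile ν) hγ hlam
  rwa [shift_bnd, add_comm] at this

lemma locGen_bnd (ψ : coefs C) : (chainRep ν).locGen γ lam 2 (bnd ν 0 ψ) =
    lam • (bnd ν 1 ψ - (2 : ℝ) • bnd ν 0 ψ + bnd ν (-1) ψ) := by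
  have h1 : ∀ z ∈ Finset.Icc (-((2 : ℕ) : ℤ)) (2 : ℕ),
      (chainRep ν).flip z (bnd ν 0 ψ) - bnd ν 0 ψ = 0 := by
    intro z _
    rw [sub_eq_zero, bnd_apply, map_sub, flip_mon_diag, flip_mon_diag]
  have h2 : Finset.Icc (-((2 : ℕ) : ℤ)) (2 : ℕ) = {-2, -1, 0, 1, 2} := by decide
  rw [LatticeRep.locGen, Finset.sum_eq_zero h1, smul_zero, zero_add, h2]
  simp only [bnd_apply, map_sub, exch_mon, Equiv.swap_apply_def]
  norm_num
  module

/-- Coboundaries bring the bonds `1` and `-1` of the Laplacian in `locGen_bnd` back to the bond `0`,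
at the price of translating the coefficient by `∓1`. -/
lemma approx_bnd_laplacian (hγ : 0 < γ) (hlam : 0 < lam) (ψ : coefs C) :
    QApprox ν γ lam
      (bnd ν 0 (coefShift 1 ψ + coefShift (-1) ψ - (2 : ℝ) • ψ)) 0 := by
  have hloc : (chainRep ν).Local 2 (bnd ν 0 ψ) := local_bnd ν (r := 1) (by decide) ψ
  have h1 := (hloc.approx_locGen (γ := γ) (lam := lam) (X := linProfile ν)
    (bnd_mem_quadL2 (Set.mem_univ 0) (Set.mem_univ _) ψ)).smul_zero lam⁻¹
  rw [locGen_bnd, smul_smul, inv_mul_cancel₀ hlam.ne', one_smul] at h1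
  have h2 := approx_bnd_coboundary (ν := ν) hγ hlam 0 (coefShift (-1) ψ)
  have h3 := (approx_bnd_coboundary (ν := ν) hγ hlam (-1) ψ).smul_zero (-1)
  rw [coefShift_coefShift, add_neg_cancel, coefShift_zero, zero_add] at h2
  rw [neg_add_cancel] at h3
  convert (h1.add_zero h2).add_zero h3 using 1
  simp only [map_add, map_sub, map_smul]
  module

lemma approx_bnd_one (hγ : 0 < γ) (hlam : 0 < lam) :
    QApprox ν γ lam (bnd ν 0 coefOne) 0 := by
  have hb : energy ν 0 - energy ν 1 = -bnd ν 0 coefOne := by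
    rw [bnd_apply, neg_sub]; rfl
  have := (isLinearProfile_linProfile ν).approx (Q := quadL2 ν Set.univ) hγ hlam (by
    rw [hb, map_neg, exch_bnd_self])
  rw [hb] at this
  simpa using this.smul_zero (-1)

/-- With `Δ_k = τ_k + τ_{-k} - 2`, one has `Δ_{k+2} = 2 Δ_{k+1} - Δ_k + Δ_1 (τ_{k+1} + τ_{-k-1})`,
so everything reduces to the Laplacian `Δ_1`. -/
lemma approx_bnd_shift_add_shift (hγ : 0 < γ) (hlam : 0 < lam) (ψ : coefs C) (k : ℕ) :
    QApprox ν γ lam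
      (bnd ν 0 (coefShift k ψ + coefShift (-k) ψ - (2 : ℝ) • ψ)) 0 := by
  induction k using Nat.strong_induction_on with
  | _ k ih =>
    match k with
    | 0 =>
      have : coefShift ((0 : ℕ) : ℤ) ψ + coefShift (-((0 : ℕ) : ℤ)) ψ - (2 : ℝ) • ψ = 0 := by
        rw [Nat.cast_zero, neg_zero, coefShift_zero]; module
      rw [this, map_zero]
      exact LatticeRep.Approx.zero
    | 1 => exact_mod_cast approx_bnd_laplacian hγ hlam ψ
    | k + 2 =>
      have h1 := (ih (k + 1) (by omega)).smul_zero 2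
      have h2 := (ih k (by omega)).smul_zero (-1)
      have h3 := approx_bnd_laplacian (ν := ν) hγ hlam
        (coefShift ((k + 1 : ℕ) : ℤ) ψ + coefShift (-((k + 1 : ℕ) : ℤ)) ψ)
      convert (h1.add_zero h2).add_zero h3 using 1
      simp only [map_add, map_sub, map_smul, coefShift_coefShift]
      push_cast
      rw [show (1 : ℤ) + (k + 1) = k + 2 by ring, show (-1 : ℤ) + (k + 1) = k by ring,
        show (1 : ℤ) + -(k + 1) = -k by ring, show (-1 : ℤ) + -(k + 1) = -(k + 2) by ring]
      module

/-- Modulo terms of cost zero, `ψ` is replaced by an average of `2n` of its translates. Their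
correlations have finite range, so the average has `L²` norm `O(n^{-1/2})` and the crude bound for
odd vectors concludes. -/
lemma approx_bnd_of_mean_zero (hγ : 0 < γ) (hlam : 0 < lam) {ψ : coefs C}
    (hψ : coefMean ν ψ = 0) {ε : ℝ} (hε : 0 < ε) : QApprox ν γ lam (bnd ν 0 ψ) ε := by
  obtain ⟨d, hd⟩ := exists_integral_shift_mul_shift_eq_zero ν hψ
  set M := ‖mon ν 0 0 ψ‖ with hM
  have hsum : ∀ (e : ℤ), |e| = 1 → ∀ (i : ℤ) (n : ℕ),
      ‖mon ν i i (∑ k ∈ Finset.range n, coefShift (e * k) ψ)‖ ≤ √(n * (2 * d + 1) * M ^ 2) := by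
    intro e he i n
    rw [map_sum]
    refine Real.le_sqrt_of_sq_le (norm_sum_range_sq_le _ M d (fun k => ?_) (fun k k' hk => ?_) n)
    · refine (norm_mon_le ν i i _).trans ?_
      -- The translation of the coefficient is undone by a translation of the sites, which is an
      -- isometry; the norm is then bounded uniformly in the site.
      have := shift_mon ν (e * k) (-(e * k)) (-(e * k)) ψ
      rw [add_neg_cancel] at this
      rw [← this, LatticeRep.norm_shift]
      exact norm_mon_le ν _ _ ψ
    · rw [inner_mon, hd, zero_mul]
      rwa [← mul_sub, abs_mul, he, one_mul]
  have hbnd : ∀ n : ℕ, 0 < n → QApprox ν γ lam (bnd ν 0 ψ)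
      (LatticeRep.dualConst γ lam * (2 * √((2 * d + 1) * M ^ 2 * (n : ℝ)⁻¹))) := by
    intro n hn
    have hn' : (0 : ℝ) < n := by exact_mod_cast hn
    set a : coefs C := ∑ k ∈ Finset.range n, coefShift (1 * (k : ℤ)) ψ
    set b : coefs C := ∑ k ∈ Finset.range n, coefShift (-1 * (k : ℤ)) ψ
    have hdecomp : ψ = (2 * (n : ℝ))⁻¹ • (a + b) + (-(2 * (n : ℝ))⁻¹) •
        ∑ k ∈ Finset.range n, (coefShift k ψ + coefShift (-k) ψ - (2 : ℝ) • ψ) := by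
      have h1 : ∑ k ∈ Finset.range n, (coefShift (k : ℤ) ψ + coefShift (-k) ψ - (2 : ℝ) • ψ) =
          a + b - (2 * (n : ℝ)) • ψ := by
        rw [Finset.sum_sub_distrib, Finset.sum_add_distrib, Finset.sum_const, Finset.card_range,
          ← Nat.cast_smul_eq_nsmul ℝ, smul_smul, mul_comm (n : ℝ)]
        simp only [a, b, one_mul, neg_mul]
      have h2 : ψ = ((2 * (n : ℝ))⁻¹ * (2 * (n : ℝ))) • ψ := by
        rw [inv_mul_cancel₀ (by positivity), one_smul]
      rw [h1]
      nth_rewrite 1 [h2]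
      module
    have h0 : QApprox ν γ lam (bnd ν 0 (∑ k ∈ Finset.range n,
        (coefShift (k : ℤ) ψ + coefShift (-k) ψ - (2 : ℝ) • ψ))) 0 := by
      rw [map_sum]
      simpa using LatticeRep.Approx.sum (Finset.range n) fun k _ =>
        approx_bnd_shift_add_shift (ν := ν) hγ hlam ψ k
    have hodd : (chainRep ν).IsOdd 1 (bnd ν 0 ((2 * (n : ℝ))⁻¹ • (a + b))) :=
      isOdd_bnd ν (by decide) _
    have h2 := (hodd.approx (Q := quadL2 ν Set.univ) (X := linProfile ν) hγ hlam).add_zero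
      (h0.smul_zero (-(2 * (n : ℝ))⁻¹))
    rw [← map_smul, ← map_add, ← hdecomp] at h2
    refine h2.mono (mul_le_mul_of_nonneg_left ?_ (LatticeRep.dualConst_pos hγ).le)
    have h3 : ∀ i : ℤ, ‖mon ν i i (a + b)‖ ≤ 2 * √(n * (2 * d + 1) * M ^ 2) := by
      intro i
      rw [map_add]
      refine (norm_add_le _ _).trans ?_
      linarith [hsum 1 (by simp) i n, hsum (-1) (by simp) i n]
    rw [map_smul, norm_smul, bnd_apply, Real.norm_eq_abs, abs_of_pos (by positivity)]
    have h4 : √(n * (2 * d + 1) * M ^ 2) = n * √((2 * d + 1) * M ^ 2 * (n : ℝ)⁻¹) := by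
      rw [show (n : ℝ) * (2 * d + 1) * M ^ 2 = n ^ 2 * ((2 * d + 1) * M ^ 2 * (n : ℝ)⁻¹) by
        field_simp, Real.sqrt_mul (by positivity), Real.sqrt_sq hn'.le]
    calc (2 * (n : ℝ))⁻¹ * ‖mon ν (0 + 1) (0 + 1) (a + b) - mon ν 0 0 (a + b)‖
        ≤ (2 * (n : ℝ))⁻¹ * (2 * √(n * (2 * d + 1) * M ^ 2) + 2 * √(n * (2 * d + 1) * M ^ 2)) := by
          gcongr
          exact (norm_sub_le _ _).trans (add_le_add (h3 _) (h3 _))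
      _ = 2 * √((2 * d + 1) * M ^ 2 * (n : ℝ)⁻¹) := by
          rw [h4]; field_simp; ring
  have hlim : Tendsto (fun n : ℕ => LatticeRep.dualConst γ lam *
      (2 * √((2 * d + 1) * M ^ 2 * (n : ℝ)⁻¹))) atTop (𝓝 0) := by
    have h := ((tendsto_inv_atTop_zero.comp (tendsto_natCast_atTop_atTop (R := ℝ))).const_mul
      ((2 * d + 1) * M ^ 2)).sqrt.const_mul 2 |>.const_mul (LatticeRep.dualConst γ lam)
    simpa using h
  obtain ⟨n, hn, hn0⟩ := ((hlim.eventually_lt_const hε).and (eventually_gt_atTop 0)).exists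
  exact (hbnd n hn0).mono hn.le

/-- At the bond `0` the mean of `ψ` is split off and handled by the linear profile; coboundaries
carry the result to the other bonds in both directions. -/
lemma approx_bnd (hγ : 0 < γ) (hlam : 0 < lam) (i : ℤ) :
    ∀ (ψ : coefs C) {ε : ℝ}, 0 < ε → QApprox ν γ lam (bnd ν i ψ) ε := by
  induction i using Int.induction_on with
  | zero =>
    intro ψ ε hε
    have h := (approx_bnd_of_mean_zero hγ hlam (coefMean_sub_smul_one ν ψ) hε).add_zero
      ((approx_bnd_one (ν := ν) hγ hlam).smul_zero (coefMean ν ψ))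
    rwa [← map_smul, ← map_add, sub_add_cancel] at h
  | succ i ih =>
    intro ψ ε hε
    have h1 := ih (coefShift (-1) ψ) hε
    have h2 := (approx_bnd_coboundary (ν := ν) hγ hlam i (coefShift (-1) ψ)).smul_zero (-1)
    rw [coefShift_coefShift, add_neg_cancel, coefShift_zero] at h2
    convert h1.add_zero h2 using 1
    module
  | pred i ih =>
    intro ψ ε hε
    have h1 := ih (coefShift 1 ψ) hε
    have h2 := approx_bnd_coboundary (ν := ν) hγ hlam (-i - 1) ψ
    rw [sub_add_cancel] at h2
    convert h1.add_zero h2 using 1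
    abel

lemma approx_of_mem_quadL2 (hγ : 0 < γ) (hlam : 0 < lam) {v : Lp ℝ 2 (starMeasure ν)}
    (hv : v ∈ quadL2 ν Set.univ) : ∀ ε > 0, QApprox ν γ lam v ε :=
  quadL2_induction (p := fun v => ∀ ε > 0, QApprox ν γ lam v ε)
    (fun ψ _ _ _ _ hij _ hε => approx_mon hγ hlam ψ hε hij)
    (fun ψ i _ _ _ hε => approx_bnd hγ hlam i ψ hε)
    (fun _ hε => LatticeRep.Approx.zero.mono (le_of_lt hε))
    (fun _ _ h h' ε hε => by
      simpa using (h (ε / 2) (by linarith)).add (h' (ε / 2) (by linarith)))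
    (fun c _ h ε hε => by
      refine ((h (ε / (|c| + 1)) (by positivity)).smul c).mono ?_
      rw [mul_div_assoc', div_le_iff₀ (by positivity)]
      nlinarith) hv

end HarmonicChain
end

/-! ### Algebraic description of `𝒬` and `𝒬₀`. -/

noncomputable section

namespace HarmonicChain

open MeasureTheory ProbabilityTheory Filter Topology

open scoped Pointwise

variable {C : ℝ}

/-! ### Quadratic functions -/

/-- The span of the functions `ψ(m) ω_i ω_j` and `ψ(m) (ω_{i+1}² - ω_i²)` that are supported
in `Λ`. -/
def quadFn (C : ℝ) (Λ : Set ℤ) : Submodule ℝ (Fn C) :=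
  Submodule.span ℝ
    ({f | ∃ (ψ : coefs C) (i j : ℤ), i ∈ Λ ∧ j ∈ Λ ∧ i ≠ j ∧ f = monF ψ.1 i j} ∪
      {f | ∃ (ψ : coefs C) (i : ℤ), i ∈ Λ ∧ i + 1 ∈ Λ ∧
        f = monF ψ.1 (i + 1) (i + 1) - monF ψ.1 i i})

lemma monF_mem_quadFn {Λ : Set ℤ} {i j : ℤ} (hi : i ∈ Λ) (hj : j ∈ Λ) (hij : i ≠ j)
    (ψ : coefs C) : monF ψ.1 i j ∈ quadFn C Λ :=
  Submodule.subset_span (Or.inl ⟨ψ, i, j, hi, hj, hij, rfl⟩)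

lemma bond_mem_quadFn {Λ : Set ℤ} {i : ℤ} (hi : i ∈ Λ) (hj : i + 1 ∈ Λ) (ψ : coefs C) :
    monF ψ.1 (i + 1) (i + 1) - monF ψ.1 i i ∈ quadFn C Λ :=
  Submodule.subset_span (Or.inr ⟨ψ, i, hi, hj, rfl⟩)

lemma quadFn_induction {Λ : Set ℤ} {p : Fn C → Prop}
    (hmon : ∀ (ψ : coefs C) (i j : ℤ), i ∈ Λ → j ∈ Λ → i ≠ j → p (monF ψ.1 i j))
    (hbnd : ∀ (ψ : coefs C) (i : ℤ), i ∈ Λ → i + 1 ∈ Λ →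
      p (monF ψ.1 (i + 1) (i + 1) - monF ψ.1 i i))
    (zero : p 0) (add : ∀ v w, p v → p w → p (v + w)) (smul : ∀ (c : ℝ) v, p v → p (c • v))
    {v : Fn C} (hv : v ∈ quadFn C Λ) : p v := by
  induction hv using Submodule.span_induction with
  | mem v hv =>
    rcases hv with ⟨ψ, i, j, hi, hj, hij, rfl⟩ | ⟨ψ, i, hi, hj, rfl⟩
    · exact hmon ψ i j hi hj hij
    · exact hbnd ψ i hi hj
  | zero => exact zero
  | add v w _ _ h1 h2 => exact add v w h1 h2
  | smul c v _ h => exact smul c v h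

lemma quadFn_mono {Λ Λ' : Set ℤ} (h : Λ ⊆ Λ') : quadFn C Λ ≤ quadFn C Λ' := fun _ hv =>
  quadFn_induction (p := fun v => v ∈ quadFn C Λ')
    (fun ψ _ _ hi hj hij => monF_mem_quadFn (h hi) (h hj) hij ψ)
    (fun ψ _ hi hj => bond_mem_quadFn (h hi) (h hj) ψ) (Submodule.zero_mem _)
    (fun _ _ => Submodule.add_mem _) (fun c _ => Submodule.smul_mem _ c) hv

lemma exists_mem_quadFn_Icc {f : Fn C} (hf : f ∈ quadFn C Set.univ) :
    ∃ r : ℕ, f ∈ quadFn C (Set.Icc (-(r : ℤ)) r) := by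
  have hmono : ∀ {r r' : ℕ}, r ≤ r' → ∀ {f : Fn C}, f ∈ quadFn C (Set.Icc (-(r : ℤ)) r) →
      f ∈ quadFn C (Set.Icc (-(r' : ℤ)) r') := fun h _ hf =>
    quadFn_mono (Set.Icc_subset_Icc (by omega) (by omega)) hf
  refine quadFn_induction (p := fun f => ∃ r : ℕ, f ∈ quadFn C (Set.Icc (-(r : ℤ)) r))
    ?_ ?_ ?_ ?_ ?_ hf
  · intro ψ i j _ _ hij
    refine ⟨max i.natAbs j.natAbs, monF_mem_quadFn ?_ ?_ hij ψ⟩ <;> rw [Set.mem_Icc] <;> omega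
  · intro ψ i _ _
    refine ⟨i.natAbs + 1, bond_mem_quadFn ?_ ?_ ψ⟩ <;> rw [Set.mem_Icc] <;> omega
  · exact ⟨0, Submodule.zero_mem _⟩
  · rintro v w ⟨r, hr⟩ ⟨r', hr'⟩
    exact ⟨max r r', Submodule.add_mem _ (hmono (le_max_left _ _) hr)
      (hmono (le_max_right _ _) hr')⟩
  · rintro c v ⟨r, hr⟩
    exact ⟨r, Submodule.smul_mem _ c hr⟩

/-- The functions satisfying the formula of `IsQuadratic` with the index set `I`. -/
lemma IsQuadratic.exists_superset {f : Fn C} (hf : IsQuadratic f) :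
    ∃ (I₀ : Finset ℤ) (ψ : ℤ → ℤ → coefs C),
      (∀ i j, (i ∉ I₀ ∨ j ∉ I₀) → ψ i j = 0) ∧ (∀ i j, ψ i j = ψ j i) ∧
      ∀ I, I₀ ⊆ I → ∀ m ω, f m ω =
        (∑ i ∈ I, (ψ i i).1 m * (ω (i + 1) ^ 2 - ω i ^ 2)) +
          ∑ i ∈ I, ∑ j ∈ I, if i ≠ j then (ψ i j).1 m * (ω i * ω j) else 0 := by
  obtain ⟨I₀, ψ, hc, hd, hz, hs, hf⟩ := hf
  refine ⟨I₀, fun i j => ⟨ψ i j, hc i j, hd i j⟩, fun i j h => Subtype.ext (hz i j h),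
    fun i j => Subtype.ext (hs i j), fun I hI m ω => ?_⟩
  rw [hf]
  congr 1
  · refine Finset.sum_subset hI fun i _ hi => ?_
    rw [hz i i (Or.inl hi), Pi.zero_apply, zero_mul]
  · rw [← Finset.sum_subset hI fun i _ hi => Finset.sum_eq_zero fun j _ => by
      simp [hz i j (Or.inl hi)]]
    refine Finset.sum_congr rfl fun i _ => Finset.sum_subset hI fun j _ hj => ?_
    simp [hz i j (Or.inr hj)]

lemma isQuadratic_of_coefs {f : Fn C} (I : Finset ℤ) (ψ : ℤ → ℤ → coefs C)
    (hz : ∀ i j, (i ∉ I ∨ j ∉ I) → ψ i j = 0) (hs : ∀ i j, ψ i j = ψ j i)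
    (hf : ∀ m ω, f m ω = (∑ i ∈ I, (ψ i i).1 m * (ω (i + 1) ^ 2 - ω i ^ 2)) +
      ∑ i ∈ I, ∑ j ∈ I, if i ≠ j then (ψ i j).1 m * (ω i * ω j) else 0) : IsQuadratic f :=
  ⟨I, fun i j => (ψ i j).1, fun i j => (ψ i j).2.1, fun i j => (ψ i j).2.2,
    fun i j h => congrArg Subtype.val (hz i j h), fun i j => congrArg Subtype.val (hs i j), hf⟩

lemma IsQuadratic.mem_quadFn {f : Fn C} (hf : IsQuadratic f) : f ∈ quadFn C Set.univ := by
  obtain ⟨I, ψ, _, _, hf⟩ := hf.exists_superset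
  have h : f = (∑ i ∈ I, (monF (ψ i i).1 (i + 1) (i + 1) - monF (ψ i i).1 i i)) +
      ∑ i ∈ I, ∑ j ∈ I, if i ≠ j then monF (ψ i j).1 i j else 0 := by
    ext m ω
    rw [hf I subset_rfl]
    simp only [Pi.add_apply, Finset.sum_apply, Pi.sub_apply, monF]
    congr 1
    · exact Finset.sum_congr rfl fun i _ => by ring
    · refine Finset.sum_congr rfl fun i _ => Finset.sum_congr rfl fun j _ => ?_
      split_ifs <;> rfl
  rw [h]
  refine Submodule.add_mem _ (Submodule.sum_mem _ fun i _ =>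
    bond_mem_quadFn (Set.mem_univ _) (Set.mem_univ _) _) (Submodule.sum_mem _ fun i _ =>
      Submodule.sum_mem _ fun j _ => ?_)
  split_ifs with hij
  · exact monF_mem_quadFn (Set.mem_univ _) (Set.mem_univ _) hij _
  · exact Submodule.zero_mem _

lemma isQuadratic_of_mem_quadFn {f : Fn C} (hf : f ∈ quadFn C Set.univ) : IsQuadratic f := by
  refine quadFn_induction (p := IsQuadratic) ?_ ?_ ?_ ?_ ?_ hf
  · intro ψ i j _ _ hij
    -- The factor `1/2` compensates for the symmetric double sum, which counts `{i, j}` twice.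
    refine isQuadratic_of_coefs {i, j}
      (fun k l => if (k = i ∧ l = j) ∨ (k = j ∧ l = i) then (1 / 2 : ℝ) • ψ else 0) ?_ ?_ ?_
    · intro k l h
      rw [if_neg]
      rintro (⟨rfl, rfl⟩ | ⟨rfl, rfl⟩) <;> simp at h
    · intro k l
      congr 1
      apply propext
      tauto
    · intro m ω
      rw [Finset.sum_pair hij, Finset.sum_pair hij, Finset.sum_pair hij, Finset.sum_pair hij]
      simp [hij, hij.symm, monF]
      ring
  · intro ψ i _ _
    refine isQuadratic_of_coefs {i} (fun k l => if k = i ∧ l = i then ψ else 0) ?_ ?_ ?_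
    · intro k l h
      rw [if_neg]
      rintro ⟨rfl, rfl⟩
      simp at h
    · intro k l
      congr 1
      apply propext
      tauto
    · intro m ω
      simp [monF]
      ring
  · exact isQuadratic_of_coefs ∅ (fun _ _ => 0) (fun _ _ _ => rfl) (fun _ _ => rfl) (by simp)
  · intro f g hf hg
    obtain ⟨I, ψ, hz, hs, hf⟩ := hf.exists_superset
    obtain ⟨I', ψ', hz', hs', hg⟩ := hg.exists_superset
    refine isQuadratic_of_coefs (I ∪ I') (fun i j => ψ i j + ψ' i j) ?_ ?_ ?_
    · intro i j h
      simp only [Finset.mem_union] at h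
      rw [hz i j (by tauto), hz' i j (by tauto), add_zero]
    · intro i j
      rw [hs, hs']
    · intro m ω
      rw [Pi.add_apply, Pi.add_apply, hf _ Finset.subset_union_left,
        hg _ Finset.subset_union_right, add_add_add_comm, ← Finset.sum_add_distrib,
        ← Finset.sum_add_distrib]
      congr 1
      · refine Finset.sum_congr rfl fun i _ => ?_
        rw [← add_mul]; rfl
      · refine Finset.sum_congr rfl fun i _ => ?_
        rw [← Finset.sum_add_distrib]
        refine Finset.sum_congr rfl fun j _ => ?_
        split_ifs
        · rw [← add_mul]; rfl
        · rw [add_zero]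
  · intro c f hf
    obtain ⟨I, ψ, hz, hs, hf⟩ := hf.exists_superset
    refine isQuadratic_of_coefs I (fun i j => c • ψ i j) ?_ ?_ ?_
    · intro i j h
      rw [hz i j h, smul_zero]
    · intro i j
      rw [hs]
    · intro m ω
      rw [Pi.smul_apply, Pi.smul_apply, hf _ subset_rfl, smul_add, Finset.smul_sum,
        Finset.smul_sum]
      congr 1
      · refine Finset.sum_congr rfl fun i _ => ?_
        simp [mul_assoc]
      · refine Finset.sum_congr rfl fun i _ => ?_
        rw [Finset.smul_sum]
        refine Finset.sum_congr rfl fun j _ => ?_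
        split_ifs <;> simp [mul_assoc]

/-! ### Decomposition of the elements of `𝒬₀` -/

/-- A homogeneous polynomial of degree two is determined by its polarization. -/
lemma eval_eq_polar_sum {p : MvPolynomial ℤ ℝ} (hp : p.IsHomogeneous 2) (Λ : Finset ℤ)
    (ω : Config) (hω : ∀ z, z ∉ Λ → ω z = 0) :
    MvPolynomial.eval ω p = ∑ i ∈ Λ, ∑ j ∈ Λ,
      (1 / 2 * (MvPolynomial.eval (Pi.single i 1 + Pi.single j 1 : Config) p -
        MvPolynomial.eval (Pi.single i 1 : Config) p -
        MvPolynomial.eval (Pi.single j 1 : Config) p)) * (ω i * ω j) := by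
  have hmem : p ∈ Submodule.span ℝ
      (Set.range (MvPolynomial.X : ℤ → MvPolynomial ℤ ℝ) *
        Set.range (MvPolynomial.X : ℤ → MvPolynomial ℤ ℝ)) := by
    rw [← Submodule.span_mul_span, ← MvPolynomial.homogeneousSubmodule_one_eq_span_X, ← sq,
      MvPolynomial.homogeneousSubmodule_one_pow]
    exact hp
  clear hp
  induction hmem using Submodule.span_induction with
  | mem p hp =>
    obtain ⟨_, ⟨a, rfl⟩, _, ⟨b, rfl⟩, rfl⟩ := hp
    have hsum : ∀ a : ℤ, ∑ i ∈ Λ, (Pi.single i 1 : Config) a * ω i = ω a := by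
      intro a
      simp only [Pi.single_apply, ite_mul, one_mul, zero_mul, Finset.sum_ite_eq]
      split_ifs with h
      · rfl
      · exact (hω a h).symm
    have h1 : ∀ i j : ℤ, (1 / 2 * (MvPolynomial.eval (Pi.single i 1 + Pi.single j 1 : Config)
          (MvPolynomial.X a * MvPolynomial.X b : MvPolynomial ℤ ℝ) -
        MvPolynomial.eval (Pi.single i 1 : Config) (MvPolynomial.X a * MvPolynomial.X b) -
        MvPolynomial.eval (Pi.single j 1 : Config) (MvPolynomial.X a * MvPolynomial.X b))) *
          (ω i * ω j) =
        1 / 2 * (((Pi.single i 1 : Config) a * ω i) * ((Pi.single j 1 : Config) b * ω j)) +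
        1 / 2 * (((Pi.single i 1 : Config) b * ω i) * ((Pi.single j 1 : Config) a * ω j)) := by
      intro i j
      simp only [map_mul, MvPolynomial.eval_X, Pi.add_apply]
      ring
    simp only [h1, Finset.sum_add_distrib, ← Finset.mul_sum, hsum, ← Finset.sum_mul]
    simp only [map_mul, MvPolynomial.eval_X]
    ring
  | zero => simp
  | add p q _ _ h1 h2 =>
    simp only [map_add]
    rw [h1, h2, ← Finset.sum_add_distrib]
    refine Finset.sum_congr rfl fun i _ => ?_
    rw [← Finset.sum_add_distrib]
    exact Finset.sum_congr rfl fun j _ => by ring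
  | smul c p _ h =>
    simp only [MvPolynomial.smul_eval]
    rw [h, Finset.mul_sum]
    refine Finset.sum_congr rfl fun i _ => ?_
    rw [Finset.mul_sum]
    exact Finset.sum_congr rfl fun j _ => by ring

/-- A homogeneous quadratic function is a finite sum of monomials. -/
lemma IsHomQuadratic.eq_sum {F : Fn C} (hF : IsHomQuadratic F) :
    ∃ (Λ : Finset ℤ) (a : ℤ → ℤ → coefs C), F = ∑ i ∈ Λ, ∑ j ∈ Λ, monF (a i j).1 i j := by
  obtain ⟨Λ, hΛ⟩ := hF.cylinder
  have hdep : ∀ ω : Config, DependsOn (fun m => F m ω) (Λ : Set ℤ) :=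
    fun ω m m' h => hΛ m m' ω ω fun x hx => ⟨h x hx, rfl⟩
  have hmem : ∀ ω : Config, (fun m => F m ω) ∈ coefs C :=
    fun ω => ⟨hF.continuous ω, Λ, hdep ω⟩
  let e (ω : Config) : coefs C := ⟨fun m => F m ω, hmem ω⟩
  -- The polynomial is chosen separately for each `m`, but its polarized coefficients are values of
  -- `F` at fixed configurations, so they are continuous cylinder functions of `m`.
  refine ⟨Λ, fun i j => (1 / 2 : ℝ) • (e (Pi.single i 1 + Pi.single j 1) - e (Pi.single i 1) -
    e (Pi.single j 1)), ?_⟩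
  ext m ω
  obtain ⟨p, hp, hpF⟩ := hF.homogeneous m
  set ω' : Config := fun z => if z ∈ Λ then ω z else 0 with hω'
  have h1 : F m ω = F m ω' := hΛ m m ω ω' fun x hx => ⟨rfl, by simp [hω', Finset.mem_coe.1 hx]⟩
  rw [h1, hpF, eval_eq_polar_sum hp Λ ω' fun z hz => by simp [hω', hz]]
  simp only [Finset.sum_apply]
  refine Finset.sum_congr rfl fun i hi => Finset.sum_congr rfl fun j hj => ?_
  simp [monF, e, hpF, hω', hi, hj]

lemma gradFlip_monF_mem (x i j : ℤ) (ψ : coefs C) :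
    gradFlip x (monF ψ.1 i j) ∈ quadFn C Set.univ := by
  by_cases hij : i = j
  · subst hij
    convert Submodule.zero_mem _ using 1
    ext m ω
    by_cases h : i = x
    · subst h; simp [gradFlip, monF, flip]
    · simp [gradFlip, monF, flip, h]
  · by_cases hx : i = x ∨ j = x
    · convert Submodule.smul_mem _ (-2 : ℝ)
        (monF_mem_quadFn (Set.mem_univ i) (Set.mem_univ j) hij ψ) using 1
      ext m ω
      rcases hx with rfl | rfl
      · simp [gradFlip, monF, flip, Ne.symm hij]; ring
      · simp [gradFlip, monF, flip, hij]; ring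
    · convert Submodule.zero_mem _ using 1
      rw [not_or] at hx
      ext m ω
      simp [gradFlip, monF, flip, hx.1, hx.2]

lemma gradExch_monF (x i j : ℤ) (ψ : coefs C) : gradExch x (monF ψ.1 i j) =
    monF ψ.1 (Equiv.swap x (x + 1) i) (Equiv.swap x (x + 1) j) - monF ψ.1 i j := rfl

lemma gradExch_monF_mem (x i j : ℤ) (ψ : coefs C) :
    gradExch x (monF ψ.1 i j) ∈ quadFn C Set.univ := by
  rw [gradExch_monF]
  by_cases hij : i = j
  · subst hij
    rw [Equiv.swap_apply_def]
    split_ifs with h1 h2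
    · subst h1
      exact bond_mem_quadFn (Set.mem_univ _) (Set.mem_univ _) ψ
    · subst h2
      rw [← neg_sub]
      exact Submodule.neg_mem _ (bond_mem_quadFn (Set.mem_univ _) (Set.mem_univ _) ψ)
    · rw [sub_self]
      exact Submodule.zero_mem _
  · exact Submodule.sub_mem _
      (monF_mem_quadFn (Set.mem_univ _) (Set.mem_univ _) (by simpa using hij) ψ)
      (monF_mem_quadFn (Set.mem_univ _) (Set.mem_univ _) hij ψ)

lemma gradFlip_sum {ι : Type*} (A : Finset ι) (x : ℤ) (f : ι → Fn C) :
    gradFlip x (∑ i ∈ A, f i) = ∑ i ∈ A, gradFlip x (f i) := by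
  ext m ω
  simp [gradFlip, Finset.sum_sub_distrib]

lemma gradExch_sum {ι : Type*} (A : Finset ι) (x : ℤ) (f : ι → Fn C) :
    gradExch x (∑ i ∈ A, f i) = ∑ i ∈ A, gradExch x (f i) := by
  ext m ω
  simp [gradExch, Finset.sum_sub_distrib]

lemma IsQZero.mem_quadFn {φ : Fn C} (hφ : IsQZero φ) : φ ∈ quadFn C Set.univ := by
  obtain ⟨-, Λ, F, G, hFG, hφ⟩ := hφ
  have h : φ = ∑ x ∈ Λ, (gradFlip x (F x) + gradExch x (G x)) := by
    ext m ω
    simp [hφ]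
  rw [h]
  refine Submodule.sum_mem _ fun x hx => Submodule.add_mem _ ?_ ?_
  · obtain ⟨A, a, ha⟩ := (hFG x hx).1.eq_sum
    simp only [ha, gradFlip_sum]
    exact Submodule.sum_mem _ fun i _ => Submodule.sum_mem _ fun j _ => gradFlip_monF_mem x i j _
  · obtain ⟨A, a, ha⟩ := (hFG x hx).2.eq_sum
    simp only [ha, gradExch_sum]
    exact Submodule.sum_mem _ fun i _ => Submodule.sum_mem _ fun j _ => gradExch_monF_mem x i j _

/-! ### Localization -/

lemma integral_sq_gibbs_pos (i : ℤ) : ∫ ω, ω i * ω i ∂gibbs ≠ 0 := by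
  have h := variance_of_integral_eq_zero (X := fun t : ℝ => t) (μ := gaussianReal 0 1)
    measurable_id.aemeasurable integral_id_gaussianReal
  rw [variance_fun_id_gaussianReal] at h
  rw [integral_eval_gibbs i (f := fun t => t * t) (by fun_prop)]
  simp only [← sq, ← h]
  norm_num

/-- The elements of the span have mean zero for all values of the disorder. -/
lemma integral_eq_zero_of_mem_quadFn {f : Fn C} (hf : f ∈ quadFn C Set.univ) (m : Disorder C) :
    Integrable (f m) gibbs ∧ ∫ ω, f m ω ∂gibbs = 0 := by
  have hint : ∀ (ψ : coefs C) (i j : ℤ), Integrable (monF ψ.1 i j m) gibbs := fun ψ i j =>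
    ((memLp_mul_gibbs i j).integrable one_le_two).const_mul _
  refine quadFn_induction (p := fun f => Integrable (f m) gibbs ∧ ∫ ω, f m ω ∂gibbs = 0)
    ?_ ?_ ?_ ?_ ?_ hf
  · intro ψ i j _ _ hij
    refine ⟨hint ψ i j, ?_⟩
    have hind : IndepFun (fun ω : Config => ω i) (fun ω : Config => ω j) gibbs :=
      (iIndepFun_infinitePi (P := fun _ : ℤ => gaussianReal 0 1) (X := fun _ t => t)
        fun _ => by fun_prop).indepFun hij
    have h0 : ∫ ω : Config, ω i ∂gibbs = 0 := by
      rw [integral_eval_gibbs i (f := fun t => t) (by fun_prop), integral_id_gaussianReal]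
    simp only [monF]
    rw [integral_const_mul, hind.integral_fun_mul_eq_mul_integral
      (memLp_eval_gibbs i 2 (by simp)).1 (memLp_eval_gibbs j 2 (by simp)).1, h0, zero_mul, mul_zero]
  · intro ψ i _ _
    refine ⟨(hint ψ _ _).sub (hint ψ _ _), ?_⟩
    have h : ∫ ω, monF ψ.1 (i + 1) (i + 1) m ω ∂gibbs = ∫ ω, monF ψ.1 i i m ω ∂gibbs := by
      simp only [monF]
      rw [integral_eval_gibbs (i + 1) (f := fun t => ψ.1 m * (t * t)) (by fun_prop),
        integral_eval_gibbs i (f := fun t => ψ.1 m * (t * t)) (by fun_prop)]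
    simp only [Pi.sub_apply]
    rw [integral_sub (hint ψ _ _) (hint ψ _ _), h, sub_self]
  · exact ⟨integrable_zero _ _ _, by simp⟩
  · rintro f g ⟨hf, hf0⟩ ⟨hg, hg0⟩
    refine ⟨hf.add hg, ?_⟩
    simp only [Pi.add_apply]
    rw [integral_add hf hg, hf0, hg0, add_zero]
  · rintro c f ⟨hf, hf0⟩
    refine ⟨hf.smul c, ?_⟩
    simp only [Pi.smul_apply, smul_eq_mul]
    rw [integral_const_mul, hf0, mul_zero]

/-- The function `f` evaluated at the configuration set to zero outside `{-s, …, s}`. -/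
def restr (s : ℕ) : Fn C →ₗ[ℝ] Fn C where
  toFun f := fun m ω => f m fun z => if z ∈ Finset.Icc (-(s : ℤ)) s then ω z else 0
  map_add' _ _ := rfl
  map_smul' _ _ := rfl

lemma restr_monF (s : ℕ) (ψ : Disorder C → ℝ) (i j : ℤ) : restr s (monF ψ i j) =
    if i ∈ Finset.Icc (-(s : ℤ)) s ∧ j ∈ Finset.Icc (-(s : ℤ)) s then monF ψ i j else 0 := by
  ext m ω
  have h : restr s (monF ψ i j) m ω =
      ψ m * ((if i ∈ Finset.Icc (-(s : ℤ)) s then ω i else 0) *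
        (if j ∈ Finset.Icc (-(s : ℤ)) s then ω j else 0)) := rfl
  rw [h]
  by_cases hi : i ∈ Finset.Icc (-(s : ℤ)) s
  · by_cases hj : j ∈ Finset.Icc (-(s : ℤ)) s
    · rw [if_pos hi, if_pos hj, if_pos ⟨hi, hj⟩]; rfl
    · have h2 : ¬(i ∈ Finset.Icc (-(s : ℤ)) s ∧ j ∈ Finset.Icc (-(s : ℤ)) s) := fun h => hj h.2
      rw [if_neg hj, if_neg h2, mul_zero, mul_zero]; rfl
  · have h2 : ¬(i ∈ Finset.Icc (-(s : ℤ)) s ∧ j ∈ Finset.Icc (-(s : ℤ)) s) := fun h => hi h.1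
    rw [if_neg hi, if_neg h2, zero_mul, mul_zero]; rfl

lemma monF_sub_monF_mem (s : ℕ) (ψ : coefs C) {i : ℤ} (hi : i ∈ Set.Icc (-(s : ℤ)) s) :
    monF ψ.1 i i - monF ψ.1 s s ∈ quadFn C (Set.Icc (-(s : ℤ)) s) := by
  obtain ⟨n, hn⟩ : ∃ n : ℕ, i = s - n := ⟨(s - i).toNat, by rw [Set.mem_Icc] at hi; omega⟩
  induction n generalizing i with
  | zero =>
    rw [hn, Nat.cast_zero, sub_zero, sub_self]
    exact Submodule.zero_mem _
  | succ n ih =>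
    rw [Set.mem_Icc] at hi
    have hi1 : i + 1 ∈ Set.Icc (-(s : ℤ)) s := by rw [Set.mem_Icc]; push_cast at hn; omega
    have h1 := ih hi1 (by push_cast at hn; omega)
    have h2 := bond_mem_quadFn (Set.mem_Icc.2 hi) hi1 ψ
    convert Submodule.sub_mem _ h1 h2 using 1
    abel

lemma exists_restr_monF_sub_mem (s : ℕ) (ψ : coefs C) (i j : ℤ) :
    ∃ A : coefs C, restr s (monF ψ.1 i j) - monF A.1 s s ∈ quadFn C (Set.Icc (-(s : ℤ)) s) := by
  have h0 : monF (0 : coefs C).1 s s = (0 : Fn C) := by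
    ext m ω; simp [monF]
  rw [restr_monF]
  split_ifs with h
  · simp only [Finset.mem_Icc, ← Set.mem_Icc] at h
    by_cases hij : i = j
    · subst hij
      exact ⟨ψ, monF_sub_monF_mem s ψ h.1⟩
    · exact ⟨0, by rw [h0, sub_zero]; exact monF_mem_quadFn h.1 h.2 hij ψ⟩
  · exact ⟨0, by rw [h0, sub_zero]; exact Submodule.zero_mem _⟩

/-- Telescoping bond gradients inside the box move all diagonal terms to the site `s`; the only
obstruction left is a single term `A(m) ω_s²`. -/
lemma exists_restr_sub_mem (s : ℕ) {f : Fn C} (hf : f ∈ quadFn C Set.univ) :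
    ∃ A : coefs C, restr s f - monF A.1 s s ∈ quadFn C (Set.Icc (-(s : ℤ)) s) := by
  have hadd : ∀ A B : coefs C, monF (A + B).1 s s = (monF A.1 s s + monF B.1 s s : Fn C) := by
    intro A B; ext m ω; simp [monF, add_mul]
  have hsmul : ∀ (c : ℝ) (A : coefs C), monF (c • A).1 s s = (c • monF A.1 s s : Fn C) := by
    intro c A; ext m ω; simp [monF, mul_assoc]
  have hadd' : ∀ f g : Fn C,
      (∃ A : coefs C, restr s f - monF A.1 s s ∈ quadFn C (Set.Icc (-(s : ℤ)) s)) →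
      (∃ A : coefs C, restr s g - monF A.1 s s ∈ quadFn C (Set.Icc (-(s : ℤ)) s)) →
      ∃ A : coefs C, restr s (f + g) - monF A.1 s s ∈ quadFn C (Set.Icc (-(s : ℤ)) s) := by
    rintro f g ⟨A, hA⟩ ⟨B, hB⟩
    refine ⟨A + B, ?_⟩
    rw [hadd, map_add, add_sub_add_comm]
    exact Submodule.add_mem _ hA hB
  have hsmul' : ∀ (c : ℝ) (f : Fn C),
      (∃ A : coefs C, restr s f - monF A.1 s s ∈ quadFn C (Set.Icc (-(s : ℤ)) s)) →
      ∃ A : coefs C, restr s (c • f) - monF A.1 s s ∈ quadFn C (Set.Icc (-(s : ℤ)) s) := by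
    rintro c f ⟨A, hA⟩
    refine ⟨c • A, ?_⟩
    rw [hsmul, map_smul, ← smul_sub]
    exact Submodule.smul_mem _ c hA
  refine quadFn_induction
    (p := fun f => ∃ A : coefs C, restr s f - monF A.1 s s ∈ quadFn C (Set.Icc (-(s : ℤ)) s))
    (fun ψ i j _ _ _ => exists_restr_monF_sub_mem s ψ i j) (fun ψ i _ _ => ?_) ?_ hadd' hsmul' hf
  · rw [sub_eq_add_neg, ← neg_one_smul ℝ (monF ψ.1 i i)]
    exact hadd' _ _ (exists_restr_monF_sub_mem s ψ _ _)
      (hsmul' _ _ (exists_restr_monF_sub_mem s ψ _ _))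
  · simpa using hsmul' 0 0 ⟨0, by
      have h0 : monF (0 : coefs C).1 s s = (0 : Fn C) := by ext m ω; simp [monF]
      rw [h0, map_zero, sub_zero]
      exact Submodule.zero_mem _⟩

/-- Locality makes the restriction equal to `f`. The obstruction `A(m) ω_s²` then lies in the global
span, whose elements have mean zero at fixed disorder, so `A = 0`. -/
lemma mem_quadFn_of_localOn {f : Fn C} (hf : f ∈ quadFn C Set.univ) {s : ℕ}
    (hs : LocalOn f (Set.Icc (-(s : ℤ)) s)) : f ∈ quadFn C (Set.Icc (-(s : ℤ)) s) := by
  obtain ⟨A, hA⟩ := exists_restr_sub_mem s hf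
  have hrestr : restr s f = f := by
    ext m ω
    exact hs _ _ _ _ fun x hx => ⟨rfl, if_pos (Finset.mem_Icc.2 (Set.mem_Icc.1 hx))⟩
  rw [hrestr] at hA
  have hmon : monF A.1 s s ∈ quadFn C Set.univ := by
    have := Submodule.sub_mem _ hf (quadFn_mono (Set.subset_univ _) hA)
    rwa [sub_sub_cancel] at this
  have hA0 : monF A.1 s s = (0 : Fn C) := by
    ext m ω
    have h1 := (integral_eq_zero_of_mem_quadFn hmon m).2
    simp only [monF] at h1
    rw [integral_const_mul] at h1
    have h2 : A.1 m = 0 := (mul_eq_zero.1 h1).resolve_right (integral_sq_gibbs_pos s)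
    simp [monF, h2]
  rwa [hA0, sub_zero] at hA

end HarmonicChain
end

/-! ### Identification of the variational values and conclusion. -/

noncomputable section

namespace HarmonicChain

open MeasureTheory ProbabilityTheory Filter Topology

variable {C : ℝ}

/-! ### The class of a quadratic function -/

section QuadraticClasses

variable (ν : Measure (Set.Icc C⁻¹ C)) [IsProbabilityMeasure ν]

lemma isL2_and_cls_mem_quadL2 {Λ : Set ℤ} {f : Fn C} (hf : f ∈ quadFn C Λ) :
    IsL2 ν f ∧ cls ν f ∈ quadL2 ν Λ := by
  refine quadFn_induction (p := fun f => IsL2 ν f ∧ cls ν f ∈ quadL2 ν Λ) ?_ ?_ ?_ ?_ ?_ hf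
  · intro ψ i j hi hj hij
    exact ⟨isL2_monF ν ψ i j, mon_mem_quadL2 hi hj hij ψ⟩
  · intro ψ i hi hj
    refine ⟨(isL2_monF ν ψ _ _).sub (isL2_monF ν ψ _ _), ?_⟩
    rw [cls_sub (isL2_monF ν ψ _ _) (isL2_monF ν ψ _ _)]
    exact bnd_mem_quadL2 hi hj ψ
  · exact ⟨IsL2.zero, by rw [cls_zero]; exact Submodule.zero_mem _⟩
  · rintro f g ⟨hf, hf'⟩ ⟨hg, hg'⟩
    exact ⟨hf.add hg, by rw [cls_add hf hg]; exact Submodule.add_mem _ hf' hg'⟩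
  · rintro c f ⟨hf, hf'⟩
    exact ⟨hf.smul c, by rw [cls_smul hf]; exact Submodule.smul_mem _ c hf'⟩

lemma isL2_of_mem_quadFn {Λ : Set ℤ} {f : Fn C} (hf : f ∈ quadFn C Λ) : IsL2 ν f :=
  (isL2_and_cls_mem_quadL2 ν hf).1

lemma cls_mem_quadL2 {Λ : Set ℤ} {f : Fn C} (hf : f ∈ quadFn C Λ) : cls ν f ∈ quadL2 ν Λ :=
  (isL2_and_cls_mem_quadL2 ν hf).2

lemma exists_cls_eq_of_mem_quadL2 {Λ : Set ℤ} {v : Lp ℝ 2 (starMeasure ν)}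
    (hv : v ∈ quadL2 ν Λ) : ∃ f ∈ quadFn C Λ, cls ν f = v := by
  refine quadL2_induction (p := fun v => ∃ f ∈ quadFn C Λ, cls ν f = v) ?_ ?_ ?_ ?_ ?_ hv
  · intro ψ i j hi hj hij
    exact ⟨_, monF_mem_quadFn hi hj hij ψ, rfl⟩
  · intro ψ i hi hj
    exact ⟨_, bond_mem_quadFn hi hj ψ, cls_sub (isL2_monF ν ψ _ _) (isL2_monF ν ψ _ _)⟩
  · exact ⟨0, Submodule.zero_mem _, cls_zero⟩
  · rintro _ _ ⟨f, hf, rfl⟩ ⟨g, hg, rfl⟩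
    exact ⟨f + g, Submodule.add_mem _ hf hg,
      cls_add (isL2_of_mem_quadFn ν hf) (isL2_of_mem_quadFn ν hg)⟩
  · rintro c _ ⟨f, hf, rfl⟩
    exact ⟨c • f, Submodule.smul_mem _ c hf, cls_smul (isL2_of_mem_quadFn ν hf) c⟩

end QuadraticClasses

lemma dependsOn_of_mem_quadFn {Λ : Set ℤ} {f : Fn C} (hf : f ∈ quadFn C Λ) (m : Disorder C) :
    DependsOn (f m) Λ := by
  refine quadFn_induction (p := fun f => DependsOn (f m) Λ) ?_ ?_ ?_ ?_ ?_ hf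
  · intro ψ i j hi hj _ ω ω' h
    simp only [monF, h i hi, h j hj]
  · intro ψ i hi hj ω ω' h
    simp only [monF, Pi.sub_apply, h i hi, h (i + 1) hj]
  · intro ω ω' _
    rfl
  · intro f g hf hg ω ω' h
    simp only [Pi.add_apply, hf h, hg h]
  · intro c f hf ω ω' h
    simp only [Pi.smul_apply, hf h]

lemma gradFlip_shift_eq_zero {r : ℕ} {g : Fn C} (hg : g ∈ quadFn C (Set.Icc (-(r : ℤ)) r))
    {x : ℤ} (hx : (r : ℤ) < |x|) : gradFlip 0 (shift x g) = 0 := by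
  ext m ω
  refine sub_eq_zero.2 (dependsOn_of_mem_quadFn hg _ fun z hz => ?_)
  have h : x + z ≠ 0 := by
    intro h
    obtain rfl : z = -x := by omega
    rw [← abs_neg] at hx
    exact absurd (abs_le.2 hz) (not_le.2 hx)
  exact Function.update_of_ne h _ _

lemma gradExch_shift_eq_zero {r : ℕ} {g : Fn C} (hg : g ∈ quadFn C (Set.Icc (-(r : ℤ)) r))
    {x : ℤ} (hx : ((r + 1 : ℕ) : ℤ) < |x|) : gradExch 0 (shift x g) = 0 := by
  ext m ω
  refine sub_eq_zero.2 (dependsOn_of_mem_quadFn hg _ fun z hz => ?_)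
  rw [Set.mem_Icc] at hz
  rw [lt_abs] at hx
  push_cast at hx
  exact congrArg ω (Equiv.swap_apply_of_ne_of_ne (by omega) (by omega))

lemma gradFlipGamma_eq_sum {r : ℕ} {g : Fn C} (hg : g ∈ quadFn C (Set.Icc (-(r : ℤ)) r)) :
    gradFlipGamma g =
      ∑ x ∈ Finset.Icc (-((r + 1 : ℕ) : ℤ)) (r + 1 : ℕ), gradFlip 0 (shift x g) := by
  ext m ω
  rw [gradFlipGamma, tsum_eq_sum (s := Finset.Icc (-((r + 1 : ℕ) : ℤ)) (r + 1 : ℕ))]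
  · simp only [Finset.sum_apply]
  · intro x hx
    rw [Finset.mem_Icc, ← abs_le, not_le] at hx
    rw [gradFlip_shift_eq_zero hg (lt_trans (by push_cast; omega) hx)]
    rfl

lemma gradExchGamma_eq_sum {r : ℕ} {g : Fn C} (hg : g ∈ quadFn C (Set.Icc (-(r : ℤ)) r)) :
    gradExchGamma g =
      ∑ x ∈ Finset.Icc (-((r + 1 : ℕ) : ℤ)) (r + 1 : ℕ), gradExch 0 (shift x g) := by
  ext m ω
  rw [gradExchGamma, tsum_eq_sum (s := Finset.Icc (-((r + 1 : ℕ) : ℤ)) (r + 1 : ℕ))]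
  · simp only [Finset.sum_apply]
  · intro x hx
    rw [Finset.mem_Icc, ← abs_le, not_le] at hx
    rw [gradExch_shift_eq_zero hg hx]
    rfl

/-! ### The variational functionals in `L²` -/

section Functionals

variable (ν : Measure (Set.Icc C⁻¹ C)) [IsProbabilityMeasure ν]

/-- The class of `∇_0 Γ_g`. -/
def flipGamma (ρ : ℕ) (v : Lp ℝ 2 (starMeasure ν)) : Lp ℝ 2 (starMeasure ν) :=
  ∑ z ∈ Finset.Icc (-(ρ : ℤ)) ρ,
    ((chainRep ν).flip 0 ((chainRep ν).shift z v) - (chainRep ν).shift z v)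

/-- The class of `∇_{0,1} Γ_g`. -/
def exchGamma (ρ : ℕ) (v : Lp ℝ 2 (starMeasure ν)) : Lp ℝ 2 (starMeasure ν) :=
  ∑ z ∈ Finset.Icc (-(ρ : ℤ)) ρ,
    ((chainRep ν).exch 0 ((chainRep ν).shift z v) - (chainRep ν).shift z v)

variable {ν}

lemma isL2_gradFlipGamma {r : ℕ} {g : Fn C} (hg : g ∈ quadFn C (Set.Icc (-(r : ℤ)) r)) :
    IsL2 ν (gradFlipGamma g) ∧ cls ν (gradFlipGamma g) = flipGamma ν (r + 1) (cls ν g) := by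
  have h := isL2_of_mem_quadFn ν hg
  have h1 : ∀ x ∈ Finset.Icc (-((r + 1 : ℕ) : ℤ)) (r + 1 : ℕ),
      IsL2 ν (gradFlip 0 (shift x g)) := fun x _ => (h.shift x).gradFlip 0
  rw [gradFlipGamma_eq_sum hg, cls_sum h1]
  refine ⟨IsL2.sum h1, Finset.sum_congr rfl fun x _ => ?_⟩
  rw [cls_gradFlip (h.shift x), cls_shift h]

lemma isL2_gradExchGamma {r : ℕ} {g : Fn C} (hg : g ∈ quadFn C (Set.Icc (-(r : ℤ)) r)) :
    IsL2 ν (gradExchGamma g) ∧ cls ν (gradExchGamma g) = exchGamma ν (r + 1) (cls ν g) := by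
  have h := isL2_of_mem_quadFn ν hg
  have h1 : ∀ x ∈ Finset.Icc (-((r + 1 : ℕ) : ℤ)) (r + 1 : ℕ),
      IsL2 ν (gradExch 0 (shift x g)) := fun x _ => (h.shift x).gradExch 0
  rw [gradExchGamma_eq_sum hg, cls_sum h1]
  refine ⟨IsL2.sum h1, Finset.sum_congr rfl fun x _ => ?_⟩
  rw [cls_gradExch (h.shift x), cls_shift h]

lemma starE_gradFlipGamma_sq {r : ℕ} {g : Fn C} (hg : g ∈ quadFn C (Set.Icc (-(r : ℤ)) r)) :
    starE ν (fun m ω => gradFlipGamma g m ω ^ 2) = ‖flipGamma ν (r + 1) (cls ν g)‖ ^ 2 := by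
  rw [← (isL2_gradFlipGamma hg).2, norm_cls_sq (isL2_gradFlipGamma hg).1]

lemma starE_gradExchGamma_sq {r : ℕ} {g : Fn C} (hg : g ∈ quadFn C (Set.Icc (-(r : ℤ)) r)) :
    starE ν (fun m ω => gradExchGamma g m ω ^ 2) = ‖exchGamma ν (r + 1) (cls ν g)‖ ^ 2 := by
  rw [← (isL2_gradExchGamma hg).2, norm_cls_sq (isL2_gradExchGamma hg).1]

variable (ν) in
lemma isL2_energy_sub : IsL2 ν (fun _ ω => ω 0 ^ 2 - ω 1 ^ 2) ∧
    cls ν (fun _ ω => ω 0 ^ 2 - ω 1 ^ 2) = energy ν 0 - energy ν 1 := by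
  have h : (fun _ ω => ω 0 ^ 2 - ω 1 ^ 2 : Fn C) =
      monF (coefOne : coefs C).1 0 0 - monF (coefOne : coefs C).1 1 1 := by
    ext m ω
    change ω 0 ^ 2 - ω 1 ^ 2 = 1 * (ω 0 * ω 0) - 1 * (ω 1 * ω 1)
    ring
  rw [h]
  exact ⟨(isL2_monF ν _ _ _).sub (isL2_monF ν _ _ _),
    cls_sub (isL2_monF ν _ _ _) (isL2_monF ν _ _ _)⟩

lemma starE_add_gradExchGamma_sq {r : ℕ} {g : Fn C}
    (hg : g ∈ quadFn C (Set.Icc (-(r : ℤ)) r)) (a : ℝ) :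
    starE ν (fun m ω => (a * (ω 0 ^ 2 - ω 1 ^ 2) + gradExchGamma g m ω) ^ 2) =
      ‖a • (energy ν 0 - energy ν 1) + exchGamma ν (r + 1) (cls ν g)‖ ^ 2 := by
  obtain ⟨h1, h2⟩ := isL2_energy_sub ν
  obtain ⟨h3, h4⟩ := isL2_gradExchGamma (ν := ν) hg
  rw [← h2, ← h4, ← cls_smul h1, ← cls_add (h1.smul a) h3, norm_cls_sq ((h1.smul a).add h3)]
  rfl

variable (ν) in
lemma norm_energy_sub_sq : ‖energy ν 0 - energy ν 1‖ ^ 2 = 2 * chi := by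
  obtain ⟨h1, h2⟩ := isL2_energy_sub ν
  rw [← h2, norm_cls_sq h1, starE, starMeasure,
    integral_fun_snd (fun ω : Config => (ω 0 ^ 2 - ω 1 ^ 2) ^ 2)]
  simp [integral_sq_sub_sq_sq]

lemma inner_energy_eq_zero {s : ℕ} {v : Lp ℝ 2 (starMeasure ν)}
    (hv : v ∈ quadL2 ν (Set.Icc (-(s : ℤ)) s)) {x : ℤ} (hx : (s : ℤ) < |x|) :
    inner ℝ v (energy ν x) = 0 := by
  apply quadL2_orthInv hv
  · intro y _
    rw [flip_energy]
  · intro y hy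
    rw [Finset.mem_Ico] at hy
    rw [lt_abs] at hx
    rw [exch_energy, Equiv.swap_apply_of_ne_of_ne (by omega) (by omega)]

/-- The linear profile is orthogonal to the gradients of the formal sums `Γ_g`. -/
lemma inner_energy_sub_exchGamma {r : ℕ} {v : Lp ℝ 2 (starMeasure ν)}
    (hv : v ∈ quadL2 ν (Set.Icc (-(r : ℤ)) r)) :
    inner ℝ (energy ν 0 - energy ν 1) (exchGamma ν (r + 1) v) = 0 := by
  -- Each summand is a difference of consecutive values of `z ↦ ⟨v, ω_{1-z}²⟩`; the sum telescopes
  -- to two sites outside `{-r, …, r}`, where this product vanishes.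
  have h1 : ∀ z, inner ℝ (energy ν 0 - energy ν 1)
      ((chainRep ν).exch 0 ((chainRep ν).shift z v) - (chainRep ν).shift z v) =
      2 * (inner ℝ v (energy ν (1 - z)) - inner ℝ v (energy ν (1 - (z + 1)))) := by
    intro z
    have hb : (chainRep ν).exch 0 (energy ν 0 - energy ν 1) = -(energy ν 0 - energy ν 1) := by
      rw [map_sub, exch_energy, exch_energy, zero_add, Equiv.swap_apply_left,
        Equiv.swap_apply_right, neg_sub]
    have hs : energy ν 0 - energy ν 1 =
        (chainRep ν).shift z (energy ν (1 - (z + 1)) - energy ν (1 - z)) := by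
      rw [map_sub, shift_energy, shift_energy]
      congr 2 <;> ring
    have he : inner ℝ (energy ν 0 - energy ν 1) ((chainRep ν).exch 0 ((chainRep ν).shift z v)) =
        -inner ℝ (energy ν 0 - energy ν 1) ((chainRep ν).shift z v) := by
      rw [← inner_neg_left, ← hb, (chainRep ν).inner_exch]
    rw [inner_sub_right, he, hs, (chainRep ν).inner_shift, real_inner_comm,
      inner_sub_right]
    ring
  rw [exchGamma, inner_sum, Finset.sum_congr rfl fun z _ => h1 z, ← Finset.mul_sum,
    sum_Icc_sub_succ _ (by positivity) fun z => inner ℝ v (energy ν (1 - z)),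
    inner_energy_eq_zero hv, inner_energy_eq_zero hv, sub_zero, mul_zero]
  · rw [lt_abs]; push_cast; omega
  · rw [lt_abs]; push_cast; omega

lemma norm_smul_energy_sub_add_sq {r : ℕ} {v : Lp ℝ 2 (starMeasure ν)}
    (hv : v ∈ quadL2 ν (Set.Icc (-(r : ℤ)) r)) (a : ℝ) :
    ‖a • (energy ν 0 - energy ν 1) + exchGamma ν (r + 1) v‖ ^ 2 =
      2 * chi * a ^ 2 + ‖exchGamma ν (r + 1) v‖ ^ 2 := by
  rw [norm_add_sq_real, inner_smul_left, inner_energy_sub_exchGamma hv, norm_smul, mul_pow,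
    norm_energy_sub_sq, Real.norm_eq_abs, sq_abs]
  ring

lemma starInner_eq_sum {r s : ℕ} {φ g : Fn C} (hφ : φ ∈ quadFn C (Set.Icc (-(s : ℤ)) s))
    (hg : g ∈ quadFn C (Set.Icc (-(r : ℤ)) r)) :
    starInner ν φ g = ∑ z ∈ Finset.Icc (-((r + 1 + s : ℕ) : ℤ)) (r + 1 + s : ℕ),
      inner ℝ (cls ν φ) ((chainRep ν).shift z (cls ν g)) := by
  have h : ∀ z, starE ν (fun m ω => φ m ω * shift z g m ω) =
      inner ℝ (cls ν φ) ((chainRep ν).shift z (cls ν g)) := fun z => by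
    rw [← cls_shift (isL2_of_mem_quadFn ν hg),
      inner_cls (isL2_of_mem_quadFn ν hφ) ((isL2_of_mem_quadFn ν hg).shift z)]
  simp only [starInner, h]
  refine tsum_eq_sum fun z hz => ?_
  rw [Finset.mem_Icc, ← abs_le, not_le] at hz
  exact LatticeRep.Local.inner_shift_eq_zero (quadL2_orthInv (cls_mem_quadL2 ν hφ))
    (quadL2_local (cls_mem_quadL2 ν hg)) hz

lemma starStar_eq_inner {s : ℕ} {φ : Fn C} (hφ : φ ∈ quadFn C (Set.Icc (-(s : ℤ)) s)) :
    starStar ν φ = inner ℝ (cls ν φ) (linProfile ν s) := by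
  have h : ∀ x : ℤ, starE ν (fun m ω => φ m ω * ω x ^ 2) =
      inner ℝ (cls ν φ) (energy ν x) := fun x => by
    rw [energy, mon_apply, inner_cls (isL2_of_mem_quadFn ν hφ) (isL2_monF ν _ _ _)]
    congr 1
    ext m ω
    change φ m ω * ω x ^ 2 = φ m ω * (1 * (ω x * ω x))
    ring
  simp only [starStar, h, linProfile, inner_sum, inner_smul_right]
  refine tsum_eq_sum fun x hx => ?_
  rw [Finset.mem_Icc, ← abs_le, not_le] at hx
  rw [inner_energy_eq_zero (cls_mem_quadL2 ν hφ) hx, mul_zero]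

/-- The elements of `normValuesBis` are the limits of the functionals of the boxes. -/
lemma tendsto_normValuesBis (γ lam : ℝ) {r s : ℕ} {φ g : Fn C}
    (hφ : φ ∈ quadFn C (Set.Icc (-(s : ℤ)) s)) (hg : g ∈ quadFn C (Set.Icc (-(r : ℤ)) r))
    (a : ℝ) {p : ℕ} (hp : s ≤ p) (q : ℕ) :
    Tendsto (fun ℓ : ℕ => (2 * (ℓ : ℝ))⁻¹ *
      (2 * inner ℝ ((chainRep ν).sumBox (ℓ - q) (cls ν g) + a • linProfile ν ℓ)
          ((chainRep ν).sumBox (ℓ - p) (cls ν φ)) -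
        (chainRep ν).dir γ lam ℓ
          ((chainRep ν).sumBox (ℓ - q) (cls ν g) + a • linProfile ν ℓ))) atTop
      (𝓝 (2 * starInner ν φ g + 2 * a * starStar ν φ
        - (lam / 2 * starE ν (fun m ω => (a * (ω 0 ^ 2 - ω 1 ^ 2) + gradExchGamma g m ω) ^ 2)
          + γ / 2 * starE ν (fun m ω => gradFlipGamma g m ω ^ 2)))) := by
  have hφ' := cls_mem_quadL2 ν hφ
  obtain ⟨S, hS⟩ := quadL2_constProfile hφ' (isLinearProfile_linProfile ν)
  have hS0 : starStar ν φ = S := by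
    rw [starStar_eq_inner hφ, ← hS s 0 (by simp), (chainRep ν).shift_zero]
  rw [starInner_eq_sum hφ hg, hS0, starE_add_gradExchGamma_sq hg, starE_gradFlipGamma_sq hg]
  exact LatticeRep.tendsto_functional γ lam (quadL2_orthInv hφ')
    (quadL2_local (cls_mem_quadL2 ν hg)) (isLinearProfile_linProfile ν) hS a hp q

end Functionals

/-! ### The two variational formulas -/

section Variational

variable {ν : Measure (Set.Icc C⁻¹ C)} [IsProbabilityMeasure ν] {γ lam : ℝ}

lemma normValuesBis_value_eq {r : ℕ} {g : Fn C} (hg : g ∈ quadFn C (Set.Icc (-(r : ℤ)) r))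
    (a : ℝ) : starE ν (fun m ω => (a * (ω 0 ^ 2 - ω 1 ^ 2) + gradExchGamma g m ω) ^ 2) =
      2 * chi * a ^ 2 + starE ν (fun m ω => gradExchGamma g m ω ^ 2) := by
  rw [starE_add_gradExchGamma_sq hg, starE_gradExchGamma_sq hg,
    norm_smul_energy_sub_add_sq (cls_mem_quadL2 ν hg)]

/-- After the cross term has vanished, `a` enters only through `2 a S - λ χ a²` with `S` the value
of `starStar`. The maximizer `a = S / (λ χ)` gives `S² / (λ χ)`. -/
lemma normValues_subset_normValuesBis (hlam : 0 < lam) (φ : Fn C) :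
    normValues ν γ lam φ ⊆ normValuesBis ν γ lam φ := by
  rintro _ ⟨g, hg, rfl⟩
  obtain ⟨r, hr⟩ := exists_mem_quadFn_Icc hg.mem_quadFn
  refine ⟨g, starStar ν φ / (lam * chi), hg, ?_⟩
  rw [normValuesBis_value_eq hr]
  have := chi_pos
  field_simp
  ring

lemma exists_normValues_ge (hlam : 0 < lam) {φ : Fn C} {v : ℝ}
    (hv : v ∈ normValuesBis ν γ lam φ) : ∃ w ∈ normValues ν γ lam φ, v ≤ w := by
  obtain ⟨g, a, hg, rfl⟩ := hv
  obtain ⟨r, hr⟩ := exists_mem_quadFn_Icc hg.mem_quadFn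
  refine ⟨_, ⟨g, hg, rfl⟩, ?_⟩
  rw [normValuesBis_value_eq hr]
  have hc := chi_pos
  have h : 1 / lam * (starStar ν φ ^ 2 / chi) - 2 * a * starStar ν φ + lam * chi * a ^ 2 =
      (lam * chi)⁻¹ * (starStar ν φ - lam * chi * a) ^ 2 := by
    field_simp
    ring
  have h2 : 0 ≤ (lam * chi)⁻¹ * (starStar ν φ - lam * chi * a) ^ 2 := by positivity
  linarith

end Variational

/-! ### The equation in the box -/

lemma IsQZero.mem_quadFn_supportRadius {φ : Fn C} (hφ : IsQZero φ) :
    φ ∈ quadFn C (Set.Icc (-(supportRadius φ : ℤ)) (supportRadius φ)) := by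
  refine mem_quadFn_of_localOn hφ.mem_quadFn ?_
  have hne : {s : ℕ | 0 < s ∧ LocalOn φ (Set.Icc (-(s : ℤ)) (s : ℤ))}.Nonempty := by
    obtain ⟨Λ, hΛ⟩ := hφ.1
    refine ⟨Λ.sup Int.natAbs + 1, Nat.succ_pos _, fun m m' ω ω' h => hΛ m m' ω ω' fun x hx => ?_⟩
    have hx' : x.natAbs ≤ Λ.sup Int.natAbs := Finset.le_sup (f := Int.natAbs) hx
    refine h x ?_
    rw [Set.mem_Icc]
    push_cast
    omega
  exact (Nat.sInf_mem hne).2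

section Box

variable (ν : Measure (Set.Icc C⁻¹ C)) [IsProbabilityMeasure ν]

lemma isL2_boxSum {φ : Fn C} (hφ : IsL2 ν φ) (ℓ : ℕ) : IsL2 ν (boxSum φ ℓ) ∧
    cls ν (boxSum φ ℓ) =
      (chainRep ν).sumBox (ℓ - (supportRadius φ + 1 : ℕ)) (cls ν φ) := by
  have h : boxSum φ ℓ = ∑ x ∈ Finset.Icc (-((ℓ : ℤ) - (supportRadius φ + 1 : ℕ)))
      ((ℓ : ℤ) - (supportRadius φ + 1 : ℕ)), shift x φ := by
    ext m ω
    simp only [boxSum, Finset.sum_apply, Nat.cast_add, Nat.cast_one, sub_sub]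
  have h1 : ∀ x ∈ Finset.Icc (-((ℓ : ℤ) - (supportRadius φ + 1 : ℕ)))
      ((ℓ : ℤ) - (supportRadius φ + 1 : ℕ)), IsL2 ν (shift x φ) := fun x _ => hφ.shift x
  rw [h, cls_sum h1, LatticeRep.sumBox_apply]
  exact ⟨IsL2.sum h1, Finset.sum_congr rfl fun x _ => cls_shift hφ x⟩

lemma exists_isInverse {γ lam : ℝ} (hγ : 0 < γ) (hlam : 0 < lam) {φ : Fn C} (hφ : IsQZero φ)
    (ℓ : ℕ) : ∃ u, IsInverse ν γ lam ℓ u (boxSum φ ℓ) := by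
  have hq := hφ.mem_quadFn_supportRadius
  obtain ⟨h1, h2⟩ := isL2_boxSum ν (isL2_of_mem_quadFn ν hq) ℓ
  have hmem : cls ν (boxSum φ ℓ) ∈ quadL2 ν (Set.Icc (-(ℓ : ℤ)) ℓ) := by
    rw [h2, LatticeRep.sumBox_apply]
    refine Submodule.sum_mem _ fun x hx => shift_mem_quadL2 (cls_mem_quadL2 ν hq) ?_
    rw [Finset.mem_Icc, ← abs_le] at hx
    push_cast at hx
    omega
  obtain ⟨v, hv⟩ := quadL2_le_range_gen hγ hlam ℓ hmem
  obtain ⟨u, hu, huv⟩ := exists_cls_eq (-v)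
  refine ⟨u, (isInverse_iff h1).2 ⟨hu, ?_⟩⟩
  rw [huv, map_neg, neg_neg, hv]

lemma isLUB_and_tendsto_seminormSq {γ lam : ℝ} (hγ : 0 < γ) (hlam : 0 < lam) {φ : Fn C}
    (hφ : IsQZero φ) {u : ℕ → Fn C} (hu : ∀ ℓ, IsInverse ν γ lam ℓ (u ℓ) (boxSum φ ℓ)) :
    IsLUB (normValues ν γ lam φ) (seminormSq ν γ lam φ) ∧
    IsLUB (normValuesBis ν γ lam φ) (seminormSq ν γ lam φ) ∧
    Tendsto (fun ℓ : ℕ => (2 * (ℓ : ℝ))⁻¹ * starE ν (fun m ω => u ℓ m ω * boxSum φ ℓ m ω))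
      atTop (𝓝 (seminormSq ν γ lam φ)) := by
  have hq := hφ.mem_quadFn_supportRadius
  set s := supportRadius φ with hs
  have hbox := isL2_boxSum ν (isL2_of_mem_quadFn ν hq)
  have hu' : ∀ ℓ, IsL2 ν (u ℓ) ∧ -(chainRep ν).gen γ lam ℓ (cls ν (u ℓ)) =
      (chainRep ν).sumBox (ℓ - (s + 1 : ℕ)) (cls ν φ) := fun ℓ => by
    rw [hs, ← (hbox ℓ).2]
    exact (isInverse_iff (hbox ℓ).1).1 (hu ℓ)
  have hA : ∀ ℓ, starE ν (fun m ω => u ℓ m ω * boxSum φ ℓ m ω) =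
      inner ℝ (cls ν (u ℓ)) ((chainRep ν).sumBox (ℓ - (s + 1 : ℕ)) (cls ν φ)) := fun ℓ => by
    rw [hs, ← (hbox ℓ).2, inner_cls (hu' ℓ).1 (hbox ℓ).1]
  simp only [hA]
  refine isLUB_and_tendsto_sSup (normValues_subset_normValuesBis hlam φ)
    (fun v hv => exists_normValues_ge hlam hv) ?_ ?_
  · rintro _ ⟨g, a, hg, rfl⟩ ε hε
    obtain ⟨r, hr⟩ := exists_mem_quadFn_Icc hg.mem_quadFn
    -- The truncation `0` of the test function is arbitrary: the limit does not depend on it.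
    have ht := tendsto_normValuesBis (ν := ν) γ lam hq hr a (Nat.le_succ s) 0
    filter_upwards [ht.eventually_const_le (sub_lt_self _ hε)] with ℓ hℓ
    refine hℓ.trans (mul_le_mul_of_nonneg_left ?_ (by positivity))
    exact (chainRep ν).functional_le hγ hlam (hu' ℓ).2 _
  · intro ε hε
    -- Chosen so that the loss `2B²` is `ε / 3`; the other two thirds pay for the boundary terms and
    -- for the convergence of the functional.
    have hB : 0 < Real.sqrt (ε / 6) := Real.sqrt_pos.2 (by positivity)
    have hB2 : 2 * Real.sqrt (ε / 6) ^ 2 = ε / 3 := by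
      rw [Real.sq_sqrt (by positivity)]; ring
    have happ := approx_of_mem_quadL2 hγ hlam
      (quadL2_mono (Set.subset_univ _) (cls_mem_quadL2 ν hq)) _ hB
    have htb : (chainRep ν).TransBdd γ lam (s + 1) (cls ν φ) :=
      quadL2_transBdd (quadL2_mono (Set.Icc_subset_Icc (by push_cast; omega)
        (by push_cast; omega)) (cls_mem_quadL2 ν hq)) hγ hlam
    obtain ⟨v, hv, a, q, h⟩ := LatticeRep.Approx.eventually_le hγ hlam happ htb
    obtain ⟨g, hg, rfl⟩ := exists_cls_eq_of_mem_quadL2 ν hv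
    obtain ⟨r, hr⟩ := exists_mem_quadFn_Icc hg
    have ht := tendsto_normValuesBis (ν := ν) γ lam hq hr a (Nat.le_succ s) q
    refine ⟨_, ⟨g, a, isQuadratic_of_mem_quadFn hg, rfl⟩, ?_⟩
    filter_upwards [h _ (fun ℓ => (hu' ℓ).2) (ε / 3) (by positivity),
      ht.eventually_le_const (lt_add_of_pos_right _ (show 0 < ε / 3 by positivity))]
      with ℓ h1 h2
    refine h1.trans ?_
    rw [hB2]
    linarith

end Box

end HarmonicChain
end

theorem mainTheorem7 (C : ℝ) (_hC : 0 < C) (ν : MeasureTheory.Measure (Set.Icc C⁻¹ C))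
    [MeasureTheory.IsProbabilityMeasure ν] (γ lam : ℝ) (hγ : 0 < γ) (hlam : 0 < lam)
    (φ : HarmonicChain.Fn C) (hφ : HarmonicChain.IsQZero φ) :
    (∀ ℓ : ℕ, ∃ u : HarmonicChain.Fn C,
      HarmonicChain.IsInverse ν γ lam ℓ u (HarmonicChain.boxSum φ ℓ)) ∧
    IsLUB (HarmonicChain.normValues ν γ lam φ) (HarmonicChain.seminormSq ν γ lam φ) ∧
    IsLUB (HarmonicChain.normValuesBis ν γ lam φ) (HarmonicChain.seminormSq ν γ lam φ) ∧
    ∀ u : ℕ → HarmonicChain.Fn C,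
      (∀ ℓ : ℕ, HarmonicChain.IsInverse ν γ lam ℓ (u ℓ) (HarmonicChain.boxSum φ ℓ)) →
      Filter.Tendsto
        (fun ℓ : ℕ => (2 * (ℓ : ℝ))⁻¹ *
          HarmonicChain.starE ν (fun m ω => u ℓ m ω * HarmonicChain.boxSum φ ℓ m ω))
        Filter.atTop (nhds (HarmonicChain.seminormSq ν γ lam φ)) := by
  -- The statements on the suprema do not mention solutions, but their finiteness comes from
  -- comparison with the box quantities, so one choice of solutions is needed.
  choose u hu using HarmonicChain.exists_isInverse ν hγ hlam hφ
  obtain ⟨h1, h2, _⟩ := HarmonicChain.isLUB_and_tendsto_seminormSq ν hγ hlam hφ hu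
  exact ⟨fun ℓ => ⟨u ℓ, hu ℓ⟩, h1, h2, fun u hu =>
    (HarmonicChain.isLUB_and_tendsto_seminormSq ν hγ hlam hφ hu).2.2⟩
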